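/- Let $K$ be a commutative ring (for example $K=\mathbb C$), let $d\in K$ be invertible, and let $s\in K$ be an invertible element with $s^2=d$ (written $s=d^{1/2}$). Let $n\ge 0$. **Chromatic algebra.** Let $R$ be a rectangle with $n$ marked points on its bottom side and $n$ on its top side. Let $\mathcal G_n$ be the set of isotopy classes (relative to $\partial R$) of finite planar graphs embedded in $R$ that meet $\partial R$ exactly in the $2n$ marked points, each of which is the end of exactly one edge and is not counted as a vertex. Loops, multiple edges, isolated vertices and components that are simple closed curves without vertices are allowed. An edge is *inner* if it does not end on $\partial R$. Let $\mathcal F_n$ be the free $K$-module on $\mathcal G_n$, with multiplication given by vertical stacking. For $Q\in K$ the chromatic algebra $\mathcal C_n^{Q}$ is the quotient of $\mathcal F_n$ by the ideal generated by the following relations between graphs: 1. $G=G/e-G\backslash e$ if $e$ is an inner edge that is not a loop; 2. $G=(Q-1)\,G\backslash e$ if $e$ is a loop or a simple closed curve component of $G$; 3. $G=0$ if $G$ has a $1$-valent vertex in the interior of $R$; 4. a $2$-valent vertex may be deleted and the two edge ends at it merged (a component that is a loop at a $2$-valent vertex becomes a simple closed curve), and an isolated vertex may be deleted. **Temperley–Lieb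 algebra.** $TL_{m}^{d}$ is the $K$-algebra of formal linear combinations of isotopy classes of compact $1$-dimensional submanifolds of a rectangle meeting its boundary exactly in $m$ marked points at the bottom and $m$ at the top, multiplied by vertical stacking, modulo the relation that a circle may be removed by multiplying by $d$. **The map $\phi$.** For a graph $G\in\mathcal G_n$, let $\phi(G)\in TL_{2n}^{d}$ be obtained by doubling every marked point, replacing each edge of $G$ by the linear combination (two parallel strands) $-\frac1d$ (two turn-backs), and replacing each vertex of valence $r$ by the boundary of a small neighbourhood of it in $G$ with the factor $d^{(r-2)/2}=s^{\,r-2}$. **Lemma.** The map $\phi$ induces a well-defined $K$-linear multiplicative map $$\phi\colon \mathcal C_n^{d^2}\longrightarrow TL_{2n}^{d}$$ (it need not preserve the unit: the image of $1$ is the idempotent given by $n$ copies of $\phi$ of a single strand side by side), and this homomorphism is injective. -/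

import Mathlib

/-!
# Planar graphs in a rectangle, the chromatic algebra and the Temperley-Lieb algebra

A planar graph embedded in a rectangle `R`, with marked points on the bottom and on the top side,
is drawn in general position with respect to the height function: read from the bottom to the top,
it is a finite sequence of layers, and each layer consists of vertical strands together with
exactly one local minimum of an edge (`cup`), one local maximum of an edge (`cap`), or one vertex.
Two such drawings are isotopic (relative to the boundary of `R`) if and only if they are related by
the standard moves `Move` below.
-/

namespace PlanarAlg

/-- The elementary pieces of a drawing: a local minimum of an edge, a local maximum of an edge,
and an interior vertex with `a` edges leaving downwards and `b` edges leaving upwards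
(so its valence is `a + b`, and `a = b = 0` is an isolated vertex). -/
inductive Piece : Type
  | cup : Piece
  | cap : Piece
  | vertex (a b : ℕ) : Piece

/-- The number of strands at the bottom of a piece. -/
def Piece.dom : Piece → ℕ
  | .cup => 0
  | .cap => 2
  | .vertex a _ => a

/-- The number of strands at the top of a piece. -/
def Piece.cod : Piece → ℕ
  | .cup => 2
  | .cap => 0
  | .vertex _ b => b

/-- A layer: an elementary piece with `pos` vertical strands to its left
(and any number of vertical strands to its right). -/
structure Layer : Type where
  pos : ℕ
  piece : Piece

/-- A sequence of layers, read from the bottom to the top; the product is vertical stacking. -/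
abbrev Word : Type := FreeMonoid Layer

/-- The layer with the piece `p` to the right of `l` strands, as a word. -/
def layer (l : ℕ) (p : Piece) : Word := FreeMonoid.of ⟨l, p⟩

/-- A local minimum; it creates the strands in positions `l` and `l + 1`. -/
def cup (l : ℕ) : Word := layer l .cup

/-- A local maximum; it joins the strands in positions `l` and `l + 1`. -/
def cap (l : ℕ) : Word := layer l .cap

/-- A vertex; it replaces the strands in positions `l, …, l + a - 1` by `b` strands. -/
def vertex (l a b : ℕ) : Word := layer l (.vertex a b)

/-- The word `w` moved `k` positions to the right. -/
def shift (k : ℕ) : Word →* Word :=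
  FreeMonoid.map fun x => ⟨k + x.pos, x.piece⟩

/-- `Runs w n m`: the sequence of layers `w` is a drawing in the rectangle
with `n` endpoints at the bottom and `m` endpoints at the top.
In each layer, `r` is the number of strands to the right of the piece. -/
def Runs : List Layer → ℕ → ℕ → Prop
  | [], n, m => n = m
  | x :: w, n, m =>
      ∃ r, n = x.pos + x.piece.dom + r ∧ Runs w (x.pos + x.piece.cod + r) m

theorem Runs.append {w : List Layer} : ∀ {n m k : ℕ} {w' : List Layer},
    Runs w n m → Runs w' m k → Runs (w ++ w') n k := by
  induction w with
  | nil => intro n m k w' h h'; cases h; exact h'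
  | cons x w ih =>
    rintro n m k w' ⟨r, hr, h⟩ h'
    exact ⟨r, hr, ih h h'⟩

/-- The drawings of planar graphs with `n` endpoints at the bottom and `m` endpoints at the top.
Simple closed curves and isolated vertices are allowed as components. -/
def graphDrawings (n m : ℕ) : Set Word := {w | Runs w.toList n m}

/-- The drawings of compact one-dimensional submanifolds of the rectangle: there are no vertices. -/
def curveDrawings (n m : ℕ) : Set Word :=
  {w | Runs w.toList n m ∧ ∀ x ∈ w.toList, x.piece = .cup ∨ x.piece = .cap}

/-- The drawings of planar graphs with `n` endpoints at the bottom and at the top, under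
vertical stacking. -/
def graphMonoid (n : ℕ) : Submonoid Word where
  carrier := graphDrawings n n
  one_mem' := rfl
  mul_mem' h h' := Runs.append h h'

/-- The drawings of one-dimensional submanifolds with `m` endpoints at the bottom and at the top,
under vertical stacking. -/
def curveMonoid (m : ℕ) : Submonoid Word where
  carrier := curveDrawings m m
  one_mem' := ⟨rfl, fun x hx => by simp at hx⟩
  mul_mem' h h' := ⟨Runs.append h.1 h'.1, fun x hx => by
    rw [FreeMonoid.toList_mul, List.mem_append] at hx
    exact hx.elim (h.2 x) (h'.2 x)⟩

/-- The elementary moves between drawings of isotopic planar graphs. -/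
inductive Move : Word → Word → Prop
  /-- two pieces that lie side by side exchange their heights -/
  | exchange (l k : ℕ) (p p' : Piece) :
      Move (layer l p * layer (l + p.cod + k) p') (layer (l + p.dom + k) p' * layer l p)
  /-- a minimum and a maximum of a strand cancel -/
  | straighten_left (l : ℕ) : Move (cup l * cap (l + 1)) 1
  /-- a minimum and a maximum of a strand cancel, in the mirror image -/
  | straighten_right (l : ℕ) : Move (cup (l + 1) * cap l) 1
  /-- the rightmost upper edge at a vertex is turned over the right and arrives from below -/
  | turn_right (l a b : ℕ) : Move (vertex l a (b + 1) * cap (l + b)) (vertex l (a + 1) b)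
  /-- the leftmost upper edge at a vertex is turned over the left and arrives from below -/
  | turn_left (l a b : ℕ) : Move (vertex (l + 1) a (b + 1) * cap l) (vertex l (a + 1) b)

/-- Isotopy of drawings: the congruence generated by the moves, applied anywhere in a drawing. -/
def isotopy (S : Submonoid Word) : Con S :=
  conGen fun w w' => ∃ u v x y : Word, Move x y ∧ (w : Word) = u * x * v ∧ (w' : Word) = u * y * v

/-- Isotopy classes of planar graphs in the rectangle with `n` endpoints at the bottom and `n` at
the top; the product is vertical stacking. -/
abbrev PlanarGraph (n : ℕ) : Type := (isotopy (graphMonoid n)).Quotient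

/-- Isotopy classes of one-dimensional submanifolds of the rectangle with `m` endpoints at the
bottom and `m` at the top; the product is vertical stacking. -/
abbrev PlanarCurve (m : ℕ) : Type := (isotopy (curveMonoid m)).Quotient

noncomputable section

variable {K : Type*} [CommRing K]

/-- The isotopy class of a drawing, as a generator of the free algebra on planar graphs. -/
def gr (K : Type*) [CommRing K] {n : ℕ} {w : Word} (h : w ∈ graphDrawings n n) :
    MonoidAlgebra K (PlanarGraph n) :=
  MonoidAlgebra.of K (PlanarGraph n) ((isotopy (graphMonoid n)).mk' ⟨w, h⟩)

/-- The isotopy class of a drawing, as a generator of the free algebra on planar curves. -/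
def cv (K : Type*) [CommRing K] {m : ℕ} {w : Word} (h : w ∈ curveDrawings m m) :
    MonoidAlgebra K (PlanarCurve m) :=
  MonoidAlgebra.of K (PlanarCurve m) ((isotopy (curveMonoid m)).mk' ⟨w, h⟩)

/-- The defining relations of the chromatic algebra. In each of them the words `u` and `v` are the
parts of the drawing below and above the part that is changed. -/
inductive ChromaticRel (Q : K) (n : ℕ) :
    MonoidAlgebra K (PlanarGraph n) → MonoidAlgebra K (PlanarGraph n) → Prop
  /-- `G = G/e - G\e` for an edge `e` between two different interior vertices; after an isotopy `e`
  is vertical, and all other edges at its lower (upper) end leave downwards (upwards). -/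
  | contract (u v : Word) (l a b : ℕ)
      (h : u * (vertex l a 1 * vertex l 1 b) * v ∈ graphDrawings n n)
      (h₁ : u * vertex l a b * v ∈ graphDrawings n n)
      (h₂ : u * (vertex l a 0 * vertex l 0 b) * v ∈ graphDrawings n n) :
      ChromaticRel Q n (gr K h) (gr K h₁ - gr K h₂)
  /-- `G = (Q - 1) G\e` for a loop `e` at an interior vertex; after an isotopy the `a` edges at this
  vertex outside the loop leave downwards, and the `c` edges inside the loop leave upwards.
  The word `X` is the part of the graph that the loop encloses. -/
  | loop (u v X : Word) (l a c : ℕ) (hX : X ∈ graphDrawings c 0)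
      (h : u * (vertex l a (c + 2) * shift (l + 1) X * cap l) * v ∈ graphDrawings n n)
      (h₁ : u * (vertex l a c * shift l X) * v ∈ graphDrawings n n) :
      ChromaticRel Q n (gr K h) ((Q - 1) • gr K h₁)
  /-- `G = (Q - 1) G\e` for a component `e` that is a simple closed curve, enclosing `X`. -/
  | circle (u v X : Word) (l : ℕ) (hX : X ∈ graphDrawings 0 0)
      (h : u * (cup l * shift (l + 1) X * cap l) * v ∈ graphDrawings n n)
      (h₁ : u * shift l X * v ∈ graphDrawings n n) :
      ChromaticRel Q n (gr K h) ((Q - 1) • gr K h₁)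
  /-- `G = 0` if `G` has a 1-valent interior vertex. -/
  | leaf (u v : Word) (l : ℕ) (h : u * vertex l 0 1 * v ∈ graphDrawings n n) :
      ChromaticRel Q n (gr K h) 0
  /-- A 2-valent vertex may be deleted and its two edges merged. -/
  | smooth (u v : Word) (l : ℕ) (h : u * vertex l 1 1 * v ∈ graphDrawings n n)
      (h₁ : u * v ∈ graphDrawings n n) :
      ChromaticRel Q n (gr K h) (gr K h₁)
  /-- An isolated vertex may be deleted. -/
  | isolated (u v : Word) (l : ℕ) (h : u * vertex l 0 0 * v ∈ graphDrawings n n)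
      (h₁ : u * v ∈ graphDrawings n n) :
      ChromaticRel Q n (gr K h) (gr K h₁)

/-- The chromatic algebra of degree `n` with parameter `Q` over `K`: the quotient of the free
algebra on isotopy classes of planar graphs by the ideal generated by the relations. -/
abbrev ChromaticAlgebra (Q : K) (n : ℕ) : Type _ := RingQuot (ChromaticRel Q n)

/-- The element of the chromatic algebra given by a graph. -/
def ChromaticAlgebra.graph (Q : K) (n : ℕ) {w : Word} (h : w ∈ graphDrawings n n) :
    ChromaticAlgebra Q n :=
  RingQuot.mkAlgHom K (ChromaticRel Q n) (gr K h)

/-- The defining relation of the Temperley-Lieb algebra: a circle may be removed by multiplying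
with `d`. -/
inductive TemperleyLiebRel (d : K) (m : ℕ) :
    MonoidAlgebra K (PlanarCurve m) → MonoidAlgebra K (PlanarCurve m) → Prop
  | circle (u v : Word) (l : ℕ) (h : u * (cup l * cap l) * v ∈ curveDrawings m m)
      (h₁ : u * v ∈ curveDrawings m m) :
      TemperleyLiebRel d m (cv K h) (d • cv K h₁)

/-- The Temperley-Lieb algebra of degree `m` with parameter `d` over `K`, in its planar loop
representation. -/
abbrev TemperleyLieb (d : K) (m : ℕ) : Type _ := RingQuot (TemperleyLiebRel d m)

/-- The element of the Temperley-Lieb algebra given by a planar one-dimensional submanifold. -/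
def TemperleyLieb.curve (d : K) (m : ℕ) {w : Word} (h : w ∈ curveDrawings m m) :
    TemperleyLieb d m :=
  RingQuot.mkAlgHom K (TemperleyLiebRel d m) (cv K h)

open Classical in
/-- The element of the Temperley-Lieb algebra given by a formal linear combination of drawings
of curves with `m` endpoints at the bottom and at the top
(a word that is not such a drawing would be ignored). -/
def TemperleyLieb.ofDrawings (d : K) (m : ℕ) (x : MonoidAlgebra K Word) : TemperleyLieb d m :=
  x.coeff.sum fun w c =>
    c • (if h : w ∈ curveDrawings m m then TemperleyLieb.curve d m h else 0)

/-- The second Jones-Wenzl projector on the strands in positions `l` and `l + 1`: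
two parallel strands minus `1/d` times a turn-back at the bottom and one at the top. -/
def projector (d : Kˣ) (l : ℕ) : MonoidAlgebra K Word :=
  1 - ((d⁻¹ : Kˣ) : K) • MonoidAlgebra.of K Word (cap l * cup l)

/-- The projectors on `k` neighbouring pairs of strands, the first of them in positions
`2 * l` and `2 * l + 1`. -/
def projectors (d : Kˣ) (l k : ℕ) : MonoidAlgebra K Word :=
  ((List.range k).map fun i => projector d (2 * (l + i))).prod

/-- The lower half of the boundary of a neighbourhood of a vertex with `a` edges below: the `a`
pairs of strands that arrive are joined to their neighbours, and two strands remain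
in positions `p` and `p + 1`. -/
def lowerHalf (p : ℕ) : ℕ → Word
  | 0 => cup p
  | a + 1 => cap (p + 1) ^ a

/-- The upper half of the boundary of a neighbourhood of a vertex with `b` edges above. -/
def upperHalf (p : ℕ) : ℕ → Word
  | 0 => cap p
  | b + 1 => cup (p + 1) ^ b

/-- The value of `φ` on a layer. Every strand is doubled; a vertex of valence `r` is replaced by the
boundary of a neighbourhood of it, with the factor `s ^ (r - 2)`, where `s ^ 2 = d`. Projectors are
put on the edges that a vertex sends upwards and on each local minimum of an edge. -/
def phiLayer (d s : Kˣ) : Layer → MonoidAlgebra K Word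
  | ⟨l, .cup⟩ => MonoidAlgebra.of K Word (cup (2 * l) * cup (2 * l + 1)) * projectors d l 1
  | ⟨l, .cap⟩ => MonoidAlgebra.of K Word (cap (2 * l + 1) * cap (2 * l))
  | ⟨l, .vertex a b⟩ =>
      ((s ^ ((a : ℤ) + b - 2) : Kˣ) : K) •
        MonoidAlgebra.of K Word (lowerHalf (2 * l) a * upperHalf (2 * l) b) * projectors d l b

/-- The formal linear combination of drawings of curves that `φ` assigns to a drawing `w` of a graph
with `n` endpoints at the bottom: each edge is replaced by the projector. (Each edge
starts at the bottom of the rectangle, or leaves a vertex upwards, or has a local minimum, so it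
carries at least one projector; as the projectors are idempotent in the Temperley-Lieb algebra,
further projectors on the same edge change nothing.) -/
def phiDrawing (d s : Kˣ) (n : ℕ) (w : Word) : MonoidAlgebra K Word :=
  projectors d 0 n * FreeMonoid.lift (phiLayer d s) w

end

end PlanarAlg

/-! ## Drawings and local equivalence -/

namespace PlanarAlg

noncomputable section

open Submodule

variable {K : Type*} [CommRing K] {A : Type*} [AddCommGroup A] [Module K A]

/-! ### Widths of drawings -/

/-! All computations are local. `Eqv f m N x y` says that two parts of a drawing are interchangeable
under a linear map `f`, whatever lies below (with matching width) and above. Since `f` is arbitrary,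
one calculus of isotopies serves evaluations in the chromatic algebra and in the Temperley-Lieb
algebra.

Well-definedness. Projectors are idempotent and slide along doubled edges, so a row of projectors at
the bottom can be recreated at every height (`projectors_mul_phiHom_mul`). Under such a row, doubled
drawings respect the isotopy moves (`phiHom_move`). Relation 1 is the definition of the projector on
an edge: two parallel strands merge the two vertex boundaries, turn-backs separate them, and the
powers of `s` match (`phiHom_contract`). A projector kills a turn-back, hence leaves vanish. A loop
or circle may enclose a subgraph; this has no upper endpoints, so it first reduces to a combination
of maxima (`exists_caps`), after which a circle is worth `d ^ 2 - 1` and a loop `d - 1/d` before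
normalisation. Multiplicativity again follows from recreating projectors between two stacked
drawings.

Injectivity. A linear left inverse is constructed. Colour black the intervals between strands `2 *
i` and `2 * i + 1`. Horizontal intervals cut the black regions of a curve diagram into discs; each
disc becomes a vertex, and the result is summed with weights over all ways to let an interval carry
an edge or stay empty. By relation 1, a graph with an edge plus the graph without it is the
contracted graph, so neighbouring discs fuse (`disc_fuse_right`, `disc_fuse_left`) and the sum does
not depend on the cutting. A circle around a black disc contributes `s ^ 2 = d` (`disc_zero_zero`);
a circle around a white hole contributes `Q / d`, which equals `d` because `Q = d ^ 2`
(`disc_bubble`). Thus the state sum descends to the Temperley-Lieb algebra. On it a projector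
annihilates an empty interval and fixes an occupied one (`stateRep_projector`), so a doubled graph
retains only the state in which all its edges are present, and the weights cancel the factors at the
vertices (`stateEval_phiDrawing`). -/

theorem one_mem_graphDrawings (n : ℕ) : (1 : Word) ∈ graphDrawings n n := rfl

theorem of_mul_mem_graphDrawings {x : Layer} {w : Word} {n m : ℕ} :
    FreeMonoid.of x * w ∈ graphDrawings n m ↔
      ∃ r, n = x.pos + x.piece.dom + r ∧ w ∈ graphDrawings (x.pos + x.piece.cod + r) m :=
  Iff.rfl

theorem mul_mem_graphDrawings {u v : Word} {n m k : ℕ} (hu : u ∈ graphDrawings n m)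
    (hv : v ∈ graphDrawings m k) : u * v ∈ graphDrawings n k :=
  Runs.append hu hv

theorem Runs.split {w w' : List Layer} : ∀ {n k : ℕ}, Runs (w ++ w') n k →
    ∃ m, Runs w n m ∧ Runs w' m k := by
  induction w with
  | nil => intro n k h; exact ⟨n, rfl, h⟩
  | cons x w ih =>
    rintro n k ⟨r, hr, h⟩
    obtain ⟨m, h1, h2⟩ := ih h
    exact ⟨m, ⟨r, hr, h1⟩, h2⟩

theorem Runs.unique {w : List Layer} : ∀ {n m m' : ℕ}, Runs w n m → Runs w n m' → m = m' := by
  induction w with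
  | nil => intro n m m' h h'; cases h; exact h'
  | cons x w ih =>
    rintro n m m' ⟨r, hr, h⟩ ⟨r', hr', h'⟩
    obtain rfl : r = r' := by omega
    exact ih h h'

theorem mul_mem_graphDrawings_iff {u v : Word} {n m k : ℕ} (hu : u ∈ graphDrawings n m) :
    u * v ∈ graphDrawings n k ↔ v ∈ graphDrawings m k := by
  refine ⟨fun h => ?_, mul_mem_graphDrawings hu⟩
  obtain ⟨m', h1, h2⟩ := Runs.split h
  rwa [← Runs.unique hu h1] at h2

theorem exists_of_mul_mem_graphDrawings {u v : Word} {n k : ℕ} (h : u * v ∈ graphDrawings n k) :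
    ∃ m, u ∈ graphDrawings n m ∧ v ∈ graphDrawings m k :=
  Runs.split h

theorem shift_mem_graphDrawings {w : Word} (l r : ℕ) : ∀ {n m : ℕ}, w ∈ graphDrawings n m →
    shift l w ∈ graphDrawings (l + n + r) (l + m + r) := by
  induction w using FreeMonoid.inductionOn' with
  | one => rintro n m h; cases h; exact rfl
  | of_mul x w ih =>
    rintro n m ⟨s, hs, h⟩
    rw [map_mul]
    refine ⟨s + r, ?_, ?_⟩
    · change l + n + r = l + x.pos + x.piece.dom + (s + r)
      omega
    · change shift l w ∈ graphDrawings (l + x.pos + x.piece.cod + (s + r)) _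
      rw [show l + x.pos + x.piece.cod + (s + r) = l + (x.pos + x.piece.cod + s) + r by omega]
      exact ih h

theorem cup_mem {l n m : ℕ} (h : l ≤ n) (hm : m = n + 2) : cup l ∈ graphDrawings n m :=
  ⟨n - l, by simp [Piece.dom]; omega, show _ = _ by simp [Piece.cod]; omega⟩

theorem cap_mem {l n m : ℕ} (h : l + 2 ≤ n) (hm : n = m + 2) : cap l ∈ graphDrawings n m :=
  ⟨n - l - 2, by simp [Piece.dom]; omega, show _ = _ by simp [Piece.cod]; omega⟩

theorem vertex_mem {l a b n m : ℕ} (h : l + a ≤ n) (hm : n + b = m + a) :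
    vertex l a b ∈ graphDrawings n m :=
  ⟨n - l - a, by simp [Piece.dom]; omega, show _ = _ by simp [Piece.cod]; omega⟩

theorem cap_mul_mem {l n m : ℕ} {w : Word} (h : w ∈ graphDrawings n m) (hl : l ≤ n) :
    cap l * w ∈ graphDrawings (n + 2) m :=
  mul_mem_graphDrawings (cap_mem (by omega) rfl) h

theorem cup_pow_mem {l n : ℕ} (h : l ≤ n) (k m : ℕ) (hm : m = n + 2 * k) :
    cup l ^ k ∈ graphDrawings n m := by
  subst hm
  induction k with
  | zero => exact rfl
  | succ k ih =>
    rw [pow_succ]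
    exact mul_mem_graphDrawings ih (cup_mem (by omega) (by omega))

theorem cap_pow_mem {l n : ℕ} (k m : ℕ) (h : l ≤ n) (hm : m = n + 2 * k) :
    cap l ^ k ∈ graphDrawings m n := by
  subst hm
  induction k with
  | zero => exact rfl
  | succ k ih =>
    rw [pow_succ']
    exact mul_mem_graphDrawings (cap_mem (by omega) (by omega)) ih

@[simp] theorem shift_cup (k l : ℕ) : shift k (cup l) = cup (k + l) := rfl
@[simp] theorem shift_cap (k l : ℕ) : shift k (cap l) = cap (k + l) := rfl
@[simp] theorem shift_of (k : ℕ) (x : Layer) :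
    shift k (FreeMonoid.of x) = layer (k + x.pos) x.piece := rfl

/-! ### Linear combinations of drawings -/

/-- The linear combinations of drawings with `n` endpoints below and `m` endpoints above. -/
def homs (K : Type*) [CommRing K] (n m : ℕ) : Submodule K (MonoidAlgebra K Word) :=
  span K (MonoidAlgebra.of K Word '' graphDrawings n m)

theorem of_mem_homs {w : Word} {n m : ℕ} (h : w ∈ graphDrawings n m) :
    MonoidAlgebra.of K Word w ∈ homs K n m :=
  subset_span ⟨w, h, rfl⟩

theorem one_mem_homs (n : ℕ) : (1 : MonoidAlgebra K Word) ∈ homs K n n := by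
  rw [← map_one (MonoidAlgebra.of K Word)]
  exact of_mem_homs (one_mem_graphDrawings n)

theorem mul_mem_homs {x y : MonoidAlgebra K Word} {n m k : ℕ} (hx : x ∈ homs K n m)
    (hy : y ∈ homs K m k) : x * y ∈ homs K n k := by
  induction hx using span_induction with
  | mem x hx =>
    obtain ⟨u, hu, rfl⟩ := hx
    induction hy using span_induction with
    | mem y hy =>
      obtain ⟨v, hv, rfl⟩ := hy
      rw [← map_mul]
      exact of_mem_homs (mul_mem_graphDrawings hu hv)
    | zero => rw [mul_zero]; exact zero_mem _
    | add y y' _ _ h h' => rw [mul_add]; exact add_mem h h'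
    | smul c y _ h => rw [mul_smul_comm]; exact smul_mem _ c h
  | zero => rw [zero_mul]; exact zero_mem _
  | add x x' _ _ h h' => rw [add_mul]; exact add_mem h h'
  | smul c x _ h => rw [smul_mul_assoc]; exact smul_mem _ c h

/-- The linear combinations of drawings moved to the right. -/
def shiftHom (K : Type*) [CommRing K] (k : ℕ) : MonoidAlgebra K Word →ₐ[K] MonoidAlgebra K Word :=
  MonoidAlgebra.mapDomainAlgHom K K (shift k)

@[simp] theorem shiftHom_of (k : ℕ) (w : Word) :
    shiftHom K k (MonoidAlgebra.of K Word w) = MonoidAlgebra.of K Word (shift k w) := by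
  simp [shiftHom]

theorem shift_zero : shift 0 = MonoidHom.id Word := by
  refine FreeMonoid.hom_eq fun x => ?_
  rw [shift_of, zero_add]
  rfl

theorem algHom_ext_of {B : Type*} [Ring B] [Algebra K B] {f g : MonoidAlgebra K Word →ₐ[K] B}
    (h : ∀ w, f (MonoidAlgebra.of K Word w) = g (MonoidAlgebra.of K Word w)) : f = g :=
  MonoidAlgebra.algHom_ext' (MonoidHom.ext h) (by ext)

theorem linearMap_congr_of {f g : MonoidAlgebra K Word →ₗ[K] A}
    (h : ∀ w, f (MonoidAlgebra.of K Word w) = g (MonoidAlgebra.of K Word w)) : f = g := by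
  refine MonoidAlgebra.lhom_ext' fun w => LinearMap.ext_ring ?_
  exact h w

@[simp] theorem shiftHom_zero (x : MonoidAlgebra K Word) : shiftHom K 0 x = x := by
  have : shiftHom K 0 = AlgHom.id K _ := algHom_ext_of fun w => by
    rw [shiftHom_of, shift_zero]; rfl
  rw [this]; rfl

theorem shiftHom_mem_homs {x : MonoidAlgebra K Word} {n m : ℕ} (l r : ℕ) (hx : x ∈ homs K n m) :
    shiftHom K l x ∈ homs K (l + n + r) (l + m + r) := by
  induction hx using span_induction with
  | mem x hx =>
    obtain ⟨u, hu, rfl⟩ := hx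
    rw [shiftHom_of]
    exact of_mem_homs (shift_mem_graphDrawings l r hu)
  | zero => rw [map_zero]; exact zero_mem _
  | add x x' _ _ h h' => rw [map_add]; exact add_mem h h'
  | smul c x _ h => rw [map_smul]; exact smul_mem _ c h

/-! ### Local equivalence -/

/-- `x` and `y` can be exchanged, as parts with `N` strands below of a drawing
with `m` endpoints at the bottom, without changing the value of `f`. -/
def Eqv (f : MonoidAlgebra K Word →ₗ[K] A) (m N : ℕ) (x y : MonoidAlgebra K Word) : Prop :=
  ∀ u ∈ graphDrawings m N, ∀ z,
    f (MonoidAlgebra.of K Word u * x * z) = f (MonoidAlgebra.of K Word u * y * z)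

namespace Eqv

variable {f : MonoidAlgebra K Word →ₗ[K] A} {m N N' : ℕ} {x x' y y' z : MonoidAlgebra K Word}

@[refl] theorem refl (x : MonoidAlgebra K Word) : Eqv f m N x x := fun _ _ _ => rfl

theorem of_eq (h : x = y) : Eqv f m N x y := h ▸ refl x

@[symm] theorem symm (h : Eqv f m N x y) : Eqv f m N y x := fun u hu z => (h u hu z).symm

@[trans] theorem trans (h : Eqv f m N x y) (h' : Eqv f m N y z) : Eqv f m N x z :=
  fun u hu w => (h u hu w).trans (h' u hu w)

theorem add (h : Eqv f m N x y) (h' : Eqv f m N x' y') : Eqv f m N (x + x') (y + y') :=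
  fun u hu w => by simp only [mul_add, add_mul, map_add, h u hu w, h' u hu w]

theorem sub (h : Eqv f m N x y) (h' : Eqv f m N x' y') : Eqv f m N (x - x') (y - y') :=
  fun u hu w => by simp only [mul_sub, sub_mul, map_sub, h u hu w, h' u hu w]

theorem smul (c : K) (h : Eqv f m N x y) : Eqv f m N (c • x) (c • y) :=
  fun u hu w => by simp only [mul_smul_comm, smul_mul_assoc, map_smul, h u hu w]

theorem mul_right (h : Eqv f m N x y) (z : MonoidAlgebra K Word) : Eqv f m N (x * z) (y * z) :=
  fun u hu w => by simpa only [mul_assoc] using h u hu (z * w)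

theorem mul_left (hz : z ∈ homs K N N') (h : Eqv f m N' x y) : Eqv f m N (z * x) (z * y) := by
  intro u hu w
  induction hz using span_induction with
  | mem z hz =>
    obtain ⟨v, hv, rfl⟩ := hz
    simpa only [← mul_assoc, ← map_mul] using h (u * v) (mul_mem_graphDrawings hu hv) w
  | zero => simp only [zero_mul, mul_zero]
  | add z z' _ _ h h' => simp only [add_mul, mul_add, map_add, h, h']
  | smul c z _ h => simp only [mul_smul_comm, smul_mul_assoc, map_smul, h]

theorem mul_left_of {w : Word} (hw : w ∈ graphDrawings N N') (h : Eqv f m N' x y) :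
    Eqv f m N (MonoidAlgebra.of K Word w * x) (MonoidAlgebra.of K Word w * y) :=
  h.mul_left (of_mem_homs hw)

end Eqv

/-- `f` is defined on the drawings with `n` endpoints at the bottom and at the top, and depends
only on their isotopy classes. -/
structure IsotopyInvariant (f : MonoidAlgebra K Word →ₗ[K] A) (n : ℕ) : Prop where
  eq_zero : ∀ w, w ∉ graphDrawings n n → f (MonoidAlgebra.of K Word w) = 0
  move : ∀ u v x y, Move x y → u * x * v ∈ graphDrawings n n → u * y * v ∈ graphDrawings n n →
    f (MonoidAlgebra.of K Word (u * x * v)) = f (MonoidAlgebra.of K Word (u * y * v))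

/-- To check a local equivalence it suffices to place it between words. -/
theorem Eqv.of_words {f : MonoidAlgebra K Word →ₗ[K] A} {m N : ℕ} {x y : MonoidAlgebra K Word}
    (h : ∀ u ∈ graphDrawings m N, ∀ v,
      f (MonoidAlgebra.of K Word u * x * MonoidAlgebra.of K Word v) =
        f (MonoidAlgebra.of K Word u * y * MonoidAlgebra.of K Word v)) : Eqv f m N x y := by
  intro u hu z
  have := linearMap_congr_of (f := f ∘ₗ LinearMap.mulLeft K (MonoidAlgebra.of K Word u * x))
    (g := f ∘ₗ LinearMap.mulLeft K (MonoidAlgebra.of K Word u * y)) (fun w => h u hu w)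
  exact LinearMap.congr_fun this z

section

variable {f : MonoidAlgebra K Word →ₗ[K] A} {n N : ℕ}

local notation "ι" => MonoidAlgebra.of K Word

/-- If the word above has the wrong width, both sides vanish by `eq_zero`. This is why `Eqv` needs
no width condition on the upper context. -/
theorem IsotopyInvariant.eqv (hf : IsotopyInvariant f n) {x y : Word} (h : Move x y) {M : ℕ}
    (hx : x ∈ graphDrawings N M) (hy : y ∈ graphDrawings N M) : Eqv f n N (ι x) (ι y) := by
  refine Eqv.of_words fun u hu v => ?_
  rw [← map_mul, ← map_mul, ← map_mul, ← map_mul]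
  by_cases hv : v ∈ graphDrawings M n
  · exact hf.move u v x y h (mul_mem_graphDrawings (mul_mem_graphDrawings hu hx) hv)
      (mul_mem_graphDrawings (mul_mem_graphDrawings hu hy) hv)
  · rw [hf.eq_zero, hf.eq_zero]
    · rwa [mul_mem_graphDrawings_iff (mul_mem_graphDrawings hu hy)]
    · rwa [mul_mem_graphDrawings_iff (mul_mem_graphDrawings hu hx)]

theorem IsotopyInvariant.exchange_layer (hf : IsotopyInvariant f n) (l k : ℕ) (p p' : Piece)
    (h : l + p.dom + k + p'.dom ≤ N) :
    Eqv f n N (ι (layer l p) * ι (layer (l + p.cod + k) p'))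
      (ι (layer (l + p.dom + k) p') * ι (layer l p)) := by
  rw [← map_mul, ← map_mul]
  obtain ⟨r, rfl⟩ := Nat.exists_eq_add_of_le h
  refine hf.eqv (Move.exchange l k p p') (M := l + p.cod + k + p'.cod + r) ?_ ?_
  · exact ⟨k + p'.dom + r, by dsimp; omega, r, by dsimp; omega, rfl⟩
  · exact ⟨r, by dsimp, k + p'.cod + r, by dsimp; omega, show _ = _ by dsimp; omega⟩

/-- The layers of `y` pass the piece `p` one at a time; the strands to the left of a layer within
`y` are added to the gap `k`. -/
theorem IsotopyInvariant.exchange_layer_word (hf : IsotopyInvariant f n) (l k : ℕ) (p : Piece)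
    (y : Word) : ∀ {c e N : ℕ}, y ∈ graphDrawings c e → l + p.dom + k + c ≤ N →
    Eqv f n N (ι (layer l p) * ι (shift (l + p.cod + k) y))
      (ι (shift (l + p.dom + k) y) * ι (layer l p)) := by
  induction y using FreeMonoid.inductionOn' with
  | one => intro c e N _ _; simp only [map_one, mul_one, one_mul]; rfl
  | of_mul q y ih =>
    rintro c e N ⟨s, hs, h⟩ hN
    dsimp at hs h
    rw [map_mul, map_mul, map_mul, map_mul, shift_of, shift_of]
    have h1 := hf.exchange_layer (N := N) l (k + q.pos) p q.piece (by omega)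
    rw [← add_assoc, ← add_assoc] at h1
    obtain ⟨r, rfl⟩ := Nat.exists_eq_add_of_le hN
    have h2 := (ih (N := l + p.dom + k + q.pos + q.piece.cod + (s + r)) h (by omega)).mul_left_of
      (N := l + p.dom + k + c + r) (w := layer (l + p.dom + k + q.pos) q.piece)
      ⟨s + r, by dsimp; omega, rfl⟩
    simpa only [mul_assoc] using (h1.mul_right _).trans (by simpa only [mul_assoc] using h2)

theorem IsotopyInvariant.exchange_words (hf : IsotopyInvariant f n) (x : Word) {y : Word}
    {c e : ℕ} (hy : y ∈ graphDrawings c e) (l k : ℕ) : ∀ {a b N : ℕ}, x ∈ graphDrawings a b →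
    l + a + k + c ≤ N →
    Eqv f n N (ι (shift l x) * ι (shift (l + b + k) y))
      (ι (shift (l + a + k) y) * ι (shift l x)) := by
  induction x using FreeMonoid.inductionOn' with
  | one => intro a b N h _; cases h; simp only [map_one, mul_one, one_mul]; rfl
  | of_mul p x ih =>
    rintro a b N ⟨s, hs, h⟩ hN
    dsimp at hs h
    rw [map_mul, map_mul, shift_of]
    obtain ⟨r, rfl⟩ := Nat.exists_eq_add_of_le hN
    have h1 := (ih (N := l + p.pos + p.piece.cod + (s + k + c + r)) h (by omega)).mul_left_of
      (N := l + a + k + c + r) (w := layer (l + p.pos) p.piece)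
      ⟨s + k + c + r, by dsimp; omega, rfl⟩
    have h2 := (hf.exchange_layer_word (l + p.pos) (s + k) p.piece y (N := l + a + k + c + r)
      hy (by omega)).mul_right (ι (shift l x))
    rw [show l + p.pos + p.piece.cod + (s + k) = l + (p.pos + p.piece.cod + s) + k by omega,
      show l + p.pos + p.piece.dom + (s + k) = l + a + k by omega] at h2
    simpa only [mul_assoc] using h1.trans (by simpa only [mul_assoc] using h2)

/-- Linear combinations of drawings that lie side by side exchange their heights. -/
theorem IsotopyInvariant.exchange (hf : IsotopyInvariant f n) {x y : MonoidAlgebra K Word}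
    {a b c e : ℕ} (hx : x ∈ homs K a b) (hy : y ∈ homs K c e) (l k : ℕ)
    (hN : l + a + k + c ≤ N) :
    Eqv f n N (shiftHom K l x * shiftHom K (l + b + k) y)
      (shiftHom K (l + a + k) y * shiftHom K l x) := by
  induction hx using span_induction with
  | mem x hx =>
    obtain ⟨u, hu, rfl⟩ := hx
    induction hy using span_induction with
    | mem y hy =>
      obtain ⟨v, hv, rfl⟩ := hy
      simpa only [shiftHom_of] using hf.exchange_words u hv l k hu hN
    | zero => simp only [map_zero, mul_zero, zero_mul]; rfl
    | add y y' _ _ h h' => simpa only [map_add, add_mul, mul_add] using h.add h'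
    | smul c y _ h => simpa only [map_smul, smul_mul_assoc, mul_smul_comm] using h.smul c
  | zero => simp only [map_zero, mul_zero, zero_mul]; rfl
  | add x x' _ _ h h' => simpa only [map_add, add_mul, mul_add] using h.add h'
  | smul c x _ h => simpa only [map_smul, smul_mul_assoc, mul_smul_comm] using h.smul c

theorem IsotopyInvariant.cup_cap_succ (hf : IsotopyInvariant f n) {l : ℕ} (h : l + 1 ≤ N) :
    Eqv f n N (ι (cup l) * ι (cap (l + 1))) 1 := by
  rw [← map_mul, ← map_one ι]
  exact hf.eqv (Move.straighten_left l) (M := N)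
    (mul_mem_graphDrawings (cup_mem (by omega) rfl) (cap_mem (by omega) rfl)) rfl

theorem IsotopyInvariant.cup_succ_cap (hf : IsotopyInvariant f n) {l : ℕ} (h : l + 1 ≤ N) :
    Eqv f n N (ι (cup (l + 1)) * ι (cap l)) 1 := by
  rw [← map_mul, ← map_one ι]
  exact hf.eqv (Move.straighten_right l) (M := N)
    (mul_mem_graphDrawings (cup_mem (by omega) rfl) (cap_mem (by omega) rfl)) rfl

end

end

end PlanarAlg

/-! ## Calculus of vertices -/

namespace PlanarAlg

noncomputable section

variable {K : Type*} [CommRing K] {A : Type*} [AddCommGroup A] [Module K A]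
variable {f : MonoidAlgebra K Word →ₗ[K] A} {Q : K} {n N : ℕ}

local notation "ι" => MonoidAlgebra.of K Word

/-- `f` is an isotopy invariant of planar graphs that satisfies the chromatic relations. -/
structure ChromaticInvariant (f : MonoidAlgebra K Word →ₗ[K] A) (Q : K) (n : ℕ) : Prop
    extends IsotopyInvariant f n where
  contract : ∀ {N l a b}, l + a ≤ N → Eqv f n N (ι (vertex l a 1) * ι (vertex l 1 b))
    (ι (vertex l a b) - ι (vertex l a 0) * ι (vertex l 0 b))
  loop : ∀ {N l a c X}, X ∈ graphDrawings c 0 → l + a ≤ N →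
    Eqv f n N (ι (vertex l a (c + 2)) * ι (shift (l + 1) X) * ι (cap l))
      ((Q - 1) • (ι (vertex l a c) * ι (shift l X)))
  circle : ∀ {N l X}, X ∈ graphDrawings 0 0 → l ≤ N →
    Eqv f n N (ι (cup l) * ι (shift (l + 1) X) * ι (cap l)) ((Q - 1) • ι (shift l X))
  leaf : ∀ {N l}, l ≤ N → Eqv f n N (ι (vertex l 0 1)) 0
  smooth : ∀ {N l}, l + 1 ≤ N → Eqv f n N (ι (vertex l 1 1)) 1
  isolated : ∀ {N l}, l ≤ N → Eqv f n N (ι (vertex l 0 0)) 1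

/-! ### Turning edges at a vertex -/

namespace IsotopyInvariant

variable (hf : IsotopyInvariant f n)
include hf

theorem vertex_mul_cap_right {l a b : ℕ} (h : l + a + 1 ≤ N) :
    Eqv f n N (ι (vertex l a (b + 1)) * ι (cap (l + b))) (ι (vertex l (a + 1) b)) := by
  rw [← map_mul]
  obtain ⟨r, rfl⟩ := Nat.exists_eq_add_of_le h
  exact hf.eqv (Move.turn_right l a b) (M := l + b + r)
    (mul_mem_graphDrawings (m := l + b + 2 + r) (vertex_mem (by omega) (by omega))
      (cap_mem (by omega) (by omega))) (vertex_mem (by omega) (by omega))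

theorem vertex_mul_cap_left {l a b : ℕ} (h : l + a + 1 ≤ N) :
    Eqv f n N (ι (vertex (l + 1) a (b + 1)) * ι (cap l)) (ι (vertex l (a + 1) b)) := by
  rw [← map_mul]
  obtain ⟨r, rfl⟩ := Nat.exists_eq_add_of_le h
  exact hf.eqv (Move.turn_left l a b) (M := l + b + r)
    (mul_mem_graphDrawings (m := l + b + 2 + r) (vertex_mem (by omega) (by omega))
      (cap_mem (by omega) (by omega))) (vertex_mem (by omega) (by omega))

/-- The inverse of the turning move: write the lower edge as an upper edge followed by a maximum,
raise the minimum past the vertex, and straighten the resulting zigzag. -/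
theorem cup_mul_vertex_right {l a b : ℕ} (h : l + a ≤ N) :
    Eqv f n N (ι (cup (l + a)) * ι (vertex l (a + 1) b)) (ι (vertex l a (b + 1))) := by
  obtain ⟨r, rfl⟩ := Nat.exists_eq_add_of_le h
  have h1 := (hf.vertex_mul_cap_right (N := l + a + r + 2) (l := l) (a := a) (b := b)
    (by omega)).symm.mul_left_of (N := l + a + r) (cup_mem (l := l + a) (by omega) rfl)
  have h2 := (hf.exchange_layer (N := l + a + r) l 0 (.vertex a (b + 1)) .cup
    (by simp [Piece.dom])).symm.mul_right (ι (cap (l + b)))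
  have h3 := (hf.cup_succ_cap (N := l + b + 1 + r) (l := l + b) (by omega)).mul_left_of
    (N := l + a + r) (w := vertex l a (b + 1)) (vertex_mem (by omega) (by omega))
  refine h1.trans ?_
  rw [mul_one] at h3
  rw [mul_assoc, mul_assoc] at h2
  exact h2.trans h3

theorem cup_mul_vertex_left {l a b : ℕ} (h : l + a ≤ N) :
    Eqv f n N (ι (cup l) * ι (vertex (l + 1) (a + 1) b)) (ι (vertex l a (b + 1))) := by
  obtain ⟨r, rfl⟩ := Nat.exists_eq_add_of_le h
  have h1 := (hf.vertex_mul_cap_left (N := l + a + r + 2) (l := l + 1) (a := a) (b := b)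
    (by omega)).symm.mul_left_of (N := l + a + r) (cup_mem (l := l) (by omega) rfl)
  have h2 := (hf.exchange_layer (N := l + a + r) l 0 .cup (.vertex a (b + 1))
    (by simp [Piece.dom])).mul_right (ι (cap (l + 1)))
  have h3 := (hf.cup_cap_succ (N := l + b + 1 + r) (l := l) (by omega)).mul_left_of
    (N := l + a + r) (w := vertex l a (b + 1)) (vertex_mem (by omega) (by omega))
  refine h1.trans ?_
  rw [mul_one] at h3
  rw [mul_assoc, mul_assoc] at h2
  exact h2.trans h3

end IsotopyInvariant

/-! ### Consequences of contraction and loop removal -/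

namespace ChromaticInvariant

variable (hf : ChromaticInvariant f Q n)
include hf

/-- Contraction of the edge from the rightmost upper end of a vertex to the leftmost lower end
of another vertex. -/
theorem fuse_right {l a b c e : ℕ} (h : l + a + c ≤ N) :
    Eqv f n N (ι (vertex l a (b + 1)) * ι (vertex (l + b) (c + 1) e))
      (ι (vertex l (a + c) (b + e)) - ι (vertex l a b) * ι (vertex (l + b) c e)) := by
  induction c generalizing e N with
  | zero =>
    induction b generalizing l a N with
    | zero => simpa only [zero_add, add_zero] using hf.contract (N := N) (l := l) (a := a) h
    | succ b ih =>
      -- The upper edges to the left of the contracted one are turned down one by one, until the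
      -- contracted edge is the only upper edge of the lower vertex.
      have h1 := (hf.cup_mul_vertex_left (N := N) (l := l) (a := a) (b := b + 1)
        (by omega)).symm.mul_right (ι (vertex (l + (b + 1)) (0 + 1) e))
      have h2 := (ih (N := N + 2) (l := l + 1) (a := a + 1) (by omega)).mul_left_of
        (cup_mem (l := l) (n := N) (by omega) rfl)
      have h3 := (hf.cup_mul_vertex_left (N := N) (l := l) (a := a) (b := b + e) (by omega))
      have h4 := (hf.cup_mul_vertex_left (N := N) (l := l) (a := a) (b := b)
        (by omega)).mul_right (ι (vertex (l + (b + 1)) 0 e))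
      refine h1.trans ?_
      rw [mul_assoc]
      rw [show l + 1 + b = l + (b + 1) by omega] at h2
      refine h2.trans ?_
      rw [mul_sub, ← mul_assoc, show b + 1 + e = b + e + 1 by omega]
      exact h3.sub h4
  | succ c ih =>
    -- Likewise the surplus lower edges of the upper vertex are turned up over the right.
    have h1 := (hf.vertex_mul_cap_right (N := N - a + b + 1) (l := l + b) (a := c + 1) (b := e)
      (by omega)).symm.mul_left_of (N := N) (w := vertex l a (b + 1))
      (vertex_mem (by omega) (by omega))
    have h2 := (ih (N := N) (e := e + 1) (by omega)).mul_right (ι (cap (l + b + e)))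
    have h3 := hf.vertex_mul_cap_right (N := N) (l := l) (a := a + c) (b := b + e) (by omega)
    have h4 := (hf.vertex_mul_cap_right (N := N - a + b) (l := l + b) (a := c) (b := e)
      (by omega)).mul_left_of (N := N) (w := vertex l a b) (vertex_mem (by omega) (by omega))
    refine h1.trans ?_
    rw [← mul_assoc]
    refine h2.trans ?_
    rw [sub_mul, mul_assoc, ← add_assoc b e 1, add_assoc l b e]
    rw [add_assoc l b e] at h4
    exact h3.sub h4

/-- Contraction of the edge from the leftmost upper end of a vertex to the rightmost lower end
of another vertex. -/
theorem fuse_left {l a b c e : ℕ} (h : l + c + a ≤ N) :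
    Eqv f n N (ι (vertex (l + c) a (b + 1)) * ι (vertex l (c + 1) e))
      (ι (vertex l (c + a) (e + b)) - ι (vertex (l + c) a b) * ι (vertex l c e)) := by
  induction c generalizing e l N with
  | zero =>
    induction b generalizing a N with
    | zero => simpa only [zero_add, add_zero] using hf.contract (N := N) (l := l) (a := a) h
    | succ b ih =>
      have h1 := (hf.cup_mul_vertex_right (N := N) (l := l) (a := a) (b := b + 1)
        (by omega)).symm.mul_right (ι (vertex l (0 + 1) e))
      have h2 := (ih (N := N + 2) (a := a + 1) (by omega)).mul_left_of
        (cup_mem (l := l + a) (n := N) (by omega) rfl)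
      have h3 := (hf.cup_mul_vertex_right (N := N) (l := l) (a := a) (b := e + b) (by omega))
      have h4 := (hf.cup_mul_vertex_right (N := N) (l := l) (a := a) (b := b)
        (by omega)).mul_right (ι (vertex l 0 e))
      refine h1.trans ?_
      rw [mul_assoc]
      refine h2.trans ?_
      rw [mul_sub, ← mul_assoc, zero_add, zero_add]
      exact h3.sub h4
  | succ c ih =>
    have h1 := (hf.vertex_mul_cap_left (N := N - a + b + 1) (l := l) (a := c + 1) (b := e)
      (by omega)).symm.mul_left_of (N := N) (w := vertex (l + (c + 1)) a (b + 1))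
      (vertex_mem (by omega) (by omega))
    have h2 := (ih (N := N) (l := l + 1) (e := e + 1) (by omega)).mul_right (ι (cap l))
    have h3 := hf.vertex_mul_cap_left (N := N) (l := l) (a := c + a) (b := e + b) (by omega)
    have h4 := (hf.vertex_mul_cap_left (N := N - a + b) (l := l) (a := c) (b := e)
      (by omega)).mul_left_of (N := N) (w := vertex (l + (c + 1)) a b)
      (vertex_mem (by omega) (by omega))
    refine h1.trans ?_
    rw [← mul_assoc]
    rw [show l + 1 + c = l + (c + 1) by omega] at h2
    refine h2.trans ?_
    rw [sub_mul, mul_assoc, show e + 1 + b = e + b + 1 by omega,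
      show c + 1 + a = c + a + 1 by omega]
    exact h3.sub h4

/-- The loop relation allows upper edges only inside the loop. Here the loop is empty, and the `b`
edges to its right are first turned down. -/
theorem vertex_mul_cap_self {l a b : ℕ} (h : l + a ≤ N) :
    Eqv f n N (ι (vertex l a (b + 2)) * ι (cap l)) ((Q - 1) • ι (vertex l a b)) := by
  induction b generalizing a N with
  | zero =>
    simpa only [map_one, mul_one, zero_add] using
      hf.loop (N := N) (l := l) (a := a) (c := 0) (X := 1) rfl h
  | succ b ih =>
    have h1 := (hf.cup_mul_vertex_right (N := N) (l := l) (a := a) (b := b + 2)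
      (by omega)).symm.mul_right (ι (cap l))
    have h2 := (ih (N := N + 2) (a := a + 1) (by omega)).mul_left_of
        (cup_mem (l := l + a) (n := N) (by omega) rfl)
    have h3 := (hf.cup_mul_vertex_right (N := N) (l := l) (a := a) (b := b)
      (by omega)).smul (Q - 1)
    rw [mul_assoc] at h1
    rw [mul_smul_comm] at h2
    exact (h1.trans h2).trans h3

/-- Contracting one of two parallel edges turns the other into a loop, worth `Q - 1`; the deletion
term leaves a single edge, whose contraction subtracts one more merged vertex and adds the separated
pair. -/
theorem bubble {l a b : ℕ} (h : l + a ≤ N) :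
    Eqv f n N (ι (vertex l a 2) * ι (vertex l 2 b))
      ((Q - 2) • ι (vertex l a b) + ι (vertex l a 0) * ι (vertex l 0 b)) := by
  have h1 := (hf.vertex_mul_cap_left (N := N - a + 2) (l := l) (a := 1) (b := b)
      (by omega)).symm.mul_left_of (N := N) (w := vertex l a 2) (vertex_mem (by omega) (by omega))
  have h2 := (hf.fuse_right (N := N) (l := l) (a := a) (b := 1) (c := 0) (e := b + 1)
    (by omega)).mul_right (ι (cap l))
  have h3 := hf.vertex_mul_cap_self (N := N) (l := l) (a := a) (b := b) h
  have h4 := (hf.vertex_mul_cap_left (N := N - a + 1) (l := l) (a := 0) (b := b)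
      (by omega)).mul_left_of (N := N) (w := vertex l a 1) (vertex_mem (by omega) (by omega))
  have h5 := hf.contract (N := N) (l := l) (a := a) (b := b) h
  refine h1.trans ?_
  rw [← mul_assoc]
  refine h2.trans ?_
  rw [sub_mul, mul_assoc, show 1 + (b + 1) = b + 2 by omega, add_zero]
  refine (h3.sub (h4.trans h5)).trans (Eqv.of_eq ?_)
  module

theorem vertex_zero_two {l : ℕ} (h : l ≤ N) : Eqv f n N (ι (vertex l 0 2)) (ι (cup l)) := by
  have h1 := (hf.cup_mul_vertex_right (N := N) (l := l) (a := 0) (b := 1) h).symm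
  have h2 := (hf.smooth (N := N + 2) (l := l) (by omega)).mul_left_of
    (cup_mem (l := l) (n := N) (by omega) rfl)
  rw [mul_one] at h2
  exact h1.trans h2

theorem vertex_two_zero {l : ℕ} (h : l + 2 ≤ N) : Eqv f n N (ι (vertex l 2 0)) (ι (cap l)) := by
  have h1 := (hf.vertex_mul_cap_right (N := N) (l := l) (a := 1) (b := 0) (by omega)).symm
  have h2 := (hf.smooth (N := N) (l := l) (by omega)).mul_right (ι (cap l))
  rw [one_mul] at h2
  exact h1.trans h2

theorem vertex_one_zero {l : ℕ} (h : l + 1 ≤ N) : Eqv f n N (ι (vertex l 1 0)) 0 := by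
  have h1 := (hf.vertex_mul_cap_right (N := N) (l := l) (a := 0) (b := 0) (by omega)).symm
  have h2 := (hf.leaf (N := N) (l := l) (by omega)).mul_right (ι (cap l))
  rw [zero_mul] at h2
  exact h1.trans h2

end ChromaticInvariant

end

end PlanarAlg

/-! ## State operators -/

namespace PlanarAlg

noncomputable section

variable {K : Type*} [CommRing K] {A : Type*} [AddCommGroup A] [Module K A]
variable {f : MonoidAlgebra K Word →ₗ[K] A} {Q : K} {n N : ℕ}

local notation "ι" => MonoidAlgebra.of K Word

/-! ### Sums over lists of booleans -/

/-- The sum of `F` over all lists of booleans of length `b`. -/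
def boolSum {M : Type*} [AddCommMonoid M] : ℕ → (List Bool → M) → M
  | 0, F => F []
  | b + 1, F => boolSum b (fun Y => F (true :: Y)) + boolSum b (fun Y => F (false :: Y))

section boolSum

variable {M : Type*} [AddCommMonoid M] {M' : Type*} [AddCommMonoid M']

theorem boolSum_congr {b : ℕ} {F G : List Bool → M} (h : ∀ Y, Y.length = b → F Y = G Y) :
    boolSum b F = boolSum b G := by
  induction b generalizing F G with
  | zero => exact h [] rfl
  | succ b ih =>
    rw [boolSum, boolSum, ih fun Y hY => h (true :: Y) (by simp [hY]),
      ih fun Y hY => h (false :: Y) (by simp [hY])]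

theorem boolSum_succ (b : ℕ) (F : List Bool → M) : boolSum (b + 1) F =
    boolSum b (fun Y => F (true :: Y)) + boolSum b (fun Y => F (false :: Y)) := rfl

theorem boolSum_zero (b : ℕ) : boolSum b (fun _ => (0 : M)) = 0 := by
  induction b with
  | zero => rfl
  | succ b ih => rw [boolSum, ih, add_zero]

theorem boolSum_add_distrib (b : ℕ) (F G : List Bool → M) :
    boolSum b (fun Y => F Y + G Y) = boolSum b F + boolSum b G := by
  induction b generalizing F G with
  | zero => rfl
  | succ b ih => rw [boolSum, ih, ih, boolSum, boolSum, add_add_add_comm]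

theorem map_boolSum {E : Type*} [FunLike E M M'] [AddMonoidHomClass E M M'] (g : E) (b : ℕ)
    (F : List Bool → M) : g (boolSum b F) = boolSum b (fun Y => g (F Y)) := by
  induction b generalizing F with
  | zero => rfl
  | succ b ih => rw [boolSum, map_add, ih, ih, boolSum]

theorem boolSum_append (a b : ℕ) (F : List Bool → M) :
    boolSum (a + b) F = boolSum a (fun X => boolSum b (fun Y => F (X ++ Y))) := by
  induction a generalizing F with
  | zero => rw [zero_add]; rfl
  | succ a ih => rw [add_right_comm, boolSum, ih, ih]; rfl

theorem boolSum_comm (a b : ℕ) (F : List Bool → List Bool → M) :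
    boolSum a (fun X => boolSum b (fun Y => F X Y)) =
      boolSum b (fun Y => boolSum a (fun X => F X Y)) := by
  induction a generalizing F with
  | zero => rfl
  | succ a ih => simp only [boolSum]; rw [ih, ih, boolSum_add_distrib]

theorem boolSum_replicate (b : ℕ) (F : List Bool → M)
    (h : ∀ Y, Y.length = b → Y ≠ List.replicate b true → F Y = 0) :
    boolSum b F = F (List.replicate b true) := by
  induction b generalizing F with
  | zero => rfl
  | succ b ih =>
    rw [boolSum, ih _ fun Y hY hne => h _ (by simp [hY]) (by simpa [List.replicate_succ] using hne),
      boolSum_congr (G := fun _ => 0) fun Y hY =>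
        h _ (by simp [hY]) (by simp [List.replicate_succ]),
      boolSum_zero, add_zero, List.replicate_succ]

end boolSum

theorem boolSum_smul (c : K) (b : ℕ) (F : List Bool → MonoidAlgebra K Word) :
    c • boolSum b F = boolSum b (fun Y => c • F Y) :=
  map_boolSum (LinearMap.lsmul K (MonoidAlgebra K Word) c) b F

theorem mul_boolSum (x : MonoidAlgebra K Word) (b : ℕ) (F : List Bool → MonoidAlgebra K Word) :
    x * boolSum b F = boolSum b (fun Y => x * F Y) :=
  map_boolSum (LinearMap.mulLeft K x) b F

theorem Eqv.boolSum {b : ℕ} {F G : List Bool → MonoidAlgebra K Word}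
    (h : ∀ Y, Y.length = b → Eqv f n N (F Y) (G Y)) : Eqv f n N (boolSum b F) (boolSum b G) := by
  induction b generalizing F G with
  | zero => exact h [] rfl
  | succ b ih =>
    exact (ih fun Y hY => h _ (by simp [hY])).add (ih fun Y hY => h _ (by simp [hY]))

/-! ### The operator of a disc -/

/-- The number of strands in a state. -/
def cnt (S : List Bool) : ℕ := S.count true

@[simp] theorem cnt_nil : cnt [] = 0 := rfl
@[simp] theorem cnt_true (S : List Bool) : cnt (true :: S) = cnt S + 1 := List.count_cons_self
@[simp] theorem cnt_false (S : List Bool) : cnt (false :: S) = cnt S := by simp [cnt]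
@[simp] theorem cnt_append (S T : List Bool) : cnt (S ++ T) = cnt S + cnt T := List.count_append
@[simp] theorem cnt_replicate (k : ℕ) : cnt (List.replicate k true) = k := by simp [cnt]

/-- The weight of a vertex with `x` edges below and `y` edges above in a disc with `b` upper
intervals. -/
def weight (s : Kˣ) (x y b : ℕ) : K := ((s ^ ((2 : ℤ) - x + y - 2 * b) : Kˣ) : K)

/-- The operator of a disc with `a` intervals below and `b` intervals above: a sum over the
sets of upper intervals that carry a strand. -/
def disc (s : Kˣ) (i a b : ℕ) : Module.End K (List Bool → MonoidAlgebra K Word) where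
  toFun F S := if i + a ≤ S.length then boolSum b fun Y =>
      weight s (cnt ((S.drop i).take a)) (cnt Y) b •
        (ι (vertex (cnt (S.take i)) (cnt ((S.drop i).take a)) (cnt Y)) *
          F (S.take i ++ (Y ++ S.drop (i + a))))
    else 0
  map_add' F G := by
    funext S
    simp only [Pi.add_apply]
    split_ifs
    · simp only [mul_add, smul_add, boolSum_add_distrib]
    · rw [add_zero]
  map_smul' c F := by
    funext S
    simp only [Pi.smul_apply, RingHom.id_apply]
    split_ifs
    · simp only [mul_smul_comm, smul_comm _ c, boolSum_smul]
    · rw [smul_zero]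

variable (s : Kˣ)

theorem disc_apply {i a : ℕ} (b : ℕ) (F : List Bool → MonoidAlgebra K Word) {U X : List Bool}
    (B : List Bool) (hU : U.length = i) (hX : X.length = a) :
    disc s i a b F (U ++ (X ++ B)) = boolSum b fun Y => weight s (cnt X) (cnt Y) b •
      (ι (vertex (cnt U) (cnt X) (cnt Y)) * F (U ++ (Y ++ B))) := by
  subst hU hX
  simp only [disc, LinearMap.coe_mk, AddHom.coe_mk]
  rw [if_pos (by simp), List.take_left, List.drop_left, List.take_left, ← List.append_assoc,
    ← List.length_append, List.drop_left]

/-- The value zero on states that are too short is what makes drawings of the wrong width evaluate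
to zero later. -/
theorem disc_apply_of_lt {i a : ℕ} (b : ℕ) (F : List Bool → MonoidAlgebra K Word) {S : List Bool}
    (h : S.length < i + a) : disc s i a b F S = 0 := by
  simp only [disc, LinearMap.coe_mk, AddHom.coe_mk]
  rw [if_neg (by omega)]

theorem exists_append (S : List Bool) {i a : ℕ} (h : i + a ≤ S.length) :
    ∃ U X B : List Bool, U.length = i ∧ X.length = a ∧ S = U ++ (X ++ B) := by
  refine ⟨S.take i, (S.drop i).take a, (S.drop i).drop a, ?_, ?_, ?_⟩
  · simp; omega
  · simp; omega
  · rw [List.take_append_drop, List.take_append_drop]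

/-- In the exponent of `weight` each disc counts `2` and each upper interval `-2`, so a black region
cut into discs receives a power of `d = s ^ 2` governed by its Euler characteristic. An edge counts
`1` at its lower end and `-1` at its upper end, so inner edges cancel. -/
theorem weight_mul_weight (x y b x' y' b' x'' y'' b'' : ℕ)
    (h : (2 : ℤ) - x + y - 2 * b + (2 - x' + y' - 2 * b') = 2 - x'' + y'' - 2 * b'') :
    weight s x y b * weight s x' y' b' = weight s x'' y'' b'' := by
  rw [weight, weight, weight, ← Units.val_mul, ← zpow_add, h]

theorem disc_congr {i a b : ℕ} {F G : List Bool → MonoidAlgebra K Word} {S : List Bool}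
    (h : ∀ S', S'.length + a = S.length + b → Eqv f n (cnt S') (F S') (G S')) :
    Eqv f n (cnt S) (disc s i a b F S) (disc s i a b G S) := by
  by_cases hS : i + a ≤ S.length
  · obtain ⟨U, X, B, hU, hX, rfl⟩ := exists_append S hS
    rw [disc_apply s _ _ _ hU hX, disc_apply s _ _ _ hU hX]
    refine Eqv.boolSum fun Y hY => Eqv.smul _ (Eqv.mul_left_of ?_ (h _ ?_))
    · exact vertex_mem (by simp only [cnt_append]; omega)
        (by simp only [cnt_append]; omega)
    · simp only [List.length_append]; omega
  · rw [disc_apply_of_lt s _ _ (by omega), disc_apply_of_lt s _ _ (by omega)]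

/-- Discs that lie side by side commute. -/
theorem disc_exchange (hf : IsotopyInvariant f n) {i k a b c e : ℕ}
    (F : List Bool → MonoidAlgebra K Word) {S : List Bool} (hS : i + a + k + c ≤ S.length) :
    Eqv f n (cnt S) (disc s i a b (disc s (i + b + k) c e F) S)
      (disc s (i + a + k) c e (disc s i a b F) S) := by
  obtain ⟨U, X, B, hU, hX, rfl⟩ := exists_append S (show i + a ≤ S.length by omega)
  obtain ⟨V, Z, B, hV, hZ, rfl⟩ := exists_append B (i := k) (a := c) (by simp at hS; omega)
  rw [disc_apply s _ _ _ hU hX]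
  have h1 : U ++ (X ++ (V ++ (Z ++ B))) = (U ++ (X ++ V)) ++ (Z ++ B) := by simp
  rw [h1, disc_apply s _ _ _ (by simp; omega) hZ]
  have h2 : ∀ Y, Y.length = b → disc s (i + b + k) c e F (U ++ (Y ++ (V ++ (Z ++ B)))) =
      boolSum e fun W => weight s (cnt Z) (cnt W) e •
        (ι (vertex (cnt (U ++ (Y ++ V))) (cnt Z) (cnt W))
        * F (U ++ (Y ++ (V ++ (W ++ B))))) := by
    intro Y hY
    rw [show U ++ (Y ++ (V ++ (Z ++ B))) = (U ++ (Y ++ V)) ++ (Z ++ B) by simp,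
      disc_apply s _ _ _ (by simp; omega) hZ]
    simp
  have h3 : ∀ W, disc s i a b F (U ++ (X ++ V) ++ (W ++ B)) =
      boolSum b fun Y => weight s (cnt X) (cnt Y) b • (ι (vertex (cnt U) (cnt X) (cnt Y))
        * F (U ++ (Y ++ (V ++ (W ++ B))))) := by
    intro W
    rw [show U ++ (X ++ V) ++ (W ++ B) = U ++ (X ++ (V ++ (W ++ B))) by simp,
      disc_apply s _ _ _ hU hX]
  rw [boolSum_congr fun Y hY => by rw [h2 Y hY]]
  simp only [h3, mul_boolSum, boolSum_smul]
  rw [boolSum_comm]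
  refine Eqv.boolSum fun W hW => Eqv.boolSum fun Y hY => ?_
  simp only [mul_smul_comm, ← mul_assoc]
  rw [smul_comm]
  refine Eqv.smul _ (Eqv.smul _ (Eqv.mul_right ?_ _))
  simp only [cnt_append, ← add_assoc]
  exact hf.exchange_layer (cnt U) (cnt V) (.vertex (cnt X) (cnt Y)) (.vertex (cnt Z) (cnt W))
    (by simp only [Piece.dom]; omega)

variable {s}

/-- The sum over the state of the shared interval undoes the contraction relation: an occupied
interval gives the merged vertex minus the separate vertices, an empty one gives the separate
vertices back. Both states have the same total weight. -/
theorem disc_fuse_right (hf : ChromaticInvariant f Q n) {i a b c e : ℕ}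
    (F : List Bool → MonoidAlgebra K Word) {S : List Bool} (hS : i + a + c ≤ S.length) :
    Eqv f n (cnt S) (disc s i a (b + 1) (disc s (i + b) (c + 1) e F) S)
      (disc s i (a + c) (b + e) F S) := by
  obtain ⟨U, X, B, hU, hX, rfl⟩ := exists_append S (show i + a ≤ S.length by omega)
  obtain ⟨V, Z, B, hV, hZ, rfl⟩ := exists_append B (i := 0) (a := c) (by simp at hS; omega)
  obtain rfl := List.length_eq_zero_iff.mp hV
  rw [List.nil_append, disc_apply s _ _ _ hU hX]
  have h1 : U ++ (X ++ (Z ++ B)) = U ++ ((X ++ Z) ++ B) := by simp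
  conv_rhs => rw [h1, disc_apply s _ _ _ hU (by simp; omega)]
  have h2 : ∀ Y, Y.length = b → ∀ y, disc s (i + b) (c + 1) e F (U ++ (Y ++ [y] ++ (Z ++ B))) =
      boolSum e fun W => weight s (cnt (y :: Z)) (cnt W) e •
        (ι (vertex (cnt (U ++ Y)) (cnt (y :: Z)) (cnt W)) * F (U ++ (Y ++ (W ++ B)))) := by
    intro Y hY y
    rw [show U ++ (Y ++ [y] ++ (Z ++ B)) = (U ++ Y) ++ ((y :: Z) ++ B) by simp,
      disc_apply s _ _ _ (by simp; omega) (by simp; omega)]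
    simp
  rw [boolSum_append, boolSum_append]
  refine Eqv.boolSum fun Y hY => ?_
  simp only [boolSum, h2 Y hY, mul_boolSum, boolSum_smul, ← boolSum_add_distrib]
  refine Eqv.boolSum fun W hW => ?_
  simp only [mul_smul_comm, ← mul_assoc, smul_smul, List.append_assoc]
  have w1 : weight s (cnt X) (cnt (Y ++ [true])) (b + 1) * weight s (cnt (true :: Z)) (cnt W) e =
      weight s (cnt (X ++ Z)) (cnt (Y ++ W)) (b + e) :=
    weight_mul_weight s _ _ _ _ _ _ _ _ _ (by simp; ring)
  have w2 : weight s (cnt X) (cnt (Y ++ [false])) (b + 1) * weight s (cnt (false :: Z)) (cnt W) e =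
      weight s (cnt (X ++ Z)) (cnt (Y ++ W)) (b + e) :=
    weight_mul_weight s _ _ _ _ _ _ _ _ _ (by simp; ring)
  rw [w1, w2, ← smul_add, ← add_mul]
  refine Eqv.smul _ (Eqv.mul_right ?_ _)
  have h3 := hf.fuse_right (N := cnt (U ++ (X ++ (Z ++ B)))) (l := cnt U) (a := cnt X) (b := cnt Y)
    (c := cnt Z) (e := cnt W) (by simp only [cnt_append]; omega)
  simp only [cnt_append, cnt_true, cnt_false, cnt_nil] at h3 ⊢
  simpa using h3.add (Eqv.refl (ι (vertex (cnt U) (cnt X) (cnt Y)) *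
    ι (vertex (cnt U + cnt Y) (cnt Z) (cnt W))))

theorem disc_fuse_left (hf : ChromaticInvariant f Q n) {i a b c e : ℕ}
    (F : List Bool → MonoidAlgebra K Word) {S : List Bool} (hS : i + c + a ≤ S.length) :
    Eqv f n (cnt S) (disc s (i + c) a (b + 1) (disc s i (c + 1) e F) S)
      (disc s i (c + a) (e + b) F S) := by
  obtain ⟨U, Z, B, hU, hZ, rfl⟩ := exists_append S (show i + c ≤ S.length by omega)
  obtain ⟨V, X, B, hV, hX, rfl⟩ := exists_append B (i := 0) (a := a) (by simp at hS; omega)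
  obtain rfl := List.length_eq_zero_iff.mp hV
  rw [List.nil_append]
  conv_lhs => rw [← List.append_assoc U Z, disc_apply s _ _ _ (by simp; omega) hX]
  have h1 : U ++ (Z ++ (X ++ B)) = U ++ ((Z ++ X) ++ B) := by simp
  conv_rhs => rw [h1, disc_apply s _ _ _ hU (by simp; omega)]
  have h2 : ∀ Y y, disc s i (c + 1) e F (U ++ Z ++ (y :: Y ++ B)) =
      boolSum e fun W => weight s (cnt (Z ++ [y])) (cnt W) e •
        (ι (vertex (cnt U) (cnt (Z ++ [y])) (cnt W)) * F (U ++ (W ++ (Y ++ B)))) := by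
    intro Y y
    rw [show U ++ Z ++ (y :: Y ++ B) = U ++ ((Z ++ [y]) ++ (Y ++ B)) by simp,
      disc_apply s _ _ _ hU (by simp; omega)]
  rw [boolSum_append e b, boolSum_comm e b, boolSum_succ, ← boolSum_add_distrib]
  refine Eqv.boolSum fun Y hY => ?_
  simp only [h2, mul_boolSum, boolSum_smul, ← boolSum_add_distrib]
  refine Eqv.boolSum fun W hW => ?_
  simp only [mul_smul_comm, ← mul_assoc, smul_smul, List.append_assoc]
  have w1 : weight s (cnt X) (cnt (true :: Y)) (b + 1) * weight s (cnt (Z ++ [true])) (cnt W) e =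
      weight s (cnt (Z ++ X)) (cnt (W ++ Y)) (e + b) :=
    weight_mul_weight s _ _ _ _ _ _ _ _ _ (by simp; ring)
  have w2 : weight s (cnt X) (cnt (false :: Y)) (b + 1) * weight s (cnt (Z ++ [false])) (cnt W) e =
      weight s (cnt (Z ++ X)) (cnt (W ++ Y)) (e + b) :=
    weight_mul_weight s _ _ _ _ _ _ _ _ _ (by simp; ring)
  rw [w1, w2, ← smul_add, ← add_mul]
  refine Eqv.smul _ (Eqv.mul_right ?_ _)
  have h3 := hf.fuse_left (N := cnt (U ++ (Z ++ (X ++ B)))) (l := cnt U) (a := cnt X) (b := cnt Y)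
    (c := cnt Z) (e := cnt W) (by simp only [cnt_append]; omega)
  simp only [cnt_append, cnt_true, cnt_false, cnt_nil] at h3 ⊢
  simpa using h3.add (Eqv.refl (ι (vertex (cnt U + cnt Z) (cnt X) (cnt Y)) *
    ι (vertex (cnt U) (cnt Z) (cnt W))))

/-- States that differ below and above produce a 1-valent vertex and vanish. Equal states produce a
2-valent or an isolated vertex, both of weight one. -/
theorem disc_one_one (hf : ChromaticInvariant f Q n) {i : ℕ}
    (F : List Bool → MonoidAlgebra K Word) {S : List Bool} (hS : i + 1 ≤ S.length) :
    Eqv f n (cnt S) (disc s i 1 1 F S) (F S) := by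
  obtain ⟨U, X, B, hU, hX, rfl⟩ := exists_append S hS
  rw [disc_apply s _ _ _ hU hX]
  obtain ⟨x, rfl⟩ := List.length_eq_one_iff.mp hX
  have hN : cnt (U ++ ([x] ++ B)) = cnt U + (cnt [x] + cnt B) := by rw [cnt_append, cnt_append]
  cases x
  · have h1 := (hf.leaf (N := cnt (U ++ ([false] ++ B))) (l := cnt U) (by omega)).mul_right
      (F (U ++ ([true] ++ B)))
    have h2 := (hf.isolated (N := cnt (U ++ ([false] ++ B))) (l := cnt U) (by omega)).mul_right
      (F (U ++ ([false] ++ B)))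
    have := (h1.smul (weight s 0 1 1)).add (h2.smul (weight s 0 0 1))
    have w : weight s 0 0 1 = 1 := by simp [weight]
    simpa [boolSum, w] using this
  · have h1 := (hf.smooth (N := cnt (U ++ ([true] ++ B))) (l := cnt U)
      (by rw [hN]; simp)).mul_right (F (U ++ ([true] ++ B)))
    have h2 := (hf.vertex_one_zero (N := cnt (U ++ ([true] ++ B))) (l := cnt U)
      (by rw [hN]; simp)).mul_right (F (U ++ ([false] ++ B)))
    have := (h1.smul (weight s 1 1 1)).add (h2.smul (weight s 1 0 1))
    have w : weight s 1 1 1 = 1 := by simp [weight]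
    simpa [boolSum, w] using this

theorem disc_zero_zero (hf : ChromaticInvariant f Q n) {i : ℕ}
    (F : List Bool → MonoidAlgebra K Word) {S : List Bool} (hS : i ≤ S.length) :
    Eqv f n (cnt S) (disc s i 0 0 F S) (((s ^ 2 : Kˣ) : K) • F S) := by
  obtain ⟨U, X, B, hU, hX, rfl⟩ := exists_append S (i := i) (a := 0) hS
  rw [disc_apply s _ _ _ hU hX]
  obtain rfl := List.length_eq_zero_iff.mp hX
  have h2 := (hf.isolated (N := cnt (U ++ ([] ++ B))) (l := cnt U)
    (by simp)).mul_right (F (U ++ ([] ++ B)))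
  have w : weight s 0 0 0 = ((s ^ 2 : Kˣ) : K) := by simp [weight, zpow_ofNat]
  have := h2.smul (weight s 0 0 0)
  rw [w, one_mul] at this
  simpa only [boolSum, cnt_nil, w] using this

/-- A white hole in a black strip. The four states of the two intervals add up to `(Q - 2) + 1 + 1 =
Q` merged vertices, all separated terms cancelling. The extra upper interval costs `s ^ (-2)`, and
`Q * s ^ (-2) = s ^ 2` exactly for this value of `Q`. -/
theorem disc_bubble (hf : ChromaticInvariant f (((s ^ 2 : Kˣ) : K) ^ 2) n) {i : ℕ}
    (F : List Bool → MonoidAlgebra K Word) {S : List Bool} (hS : i + 1 ≤ S.length) :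
    Eqv f n (cnt S) (disc s i 1 2 (disc s i 2 1 F) S)
      (((s ^ 2 : Kˣ) : K) • disc s i 1 1 F S) := by
  obtain ⟨U, X, B, hU, hX, rfl⟩ := exists_append S hS
  rw [disc_apply s _ _ _ hU hX, disc_apply s _ _ _ hU hX, boolSum_smul]
  have h1 : ∀ Y, Y.length = 2 → disc s i 2 1 F (U ++ (Y ++ B)) =
      boolSum 1 fun W => weight s (cnt Y) (cnt W) 1 • (ι (vertex (cnt U) (cnt Y) (cnt W)) *
        F (U ++ (W ++ B))) := fun Y hY => disc_apply s _ _ _ hU hY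
  rw [boolSum_congr fun Y hY => by rw [h1 Y hY]]
  simp only [mul_boolSum, boolSum_smul]
  rw [boolSum_comm]
  refine Eqv.boolSum fun W hW => ?_
  simp only [mul_smul_comm, ← mul_assoc, smul_smul]
  set w : K := weight s (cnt X) (cnt W) 2 with hw
  have h2 : ∀ Y, weight s (cnt X) (cnt Y) 2 * weight s (cnt Y) (cnt W) 1 = w :=
    fun Y => weight_mul_weight s _ _ _ _ _ _ _ _ _ (by push_cast; ring)
  have h3 : ((s ^ 2 : Kˣ) : K) * weight s (cnt X) (cnt W) 1 = w * ((s ^ 2 : Kˣ) : K) ^ 2 := by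
    rw [hw, weight, weight, ← Units.val_pow_eq_pow_val, ← Units.val_mul, ← Units.val_mul,
      ← zpow_natCast, ← zpow_natCast, ← zpow_mul, ← zpow_add, ← zpow_add]
    congr 2
    push_cast
    ring
  simp only [h2, h3]
  have hl : cnt U + cnt X ≤ cnt (U ++ (X ++ B)) := by simp only [cnt_append]; omega
  have e2 := hf.bubble (b := cnt W) hl
  have e1 := hf.contract (b := cnt W) hl
  simp only [boolSum, cnt_true, cnt_false, cnt_nil]
  rw [← smul_add, ← smul_add, ← smul_add, ← add_mul, ← add_mul, ← add_mul, mul_smul,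
    ← smul_mul_assoc (((s ^ 2 : Kˣ) : K) ^ 2)]
  refine Eqv.smul _ (Eqv.mul_right ?_ _)
  -- The states in order: both edges present (`bubble`), one edge present twice (`contract`), and no
  -- edge.
  have := (e2.add e1).add (e1.add (Eqv.refl (ι (vertex (cnt U) (cnt X) 0) *
    ι (vertex (cnt U) 0 (cnt W)))))
  simp only [zero_add, one_add_one_eq_two]
  refine this.trans (Eqv.of_eq ?_)
  module

end

end PlanarAlg

/-! ## Linear maps out of the two algebras -/

namespace PlanarAlg

noncomputable section

variable {K : Type*} [CommRing K] {A : Type*} [AddCommGroup A] [Module K A]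
variable {f : MonoidAlgebra K Word →ₗ[K] A} {Q : K} {n N : ℕ}

local notation "ι" => MonoidAlgebra.of K Word

/-- The universal property of `RingQuot` concerns unital homomorphisms, whereas `φ` need not
preserve the unit and its left inverse is used only as a linear map. Invariance of `F` inside every
two-sided context replaces multiplicativity. -/
theorem exists_linearMap_ringQuot {R : Type*} [Ring R] [Algebra K R] (r : R → R → Prop)
    (F : R →ₗ[K] A) (h : ∀ a b, r a b → ∀ u v, F (u * a * v) = F (u * b * v)) :
    ∃ G : RingQuot r →ₗ[K] A, ∀ x, G (RingQuot.mkAlgHom K r x) = F x := by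
  have h1 : ∀ a b, RingQuot.Rel r a b → ∀ u v, F (u * a * v) = F (u * b * v) := by
    intro a b hab
    induction hab with
    | of hab => exact h _ _ hab
    | add_left _ ih => intro u v; simp only [mul_add, add_mul, map_add, ih]
    | @mul_left a b c _ ih =>
      intro u v
      rw [← mul_assoc, ← mul_assoc, mul_assoc _ c v, mul_assoc _ c v, ih]
    | @mul_right a b c _ ih =>
      intro u v
      rw [← mul_assoc, ← mul_assoc, ih]
  have h2 : ∀ a b, Relation.EqvGen (RingQuot.Rel r) a b → F a = F b := by
    intro a b hab
    induction hab with
    | rel a b hab => simpa using h1 a b hab 1 1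
    | refl => rfl
    | symm _ _ _ ih => exact ih.symm
    | trans _ _ _ _ _ ih ih' => exact ih.trans ih'
  have h3 : LinearMap.ker (RingQuot.mkAlgHom K r).toLinearMap ≤ LinearMap.ker F := by
    intro x hx
    have hx' : RingQuot.mkAlgHom K r x = RingQuot.mkAlgHom K r 0 := by
      rw [map_zero]; exact hx
    simp only [RingQuot.mkAlgHom_def, RingQuot.mkRingHom_def] at hx'
    have hx'' := Quot.eqvGen_exact (RingQuot.mk.inj hx')
    rw [LinearMap.mem_ker, h2 x 0 hx'', map_zero]
  refine ⟨(Submodule.liftQ _ F h3) ∘ₗ ((RingQuot.mkAlgHom K r).toLinearMap.quotKerEquivOfSurjective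
    (RingQuot.mkAlgHom_surjective K r)).symm.toLinearMap, fun x => ?_⟩
  have : ((RingQuot.mkAlgHom K r).toLinearMap.quotKerEquivOfSurjective
      (RingQuot.mkAlgHom_surjective K r)).symm (RingQuot.mkAlgHom K r x) =
      Submodule.Quotient.mk x := by
    rw [LinearEquiv.symm_apply_eq]
    rfl
  simp [this]

/-- The linear map on a monoid algebra with given values on the monoid. -/
def linearLift {M : Type*} (F : M → A) : MonoidAlgebra K M →ₗ[K] A :=
  Finsupp.linearCombination K F ∘ₗ (MonoidAlgebra.coeffLinearEquiv K).toLinearMap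

theorem linearLift_of {M : Type*} [Monoid M] (F : M → A) (x : M) :
    linearLift F (MonoidAlgebra.of K M x) = F x := by
  simp [linearLift, MonoidAlgebra.of_apply, MonoidAlgebra.coeffLinearEquiv]

theorem induction_of {M : Type*} [Monoid M] {p : MonoidAlgebra K M → Prop} (x : MonoidAlgebra K M)
    (h : ∀ m, p (MonoidAlgebra.of K M m)) (hadd : ∀ x y, p x → p y → p (x + y))
    (hsmul : ∀ (c : K) x, p x → p (c • x)) : p x :=
  MonoidAlgebra.induction_on x h hadd hsmul

theorem exists_linearMap_of_invariant (S : Submonoid Word)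
    (r : MonoidAlgebra K (isotopy S).Quotient → MonoidAlgebra K (isotopy S).Quotient → Prop)
    (F : Word → A)
    (hmove : ∀ u v x y, Move x y → u * x * v ∈ S → u * y * v ∈ S →
      F (u * x * v) = F (u * y * v))
    (hr : ∀ E : MonoidAlgebra K (isotopy S).Quotient →ₗ[K] A,
      (∀ w : S, E (MonoidAlgebra.of K _ ((isotopy S).mk' w)) = F w) →
      ∀ a b, r a b → ∀ u v : S,
        E (MonoidAlgebra.of K _ ((isotopy S).mk' u) * a *
          MonoidAlgebra.of K _ ((isotopy S).mk' v)) =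
        E (MonoidAlgebra.of K _ ((isotopy S).mk' u) * b *
          MonoidAlgebra.of K _ ((isotopy S).mk' v))) :
    ∃ G : RingQuot r →ₗ[K] A, ∀ w : S,
      G (RingQuot.mkAlgHom K r (MonoidAlgebra.of K _ ((isotopy S).mk' w))) = F w := by
  -- The syntactic congruence of `F`: words that `F` cannot distinguish in any context. It contains
  -- the moves, hence all isotopies.
  let c : Con S :=
    { r := fun w w' => ∀ u v : S, F (u * w * v) = F (u * w' * v)
      iseqv := ⟨fun _ _ _ => rfl, fun h u v => (h u v).symm, fun h h' u v => (h u v).trans (h' u v)⟩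
      mul' := by
        intro w x y z h h' u v
        have h1 := h u (y * v)
        have h2 := h' (u * x) v
        simp only [Submonoid.coe_mul, ← mul_assoc] at h1 h2 ⊢
        exact h1.trans h2 }
  have hc : isotopy S ≤ c := by
    refine Con.conGen_le.mpr ?_
    rintro w w' ⟨u, v, x, y, h, hw, hw'⟩ u' v'
    have h1 : u' * w * v' = (u' * u) * x * (v * v') := by rw [hw]; simp only [mul_assoc]
    have h2 : u' * w' * v' = (u' * u) * y * (v * v') := by rw [hw']; simp only [mul_assoc]
    rw [h1, h2]
    refine hmove _ _ _ _ h ?_ ?_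
    · rw [← h1]; exact S.mul_mem (S.mul_mem u'.2 w.2) v'.2
    · rw [← h2]; exact S.mul_mem (S.mul_mem u'.2 w'.2) v'.2
  let F' : (isotopy S).Quotient → A := fun q => Con.liftOn q (fun w : S => F w) (by
    intro w w' h
    simpa using hc h 1 1)
  have hF : ∀ w : S, linearLift (K := K) F' (MonoidAlgebra.of K _ ((isotopy S).mk' w)) = F w :=
    fun w => linearLift_of _ _
  obtain ⟨G, hG⟩ := exists_linearMap_ringQuot r (linearLift F') (by
    intro a b hab u v
    induction u using induction_of with
    | h u =>
      induction v using induction_of with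
      | h v =>
        obtain ⟨u, rfl⟩ := Con.mk'_surjective u
        obtain ⟨v, rfl⟩ := Con.mk'_surjective v
        exact hr _ hF a b hab u v
      | hadd x y hx hy => simp only [mul_add, map_add, hx, hy]
      | hsmul c x hx => simp only [mul_smul_comm, map_smul, hx]
    | hadd x y hx hy => simp only [add_mul, map_add, hx, hy]
    | hsmul c x hx => simp only [smul_mul_assoc, map_smul, hx])
  exact ⟨G, fun w => by rw [hG, hF]⟩

/-! ### The chromatic algebra -/

theorem of_mul_gr_mul (u v : graphMonoid n) {w : Word} (h : w ∈ graphDrawings n n) :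
    MonoidAlgebra.of K _ ((isotopy (graphMonoid n)).mk' u) * gr K h *
      MonoidAlgebra.of K _ ((isotopy (graphMonoid n)).mk' v) =
    MonoidAlgebra.of K _ ((isotopy (graphMonoid n)).mk' (u * ⟨w, h⟩ * v)) := by
  rw [gr, ← map_mul, ← map_mul, ← map_mul, ← map_mul]

theorem Eqv.apply_word (u' u v v' : Word) {x : Word} {y : MonoidAlgebra K Word} {m : ℕ}
    (hu' : u' ∈ graphDrawings m n) (hu : u ∈ graphDrawings n N) (h : Eqv f m N (ι x) y) :
    f (ι (u' * (u * x * v) * v')) = f (ι (u' * u) * y * ι (v * v')) := by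
  have := h (u' * u) (mul_mem_graphDrawings hu' hu) (ι (v * v'))
  rw [← this, ← map_mul, ← map_mul]
  simp only [mul_assoc]

theorem exists_linearMap_chromaticAlgebra (hf : ChromaticInvariant f Q n) :
    ∃ G : ChromaticAlgebra Q n →ₗ[K] A, ∀ (w : Word) (hw : w ∈ graphDrawings n n),
      G (ChromaticAlgebra.graph Q n hw) = f (ι w) := by
  obtain ⟨G, hG⟩ := exists_linearMap_of_invariant (K := K) (graphMonoid n) (ChromaticRel Q n)
    (fun w => f (ι w)) hf.move (by
      intro E hE a b hab u' v'
      cases hab with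
      | contract u v l a b h h₁ h₂ =>
        obtain ⟨M, hM, -⟩ := exists_of_mul_mem_graphDrawings h
        obtain ⟨N, hN, r, hr, -⟩ := exists_of_mul_mem_graphDrawings hM
        have := hf.contract (N := N) (l := l) (a := a) (b := b) (by simp [Piece.dom] at hr; omega)
        rw [← map_mul, ← map_mul] at this
        rw [mul_sub, sub_mul, of_mul_gr_mul, of_mul_gr_mul, of_mul_gr_mul, map_sub, hE, hE, hE]
        refine (this.apply_word _ _ _ _ u'.2 hN).trans ?_
        rw [mul_sub, sub_mul, map_sub]
        simp only [← map_mul, mul_assoc, Submonoid.coe_mul]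
      | loop u v X l a c hX h h₁ =>
        obtain ⟨M, hM, -⟩ := exists_of_mul_mem_graphDrawings h
        obtain ⟨N, hN, hM'⟩ := exists_of_mul_mem_graphDrawings hM
        rw [mul_assoc] at hM'
        obtain ⟨r, hr, -⟩ := hM'
        have := hf.loop (N := N) (l := l) (a := a) hX (by simp [Piece.dom] at hr; omega)
        rw [← map_mul, ← map_mul, ← map_mul] at this
        rw [mul_smul_comm, smul_mul_assoc, of_mul_gr_mul, of_mul_gr_mul, map_smul, hE, hE]
        refine (this.apply_word _ _ _ _ u'.2 hN).trans ?_
        rw [mul_smul_comm, smul_mul_assoc, map_smul]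
        simp only [← map_mul, mul_assoc, Submonoid.coe_mul]
      | circle u v X l hX h h₁ =>
        obtain ⟨M, hM, -⟩ := exists_of_mul_mem_graphDrawings h
        obtain ⟨N, hN, hM'⟩ := exists_of_mul_mem_graphDrawings hM
        rw [mul_assoc] at hM'
        obtain ⟨r, hr, -⟩ := hM'
        have := hf.circle (N := N) (l := l) hX (by simp [Piece.dom] at hr; omega)
        rw [← map_mul, ← map_mul] at this
        rw [mul_smul_comm, smul_mul_assoc, of_mul_gr_mul, of_mul_gr_mul, map_smul, hE, hE]
        refine (this.apply_word _ _ _ _ u'.2 hN).trans ?_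
        rw [mul_smul_comm, smul_mul_assoc, map_smul]
        simp only [← map_mul, mul_assoc, Submonoid.coe_mul]
      | leaf u v l h =>
        obtain ⟨M, hM, -⟩ := exists_of_mul_mem_graphDrawings h
        obtain ⟨N, hN, r, hr, -⟩ := exists_of_mul_mem_graphDrawings hM
        have := hf.leaf (N := N) (l := l) (by simp [Piece.dom] at hr; omega)
        rw [mul_zero, zero_mul, map_zero, of_mul_gr_mul, hE]
        refine (this.apply_word _ _ _ _ u'.2 hN).trans ?_
        rw [mul_zero, zero_mul, map_zero]
      | smooth u v l h h₁ =>
        obtain ⟨M, hM, -⟩ := exists_of_mul_mem_graphDrawings h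
        obtain ⟨N, hN, r, hr, -⟩ := exists_of_mul_mem_graphDrawings hM
        have := hf.smooth (N := N) (l := l) (by simp [Piece.dom] at hr; omega)
        rw [of_mul_gr_mul, of_mul_gr_mul, hE, hE]
        refine (this.apply_word _ _ _ _ u'.2 hN).trans ?_
        simp only [mul_one, ← map_mul, mul_assoc, Submonoid.coe_mul]
      | isolated u v l h h₁ =>
        obtain ⟨M, hM, -⟩ := exists_of_mul_mem_graphDrawings h
        obtain ⟨N, hN, r, hr, -⟩ := exists_of_mul_mem_graphDrawings hM
        have := hf.isolated (N := N) (l := l) (by simp [Piece.dom] at hr; omega)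
        rw [of_mul_gr_mul, of_mul_gr_mul, hE, hE]
        refine (this.apply_word _ _ _ _ u'.2 hN).trans ?_
        simp only [mul_one, ← map_mul, mul_assoc, Submonoid.coe_mul])
  exact ⟨G, fun w hw => hG ⟨w, hw⟩⟩

open Classical in
/-- The element of the chromatic algebra given by a linear combination of drawings. -/
def ofGraphs (Q : K) (n : ℕ) : MonoidAlgebra K Word →ₗ[K] ChromaticAlgebra Q n :=
  linearLift fun w => if h : w ∈ graphDrawings n n then ChromaticAlgebra.graph Q n h else 0

theorem ofGraphs_of {w : Word} (h : w ∈ graphDrawings n n) :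
    ofGraphs Q n (ι w) = ChromaticAlgebra.graph Q n h := by
  rw [ofGraphs, linearLift_of, dif_pos h]

theorem ofGraphs_of_notMem {w : Word} (h : w ∉ graphDrawings n n) :
    ofGraphs Q n (ι w) = 0 := by
  rw [ofGraphs, linearLift_of, dif_neg h]

theorem mk'_eq_of_move (S : Submonoid Word) {u v x y : Word} (h : Move x y) (hx : u * x * v ∈ S)
    (hy : u * y * v ∈ S) : (isotopy S).mk' ⟨_, hx⟩ = (isotopy S).mk' ⟨_, hy⟩ :=
  (Con.eq _).mpr (ConGen.Rel.of _ _ ⟨u, v, x, y, h, rfl, rfl⟩)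

theorem ofGraphs_isotopyInvariant (Q : K) (n : ℕ) :
    IsotopyInvariant (A := ChromaticAlgebra Q n) (ofGraphs Q n) n where
  eq_zero _ h := ofGraphs_of_notMem h
  move u v x y h hx hy := by
    rw [ofGraphs_of hx, ofGraphs_of hy, ChromaticAlgebra.graph, ChromaticAlgebra.graph, gr, gr,
      mk'_eq_of_move (graphMonoid n) h hx hy]

theorem eqv_ofGraphs {M : ℕ} {x : Word} {y : MonoidAlgebra K Word} (hx : x ∈ graphDrawings N M)
    (hy : y ∈ homs K N M)
    (h : ∀ u v, u ∈ graphDrawings n N → v ∈ graphDrawings M n →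
      ofGraphs Q n (ι (u * x * v)) = ofGraphs Q n (ι u * y * ι v)) :
    Eqv (A := ChromaticAlgebra Q n) (ofGraphs Q n) n N (ι x) y := by
  refine Eqv.of_words fun u hu v => ?_
  by_cases hv : v ∈ graphDrawings M n
  · rw [← h u v hu hv, map_mul ι, map_mul ι]
  · have : ∀ z ∈ homs K N M, ofGraphs Q n (ι u * z * ι v) = 0 := by
      intro z hz
      induction hz using Submodule.span_induction with
      | mem z hz =>
        obtain ⟨w, hw, rfl⟩ := hz
        rw [← map_mul, ← map_mul, ofGraphs_of_notMem]
        rwa [mul_mem_graphDrawings_iff (mul_mem_graphDrawings hu hw)]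
      | zero => rw [mul_zero, zero_mul, map_zero]
      | add z z' _ _ h h' => rw [mul_add, add_mul, map_add, h, h', add_zero]
      | smul c z _ h => rw [mul_smul_comm, smul_mul_assoc, map_smul, h, smul_zero]
    rw [this _ (of_mem_homs hx), this _ hy]

theorem ofGraphs_chromaticInvariant (Q : K) (n : ℕ) :
    ChromaticInvariant (A := ChromaticAlgebra Q n) (ofGraphs Q n) Q n where
  toIsotopyInvariant := ofGraphs_isotopyInvariant Q n
  contract {N l a b} h := by
    obtain ⟨r, rfl⟩ := Nat.exists_eq_add_of_le h
    have h0 : vertex l a 1 * vertex l 1 b ∈ graphDrawings (l + a + r) (l + b + r) :=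
      mul_mem_graphDrawings (m := l + 1 + r) (vertex_mem (by omega) (by omega))
        (vertex_mem (by omega) (by omega))
    have h1 : vertex l a b ∈ graphDrawings (l + a + r) (l + b + r) :=
      vertex_mem (by omega) (by omega)
    have h2 : vertex l a 0 * vertex l 0 b ∈ graphDrawings (l + a + r) (l + b + r) :=
      mul_mem_graphDrawings (m := l + r) (vertex_mem (by omega) (by omega))
        (vertex_mem (by omega) (by omega))
    rw [← map_mul, ← map_mul]
    refine eqv_ofGraphs h0 (Submodule.sub_mem _ (of_mem_homs h1) (of_mem_homs h2))
      fun u v hu hv => ?_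
    have hm := fun {x} hx => mul_mem_graphDrawings (mul_mem_graphDrawings (v := x) hu hx) hv
    rw [mul_sub, sub_mul, map_sub, ← map_mul, ← map_mul, ← map_mul, ← map_mul,
      ofGraphs_of (hm h0), ofGraphs_of (hm h1), ofGraphs_of (hm h2), ChromaticAlgebra.graph,
      ChromaticAlgebra.graph, ChromaticAlgebra.graph, ← map_sub]
    exact RingQuot.mkAlgHom_rel K (ChromaticRel.contract u v l a b _ _ _)
  loop {N l a c X} hX h := by
    obtain ⟨r, rfl⟩ := Nat.exists_eq_add_of_le h
    have h0 : vertex l a (c + 2) * shift (l + 1) X * cap l ∈ graphDrawings (l + a + r) (l + r) :=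
      mul_mem_graphDrawings (mul_mem_graphDrawings (m := l + 1 + c + (1 + r))
        (vertex_mem (by omega) (by omega))
        (shift_mem_graphDrawings (l + 1) (1 + r) hX)) (cap_mem (by omega) (by omega))
    have h1 : vertex l a c * shift l X ∈ graphDrawings (l + a + r) (l + r) :=
      mul_mem_graphDrawings (m := l + c + r) (vertex_mem (by omega) (by omega))
        (shift_mem_graphDrawings l r hX)
    rw [← map_mul, ← map_mul, ← map_mul]
    refine eqv_ofGraphs h0 (Submodule.smul_mem _ _ (of_mem_homs h1)) fun u v hu hv => ?_
    have hm := fun {x} hx => mul_mem_graphDrawings (mul_mem_graphDrawings (v := x) hu hx) hv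
    rw [mul_smul_comm, smul_mul_assoc, map_smul, ← map_mul, ← map_mul,
      ofGraphs_of (hm h0), ofGraphs_of (hm h1), ChromaticAlgebra.graph,
      ChromaticAlgebra.graph, ← map_smul]
    exact RingQuot.mkAlgHom_rel K (ChromaticRel.loop u v X l a c hX _ _)
  circle {N l X} hX h := by
    obtain ⟨r, rfl⟩ := Nat.exists_eq_add_of_le h
    have h0 : cup l * shift (l + 1) X * cap l ∈ graphDrawings (l + r) (l + r) :=
      mul_mem_graphDrawings (mul_mem_graphDrawings (m := l + 1 + 0 + (1 + r))
        (cup_mem (by omega) (by omega))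
        (shift_mem_graphDrawings (l + 1) (1 + r) hX)) (cap_mem (by omega) (by omega))
    have h1 : shift l X ∈ graphDrawings (l + r) (l + r) :=
      shift_mem_graphDrawings l r hX
    rw [← map_mul, ← map_mul]
    refine eqv_ofGraphs h0 (Submodule.smul_mem _ _ (of_mem_homs h1)) fun u v hu hv => ?_
    have hm := fun {x} hx => mul_mem_graphDrawings (mul_mem_graphDrawings (v := x) hu hx) hv
    rw [mul_smul_comm, smul_mul_assoc, map_smul, ← map_mul, ← map_mul,
      ofGraphs_of (hm h0), ofGraphs_of (hm h1), ChromaticAlgebra.graph,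
      ChromaticAlgebra.graph, ← map_smul]
    exact RingQuot.mkAlgHom_rel K (ChromaticRel.circle u v X l hX _ _)
  leaf {N l} h := by
    have h0 : vertex l 0 1 ∈ graphDrawings N (N + 1) := vertex_mem (by omega) (by omega)
    refine eqv_ofGraphs h0 (zero_mem _) fun u v hu hv => ?_
    rw [mul_zero, zero_mul, map_zero,
      ofGraphs_of (mul_mem_graphDrawings (mul_mem_graphDrawings hu h0) hv),
      ChromaticAlgebra.graph, ← map_zero (RingQuot.mkAlgHom K (ChromaticRel Q n))]
    exact RingQuot.mkAlgHom_rel K (ChromaticRel.leaf u v l _)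
  smooth {N l} h := by
    have h0 : vertex l 1 1 ∈ graphDrawings N N := vertex_mem (by omega) (by omega)
    refine eqv_ofGraphs h0 (one_mem_homs _) fun u v hu hv => ?_
    rw [mul_one, ← map_mul, ofGraphs_of (mul_mem_graphDrawings (mul_mem_graphDrawings hu h0) hv),
      ofGraphs_of (mul_mem_graphDrawings hu hv)]
    exact RingQuot.mkAlgHom_rel K (ChromaticRel.smooth u v l _ _)
  isolated {N l} h := by
    have h0 : vertex l 0 0 ∈ graphDrawings N N := vertex_mem (by omega) (by omega)
    refine eqv_ofGraphs h0 (one_mem_homs _) fun u v hu hv => ?_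
    rw [mul_one, ← map_mul, ofGraphs_of (mul_mem_graphDrawings (mul_mem_graphDrawings hu h0) hv),
      ofGraphs_of (mul_mem_graphDrawings hu hv)]
    exact RingQuot.mkAlgHom_rel K (ChromaticRel.isolated u v l _ _)

end

end PlanarAlg

namespace PlanarAlg

noncomputable section

variable {K : Type*} [CommRing K] {A : Type*} [AddCommGroup A] [Module K A]
variable {f : MonoidAlgebra K Word →ₗ[K] A} {d : K} {m n N : ℕ}

local notation "ι" => MonoidAlgebra.of K Word

/-! ### The Temperley-Lieb algebra -/

/-- `f` is an isotopy invariant of planar curves that satisfies the Temperley-Lieb relation, and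
vanishes on all other drawings. -/
structure CurveInvariant (f : MonoidAlgebra K Word →ₗ[K] A) (d : K) (m : ℕ) : Prop
    extends IsotopyInvariant f m where
  circle : ∀ {N l}, l ≤ N → Eqv f m N (ι (cup l) * ι (cap l)) (d • 1)
  vertex : ∀ {N l a b}, Eqv f m N (ι (vertex l a b)) 0

theorem exists_vertex_of_notMem {w : Word} (h : w ∈ graphDrawings m n)
    (h' : w ∉ curveDrawings m n) : ∃ u v l a b, w = u * vertex l a b * v := by
  have : ∃ x ∈ w.toList, ¬(x.piece = .cup ∨ x.piece = .cap) := by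
    by_contra! hc
    exact h' ⟨h, fun x hx => by simpa [or_iff_not_imp_left] using hc x hx⟩
  obtain ⟨⟨l, p⟩, hx, hp⟩ := this
  obtain ⟨u, v, huv⟩ := List.append_of_mem hx
  cases p with
  | cup => simp at hp
  | cap => simp at hp
  | vertex a b =>
    refine ⟨FreeMonoid.ofList u, FreeMonoid.ofList v, l, a, b, ?_⟩
    apply FreeMonoid.toList.injective
    rw [huv]
    simp [PlanarAlg.vertex, layer]

theorem vertex_notMem_curveDrawings (u v : Word) (l a b : ℕ) :
    u * vertex l a b * v ∉ curveDrawings m n := fun h => by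
  have := h.2 ⟨l, .vertex a b⟩ (by simp [PlanarAlg.vertex, layer])
  simp at this

/-- A drawing of the right width that is not a drawing of curves contains a vertex, and vertices are
killed locally. So `f` is determined by its values on curves. -/
theorem CurveInvariant.eq_zero_of_notMem (hf : CurveInvariant f d m) {w : Word}
    (h : w ∉ curveDrawings m m) : f (ι w) = 0 := by
  by_cases h' : w ∈ graphDrawings m m
  · obtain ⟨u, v, l, a, b, rfl⟩ := exists_vertex_of_notMem h' h
    obtain ⟨M, hM, -⟩ := exists_of_mul_mem_graphDrawings h'
    obtain ⟨N, hN, -⟩ := exists_of_mul_mem_graphDrawings hM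
    have := hf.vertex (N := N) (l := l) (a := a) (b := b) u hN (ι v)
    simpa only [← map_mul ι, mul_zero, zero_mul, map_zero] using this
  · exact hf.eq_zero w h'

theorem of_mul_cv_mul (u v : curveMonoid n) {w : Word} (h : w ∈ curveDrawings n n) :
    MonoidAlgebra.of K _ ((isotopy (curveMonoid n)).mk' u) * cv K h *
      MonoidAlgebra.of K _ ((isotopy (curveMonoid n)).mk' v) =
    MonoidAlgebra.of K _ ((isotopy (curveMonoid n)).mk' (u * ⟨w, h⟩ * v)) := by
  rw [cv, ← map_mul, ← map_mul, ← map_mul, ← map_mul]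

/-- `TemperleyLieb.ofDrawings` as a linear map. -/
def ofCurves (d : K) (m : ℕ) : MonoidAlgebra K Word →ₗ[K] TemperleyLieb d m :=
  open Classical in
  linearLift fun w => if h : w ∈ curveDrawings m m then TemperleyLieb.curve d m h else 0

theorem ofCurves_of {w : Word} (h : w ∈ curveDrawings m m) :
    ofCurves d m (ι w) = TemperleyLieb.curve d m h := by
  rw [ofCurves, linearLift_of, dif_pos h]

theorem ofCurves_of_notMem {w : Word} (h : w ∉ curveDrawings m m) :
    ofCurves d m (ι w) = 0 := by
  rw [ofCurves, linearLift_of, dif_neg h]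

theorem exists_linearMap_temperleyLieb (hf : CurveInvariant f d m) :
    ∃ G : TemperleyLieb d m →ₗ[K] A, ∀ x, G (ofCurves d m x) = f x := by
  obtain ⟨G, hG⟩ := exists_linearMap_of_invariant (K := K) (curveMonoid m) (TemperleyLiebRel d m)
    (fun w => f (ι w)) (fun u v x y h hx hy => hf.move u v x y h hx.1 hy.1) (by
      intro E hE a b hab u' v'
      cases hab with
      | circle u v l h h₁ =>
        obtain ⟨M, hM, -⟩ := exists_of_mul_mem_graphDrawings h.1
        obtain ⟨N, hN, r, hr, -⟩ := exists_of_mul_mem_graphDrawings hM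
        have := hf.circle (N := N) (l := l) (by simp [Piece.dom] at hr; omega)
        rw [← map_mul] at this
        rw [mul_smul_comm, smul_mul_assoc, of_mul_cv_mul, of_mul_cv_mul, map_smul, hE, hE]
        refine (this.apply_word _ _ _ _ u'.2.1 hN).trans ?_
        rw [mul_smul_comm, smul_mul_assoc, map_smul, mul_one]
        simp only [← map_mul ι, mul_assoc, Submonoid.coe_mul])
  refine ⟨G, fun x => ?_⟩
  have : G ∘ₗ ofCurves d m = f := linearMap_congr_of fun w => by
    by_cases h : w ∈ curveDrawings m m
    · rw [LinearMap.comp_apply, ofCurves_of h]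
      exact hG ⟨w, h⟩
    · rw [LinearMap.comp_apply, ofCurves_of_notMem h, map_zero, hf.eq_zero_of_notMem h]
  exact LinearMap.congr_fun this x

theorem mem_curveDrawings_of_graph {u x v : Word} {k : ℕ}
    (h : u * x * v ∈ curveDrawings n k) {y : Word}
    (hy : ∀ z ∈ y.toList, z.piece = .cup ∨ z.piece = .cap)
    (h' : u * y * v ∈ graphDrawings n k) : u * y * v ∈ curveDrawings n k := by
  refine ⟨h', fun z hz => ?_⟩
  have h2 := h.2 z
  simp only [FreeMonoid.toList_mul, List.mem_append] at hz h2
  rcases hz with (hz | hz) | hz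
  · exact h2 (Or.inl (Or.inl hz))
  · exact hy z hz
  · exact h2 (Or.inr hz)

/-- Every move has a vertex on both sides or on neither. -/
theorem curveDrawings_move {u v x y : Word} (h : Move x y) (hx : u * x * v ∈ graphDrawings n n)
    (hy : u * y * v ∈ graphDrawings n n) :
    u * x * v ∈ curveDrawings n n ↔ u * y * v ∈ curveDrawings n n := by
  have key : (∀ z ∈ x.toList, z.piece = .cup ∨ z.piece = .cap) ↔
      ∀ z ∈ y.toList, z.piece = .cup ∨ z.piece = .cap := by
    cases h with
    | exchange l k p p' => simp [layer, and_comm]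
    | straighten_left l => simp [layer, cup, cap]
    | straighten_right l => simp [layer, cup, cap]
    | turn_right l a b => simp [layer, vertex, cap]
    | turn_left l a b => simp [layer, vertex, cap]
  constructor
  · intro hc
    refine mem_curveDrawings_of_graph hc (key.mp fun z hz => hc.2 z ?_) hy
    simp only [FreeMonoid.toList_mul, List.mem_append]
    exact Or.inl (Or.inr hz)
  · intro hc
    refine mem_curveDrawings_of_graph hc (key.mpr fun z hz => hc.2 z ?_) hx
    simp only [FreeMonoid.toList_mul, List.mem_append]
    exact Or.inl (Or.inr hz)

theorem ofCurves_curveInvariant (d : K) (m : ℕ) :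
    CurveInvariant (A := TemperleyLieb d m) (ofCurves d m) d m where
  eq_zero w h := ofCurves_of_notMem fun h' => h h'.1
  move u v x y h hx hy := by
    by_cases hc : u * x * v ∈ curveDrawings m m
    · have hc' := (curveDrawings_move h hx hy).mp hc
      rw [ofCurves_of hc, ofCurves_of hc', TemperleyLieb.curve, TemperleyLieb.curve, cv, cv,
        mk'_eq_of_move (curveMonoid m) h hc hc']
    · rw [ofCurves_of_notMem hc,
        ofCurves_of_notMem fun h' => hc ((curveDrawings_move h hx hy).mpr h')]
  circle {N l} h := by
    refine Eqv.of_words fun u hu v => ?_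
    rw [mul_smul_comm, mul_one, smul_mul_assoc, map_smul, ← map_mul ι, ← map_mul ι, ← map_mul ι,
      ← map_mul ι]
    have h0 : cup l * cap l ∈ graphDrawings N N :=
      mul_mem_graphDrawings (cup_mem (by omega) rfl) (cap_mem (by omega) rfl)
    have hiff : u * (cup l * cap l) * v ∈ graphDrawings m m ↔ u * v ∈ graphDrawings m m := by
      rw [mul_mem_graphDrawings_iff (mul_mem_graphDrawings hu h0), mul_mem_graphDrawings_iff hu]
    by_cases hc : u * (cup l * cap l) * v ∈ curveDrawings m m
    · have hc' : u * v ∈ curveDrawings m m := by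
        have := mem_curveDrawings_of_graph (y := 1) hc (by simp)
          (by rw [mul_one]; exact hiff.mp hc.1)
        rwa [mul_one] at this
      rw [ofCurves_of hc, ofCurves_of hc', TemperleyLieb.curve, TemperleyLieb.curve, ← map_smul]
      exact RingQuot.mkAlgHom_rel K (TemperleyLiebRel.circle u v l _ _)
    · have hc' : u * v ∉ curveDrawings m m := by
        intro hc'
        refine hc (mem_curveDrawings_of_graph (x := 1) (by rwa [mul_one]) ?_ (hiff.mpr hc'.1))
        simp [cup, cap, layer]
      rw [ofCurves_of_notMem hc, ofCurves_of_notMem hc', smul_zero]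
  vertex {N l a b} := by
    refine Eqv.of_words fun u hu v => ?_
    rw [mul_zero, zero_mul, map_zero, ← map_mul ι, ← map_mul ι,
      ofCurves_of_notMem (vertex_notMem_curveDrawings u v l a b)]

end

end PlanarAlg

/-! ## The left inverse -/

namespace PlanarAlg

noncomputable section

variable {K : Type*} [CommRing K] {A : Type*} [AddCommGroup A] [Module K A]
variable {f : MonoidAlgebra K Word →ₗ[K] A} {Q : K} {d s : Kˣ} {m n N : ℕ}

local notation "ι" => MonoidAlgebra.of K Word

/-- The operator of a layer with strands that bound black intervals: the strands in positions
`2 * i` and `2 * i + 1` bound the interval `i`. -/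
def stateOp (s : Kˣ) : Layer → Module.End K (List Bool → MonoidAlgebra K Word)
  | ⟨l, .cup⟩ => if l % 2 = 0 then disc s (l / 2) 0 1 else disc s (l / 2) 1 2
  | ⟨l, .cap⟩ => if l % 2 = 0 then disc s (l / 2) 1 0 else disc s (l / 2) 2 1
  | ⟨_, .vertex _ _⟩ => 0

/-- The representation of linear combinations of drawings by state operators. -/
def stateRep (s : Kˣ) :
    MonoidAlgebra K Word →ₐ[K] Module.End K (List Bool → MonoidAlgebra K Word) :=
  MonoidAlgebra.lift K _ Word (FreeMonoid.lift (stateOp s))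

theorem stateRep_of (w : Word) : stateRep s (ι w) = FreeMonoid.lift (stateOp s) w :=
  MonoidAlgebra.lift_of _ _

theorem stateRep_layer (l : ℕ) (p : Piece) : stateRep s (ι (layer l p)) = stateOp s ⟨l, p⟩ := by
  rw [stateRep_of, layer, FreeMonoid.lift_eval_of]

/-- The function `F` is a continuation: it assigns to the state above a drawing what is stacked on
top, and the operator returns the same for the state below. Hence stacking corresponds to
composition without reversing the order. -/
theorem stateRep_mul (x y : MonoidAlgebra K Word) (F : List Bool → MonoidAlgebra K Word) :
    stateRep s (x * y) F = stateRep s x (stateRep s y F) := by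
  rw [map_mul]; rfl

theorem stateRep_one (F : List Bool → MonoidAlgebra K Word) : stateRep s 1 F = F := by
  rw [map_one]; rfl

theorem stateRep_cup_even (i : ℕ) : stateRep s (ι (cup (2 * i))) = disc s i 0 1 := by
  rw [cup, stateRep_layer, stateOp, if_pos (by omega)]; congr 1; omega

theorem stateRep_cup_odd (i : ℕ) : stateRep s (ι (cup (2 * i + 1))) = disc s i 1 2 := by
  rw [cup, stateRep_layer, stateOp, if_neg (by omega)]; congr 1; omega

theorem stateRep_cap_even (i : ℕ) : stateRep s (ι (cap (2 * i))) = disc s i 1 0 := by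
  rw [cap, stateRep_layer, stateOp, if_pos (by omega)]; congr 1; omega

theorem stateRep_cap_odd (i : ℕ) : stateRep s (ι (cap (2 * i + 1))) = disc s i 2 1 := by
  rw [cap, stateRep_layer, stateOp, if_neg (by omega)]; congr 1; omega

theorem stateRep_vertex (l a b : ℕ) : stateRep s (ι (vertex l a b)) = 0 := by
  rw [vertex, stateRep_layer, stateOp]

/-- A cup or cap fits into `2 * L` strands exactly when its disc fits into `L` intervals, and the
widths change compatibly. Thus the length of the state keeps track of the width of the drawing. -/
theorem stateOp_cases (s : Kˣ) (x : Layer) : stateOp s x = 0 ∨ ∃ i a b, stateOp s x = disc s i a b ∧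
    (∀ L, x.pos + x.piece.dom ≤ 2 * L ↔ i + a ≤ L) ∧
      2 * b + x.piece.dom = 2 * a + x.piece.cod := by
  obtain ⟨l, p⟩ := x
  cases p with
  | cup =>
    refine Or.inr ?_
    rw [stateOp]
    split_ifs
    · exact ⟨_, _, _, rfl, fun L => by dsimp [Piece.dom]; omega, by simp [Piece.dom, Piece.cod]⟩
    · exact ⟨_, _, _, rfl, fun L => by dsimp [Piece.dom]; omega, by simp [Piece.dom, Piece.cod]⟩
  | cap =>
    refine Or.inr ?_
    rw [stateOp]
    split_ifs
    · exact ⟨_, _, _, rfl, fun L => by dsimp [Piece.dom]; omega, by simp [Piece.dom, Piece.cod]⟩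
    · exact ⟨_, _, _, rfl, fun L => by dsimp [Piece.dom]; omega, by simp [Piece.dom, Piece.cod]⟩
  | vertex a b => exact Or.inl rfl

theorem disc_eq_zero {i a b : ℕ} {F : List Bool → MonoidAlgebra K Word} {S : List Bool}
    (h : i + a ≤ S.length → ∀ S', S'.length + a = S.length + b → F S' = 0) :
    disc s i a b F S = 0 := by
  by_cases hS : i + a ≤ S.length
  · have h' := h hS
    obtain ⟨U, X, B, hU, hX, rfl⟩ := exists_append S hS
    rw [disc_apply s _ _ _ hU hX]
    refine (boolSum_congr fun Y hY => ?_).trans (boolSum_zero b)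
    rw [h' _ (by simp only [List.length_append]; omega), mul_zero, smul_zero]
  · exact disc_apply_of_lt s _ _ (by omega)

theorem stateRep_of_mul (x : Layer) (w : Word) (F : List Bool → MonoidAlgebra K Word) :
    stateRep s (ι (FreeMonoid.of x * w)) F = stateOp s x (stateRep s (ι w) F) := by
  rw [map_mul, stateRep_mul, stateRep_of (FreeMonoid.of x), FreeMonoid.lift_eval_of]

theorem stateRep_congr {w : Word} {F G : List Bool → MonoidAlgebra K Word} {M : ℕ}
    (h : ∀ S, 2 * S.length = M → Eqv f n (cnt S) (F S) (G S)) :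
    ∀ {S : List Bool}, w ∈ graphDrawings (2 * S.length) M →
      Eqv f n (cnt S) (stateRep s (ι w) F S) (stateRep s (ι w) G S) := by
  induction w using FreeMonoid.inductionOn' with
  | one => intro S hw; rw [map_one, stateRep_one, stateRep_one]; exact h S hw
  | of_mul x w ih =>
    rintro S ⟨r, hr, hw⟩
    rw [stateRep_of_mul, stateRep_of_mul]
    obtain h0 | ⟨i, a, b, h1, -, h3⟩ := stateOp_cases s x
    · rw [h0]; rfl
    · rw [h1]
      refine disc_congr s fun S' hS' => ih ?_
      dsimp at hr hw
      rwa [show x.pos + x.piece.cod + r = 2 * S'.length by omega] at hw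

/-- The function on states that singles out the state of length `n` in which all intervals
carry strands. -/
def topState (K : Type*) [CommRing K] (n : ℕ) (S : List Bool) : MonoidAlgebra K Word :=
  if S = List.replicate n true then 1 else 0

/-- A word of the wrong width either contains a vertex or a disc that does not fit the state, or
ends in a state whose length `topState` rejects. -/
theorem stateRep_topState_eq_zero {w : Word} : ∀ {S : List Bool},
    w ∉ graphDrawings (2 * S.length) (2 * n) → stateRep s (ι w) (topState K n) S = 0 := by
  induction w using FreeMonoid.inductionOn' with
  | one =>
    intro S hw
    rw [map_one, stateRep_one, topState, if_neg]
    rintro rfl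
    exact hw (by rw [List.length_replicate]; exact one_mem_graphDrawings _)
  | of_mul x w ih =>
    intro S hw
    rw [stateRep_of_mul]
    obtain h0 | ⟨i, a, b, h1, h2, h3⟩ := stateOp_cases s x
    · rw [h0]; rfl
    · rw [h1]
      refine disc_eq_zero fun hS S' hS' => ih fun hw' => hw ?_
      have := (h2 S.length).mpr hS
      refine of_mul_mem_graphDrawings.mpr ⟨2 * S.length - x.pos - x.piece.dom, by omega, ?_⟩
      convert hw' using 2
      omega

/-- The linear map that is induced by the left inverse of `φ` on the linear combinations of
drawings of curves. -/
def stateEval (s : Kˣ) (Q : K) (n : ℕ) : MonoidAlgebra K Word →ₗ[K] ChromaticAlgebra Q n :=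
  ofGraphs Q n ∘ₗ LinearMap.proj (List.replicate n true) ∘ₗ
    LinearMap.applyₗ (topState K n) ∘ₗ (stateRep s).toLinearMap

theorem stateEval_apply (x : MonoidAlgebra K Word) : stateEval s Q n x =
    ofGraphs Q n (stateRep s x (topState K n) (List.replicate n true)) := rfl

theorem Eqv.apply_one {x y : MonoidAlgebra K Word} (h : Eqv f n n x y) : f x = f y := by
  simpa only [map_one, one_mul, mul_one] using h 1 (one_mem_graphDrawings n) 1

/-- Reduces every check on curves to a comparison of state operators in the chromatic algebra, on
states of the appropriate length. -/
theorem eqv_stateEval {x y : MonoidAlgebra K Word}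
    (h : ∀ F S, 2 * S.length = N →
      Eqv (A := ChromaticAlgebra Q n) (ofGraphs Q n) n (cnt S) (stateRep s x F S)
        (stateRep s y F S)) :
    Eqv (A := ChromaticAlgebra Q n) (stateEval s Q n) (2 * n) N x y := by
  intro u hu z
  rw [stateEval_apply, stateEval_apply]
  have := stateRep_congr (A := ChromaticAlgebra Q n) (f := ofGraphs Q n) (n := n) (w := u) (s := s)
    (F := stateRep s x (stateRep s z (topState K n)))
    (G := stateRep s y (stateRep s z (topState K n))) (fun S hS => h _ S hS)
    (S := List.replicate n true) (by rwa [List.length_replicate])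
  rw [cnt_replicate] at this
  rw [mul_assoc, mul_assoc, stateRep_mul, stateRep_mul, stateRep_mul, stateRep_mul]
  exact this.apply_one

theorem stateOp_piece (s : Kˣ) (p : Piece) : (∀ l, stateOp s ⟨l, p⟩ = 0) ∨
    ∃ a b, p.dom = 2 * a ∧ p.cod = 2 * b ∧ (∀ i, stateOp s ⟨2 * i, p⟩ = disc s i a b) ∧
      ∀ i, stateOp s ⟨2 * i + 1, p⟩ = disc s i (a + 1) (b + 1) := by
  cases p with
  | cup =>
    refine Or.inr ⟨0, 1, rfl, rfl, fun i => ?_, fun i => ?_⟩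
    · rw [← stateRep_cup_even, cup, stateRep_layer]
    · rw [← stateRep_cup_odd, cup, stateRep_layer]
  | cap =>
    refine Or.inr ⟨1, 0, rfl, rfl, fun i => ?_, fun i => ?_⟩
    · rw [← stateRep_cap_even, cap, stateRep_layer]
    · rw [← stateRep_cap_odd, cap, stateRep_layer]
  | vertex a b => exact Or.inl fun l => rfl

theorem stateRep_exchange (hf : ChromaticInvariant f Q n) (l k : ℕ) (p p' : Piece)
    (F : List Bool → MonoidAlgebra K Word) {S : List Bool}
    (hS : l + p.dom + k + p'.dom ≤ 2 * S.length) :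
    Eqv f n (cnt S) (stateRep s (ι (layer l p * layer (l + p.cod + k) p')) F S)
      (stateRep s (ι (layer (l + p.dom + k) p' * layer l p)) F S) := by
  rw [map_mul ι, map_mul ι, stateRep_mul, stateRep_mul, stateRep_layer, stateRep_layer,
    stateRep_layer]
  obtain h0 | ⟨a, b, hp, hp', he, ho⟩ := stateOp_piece s p
  · simp only [h0, LinearMap.zero_apply, map_zero]; rfl
  obtain h0 | ⟨c, e, hq, hq', he', ho'⟩ := stateOp_piece s p'
  · simp only [h0, LinearMap.zero_apply, map_zero]; rfl
  rw [hp, hp']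
  rw [hp, hq] at hS
  obtain ⟨i, rfl | rfl⟩ := l.even_or_odd'
  all_goals obtain ⟨j, rfl | rfl⟩ := k.even_or_odd'
  · rw [show 2 * i + 2 * b + 2 * j = 2 * (i + b + j) by omega,
      show 2 * i + 2 * a + 2 * j = 2 * (i + a + j) by omega, he, he', he']
    exact disc_exchange s hf.toIsotopyInvariant F (by omega)
  · rw [show 2 * i + 2 * b + (2 * j + 1) = 2 * (i + b + j) + 1 by omega,
      show 2 * i + 2 * a + (2 * j + 1) = 2 * (i + a + j) + 1 by omega, he, ho', ho']
    exact disc_exchange s hf.toIsotopyInvariant F (by omega)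
  -- Both pieces sit at odd positions. With no strands between them they touch a common black
  -- interval, so the discs are not disjoint; instead both orders fuse to the same larger disc.
  · rcases j with _ | j
    · rw [show 2 * i + 1 + 2 * b + 2 * 0 = 2 * (i + b) + 1 by omega,
        show 2 * i + 1 + 2 * a + 2 * 0 = 2 * (i + a) + 1 by omega, ho, ho', ho']
      have h1 := disc_fuse_right (s := s) hf (i := i) (a := a + 1) (b := b) (c := c) (e := e + 1) F
        (S := S) (by omega)
      have h2 := disc_fuse_left (s := s) hf (i := i) (c := a) (a := c + 1) (b := e) (e := b + 1) F
        (S := S) (by omega)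
      rw [show a + (c + 1) = a + 1 + c by omega, show b + 1 + e = b + (e + 1) by omega] at h2
      exact h1.trans h2.symm
    · rw [show 2 * i + 1 + 2 * b + 2 * (j + 1) = 2 * (i + (b + 1) + j) + 1 by omega,
        show 2 * i + 1 + 2 * a + 2 * (j + 1) = 2 * (i + (a + 1) + j) + 1 by omega, ho, ho', ho']
      exact disc_exchange s hf.toIsotopyInvariant F (by omega)
  · rw [show 2 * i + 1 + 2 * b + (2 * j + 1) = 2 * (i + (b + 1) + j) by omega,
      show 2 * i + 1 + 2 * a + (2 * j + 1) = 2 * (i + (a + 1) + j) by omega, ho, he', he']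
    exact disc_exchange s hf.toIsotopyInvariant F (by omega)

/-- For either parity the zigzag is bordered by two discs that fuse to one with a single lower and a
single upper interval, which acts trivially. -/
theorem stateRep_straighten_left (hf : ChromaticInvariant f Q n) (l : ℕ)
    (F : List Bool → MonoidAlgebra K Word) {S : List Bool} (hS : l + 1 ≤ 2 * S.length) :
    Eqv f n (cnt S) (stateRep s (ι (cup l * cap (l + 1))) F S) (F S) := by
  rw [map_mul ι, stateRep_mul]
  obtain ⟨i, rfl | rfl⟩ := l.even_or_odd'
  · rw [stateRep_cup_even, stateRep_cap_odd]
    exact (disc_fuse_right hf (b := 0) (c := 1) F (by omega)).trans (disc_one_one hf F (by omega))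
  · rw [stateRep_cup_odd, show 2 * i + 1 + 1 = 2 * (i + 1) by omega, stateRep_cap_even]
    exact (disc_fuse_right hf (b := 1) (c := 0) F (by omega)).trans (disc_one_one hf F (by omega))

theorem stateRep_straighten_right (hf : ChromaticInvariant f Q n) (l : ℕ)
    (F : List Bool → MonoidAlgebra K Word) {S : List Bool} (hS : l + 1 ≤ 2 * S.length) :
    Eqv f n (cnt S) (stateRep s (ι (cup (l + 1) * cap l)) F S) (F S) := by
  rw [map_mul ι, stateRep_mul]
  obtain ⟨i, rfl | rfl⟩ := l.even_or_odd'
  · rw [stateRep_cup_odd, stateRep_cap_even]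
    exact (disc_fuse_left hf (b := 1) (c := 0) F (by omega)).trans (disc_one_one hf F (by omega))
  · rw [stateRep_cap_odd, show 2 * i + 1 + 1 = 2 * (i + 1) by omega, stateRep_cup_even]
    exact (disc_fuse_left hf (b := 0) (c := 1) F (by omega)).trans (disc_one_one hf F (by omega))

/-- At an even position the circle bounds a black disc, at an odd position a white hole in a black
strip. Both must be worth `d`, and the second case fixes the parameter `Q`. -/
theorem stateRep_circle (hf : ChromaticInvariant f (((s ^ 2 : Kˣ) : K) ^ 2) n) (l : ℕ)
    (F : List Bool → MonoidAlgebra K Word) {S : List Bool} (hS : l ≤ 2 * S.length) :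
    Eqv f n (cnt S) (stateRep s (ι (cup l) * ι (cap l)) F S) (((s ^ 2 : Kˣ) : K) • F S) := by
  rw [stateRep_mul]
  obtain ⟨i, rfl | rfl⟩ := l.even_or_odd'
  · rw [stateRep_cup_even, stateRep_cap_even]
    exact (disc_fuse_right hf (b := 0) (c := 0) F (by omega)).trans (disc_zero_zero hf F (by omega))
  · rw [stateRep_cup_odd, stateRep_cap_odd]
    exact (disc_bubble hf F (by omega)).trans ((disc_one_one hf F (by omega)).smul _)

theorem stateRep_move (hf : ChromaticInvariant f Q n) {x y : Word} (h : Move x y) {M : ℕ}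
    (F : List Bool → MonoidAlgebra K Word) {S : List Bool}
    (hx : x ∈ graphDrawings (2 * S.length) M) :
    Eqv f n (cnt S) (stateRep s (ι x) F S) (stateRep s (ι y) F S) := by
  cases h with
  | exchange l k p p' =>
    obtain ⟨r, hr, r', hr', -⟩ := hx
    exact stateRep_exchange hf l k p p' F (by dsimp at hr hr'; omega)
  | straighten_left l =>
    obtain ⟨r, hr, r', hr', -⟩ := hx
    rw [map_one ι, stateRep_one]
    exact stateRep_straighten_left hf l F (by simp only [Piece.dom, Piece.cod] at hr hr'; omega)
  | straighten_right l =>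
    obtain ⟨r, hr, r', hr', -⟩ := hx
    rw [map_one ι, stateRep_one]
    exact stateRep_straighten_right hf l F (by simp only [Piece.dom] at hr; omega)
  | turn_right l a b =>
    rw [map_mul ι, stateRep_mul, stateRep_vertex, stateRep_vertex]; rfl
  | turn_left l a b =>
    rw [map_mul ι, stateRep_mul, stateRep_vertex, stateRep_vertex]; rfl

theorem stateEval_curveInvariant (s : Kˣ) (n : ℕ) :
    CurveInvariant (A := ChromaticAlgebra (((s ^ 2 : Kˣ) : K) ^ 2) n)
      (stateEval s (((s ^ 2 : Kˣ) : K) ^ 2) n) ((s ^ 2 : Kˣ) : K) (2 * n) where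
  eq_zero w hw := by
    rw [stateEval_apply, stateRep_topState_eq_zero (by rwa [List.length_replicate]), map_zero]
  move u v x y h hx hy := by
    obtain ⟨M, hM, -⟩ := exists_of_mul_mem_graphDrawings hx
    obtain ⟨N, hN, hx⟩ := exists_of_mul_mem_graphDrawings hM
    have := eqv_stateEval (s := s) (N := N) (x := ι x) (y := ι y) (fun F S hS =>
      stateRep_move (ofGraphs_chromaticInvariant (((s ^ 2 : Kˣ) : K) ^ 2) n) h F (hS ▸ hx))
        u hN (ι v)
    simpa only [map_mul ι] using this
  circle {N l} h := eqv_stateEval fun F S hS => by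
    rw [map_smul, map_one]
    exact stateRep_circle (ofGraphs_chromaticInvariant _ n) l F (by omega)
  vertex {N l a b} := eqv_stateEval fun F S hS => by
    rw [stateRep_vertex, map_zero]

/-! ### The value of the left inverse on the image of `φ` -/

variable (hf : ChromaticInvariant f Q n) (hs : s ^ 2 = d)
include hf

theorem stateRep_lowerHalf (l a : ℕ) (F : List Bool → MonoidAlgebra K Word) {S : List Bool}
    (hS : l + a ≤ S.length) :
    Eqv f n (cnt S) (stateRep s (ι (lowerHalf (2 * l) a)) F S) (disc s l a 1 F S) := by
  rcases a with _ | a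
  · rw [lowerHalf, stateRep_cup_even]
  · rw [lowerHalf]
    induction a generalizing S with
    | zero =>
      rw [pow_zero, map_one ι, stateRep_one]
      exact (disc_one_one hf F (by omega)).symm
    | succ a ih =>
      rw [pow_succ', map_mul ι, stateRep_mul, stateRep_cap_odd]
      refine (disc_congr s (G := disc s l (a + 1) 1 F) fun S' hS' => ih (by omega)).trans ?_
      have := disc_fuse_right (s := s) hf (i := l) (a := 2) (b := 0) (c := a) (e := 1) F (S := S)
        (by omega)
      rwa [show 2 + a = a + 1 + 1 by omega] at this

theorem stateRep_upperHalf (l b : ℕ) (F : List Bool → MonoidAlgebra K Word) {S : List Bool}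
    (hS : l + 1 ≤ S.length) :
    Eqv f n (cnt S) (stateRep s (ι (upperHalf (2 * l) b)) F S) (disc s l 1 b F S) := by
  rcases b with _ | b
  · rw [upperHalf, stateRep_cap_even]
  · rw [upperHalf]
    induction b generalizing S with
    | zero =>
      rw [pow_zero, map_one ι, stateRep_one]
      exact (disc_one_one hf F (by omega)).symm
    | succ b ih =>
      rw [pow_succ', map_mul ι, stateRep_mul, stateRep_cup_odd]
      refine (disc_congr s (G := disc s l 1 (b + 1) F) fun S' hS' => ih (by omega)).trans ?_
      exact disc_fuse_left (s := s) hf (i := l) (a := 1) (b := 1) (c := 0) (e := b + 1) F (S := S)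
        (by omega)

/-- The doubled vertex bounds a single black disc, cut into its two halves by one interval. -/
theorem stateRep_halves (l a b : ℕ) (F : List Bool → MonoidAlgebra K Word) {S : List Bool}
    (hS : l + a ≤ S.length) :
    Eqv f n (cnt S) (stateRep s (ι (lowerHalf (2 * l) a * upperHalf (2 * l) b)) F S)
      (disc s l a b F S) := by
  rw [map_mul ι, stateRep_mul]
  refine (stateRep_lowerHalf hf l a _ hS).trans ?_
  refine (disc_congr s (G := disc s l 1 b F) fun S' hS' =>
    stateRep_upperHalf hf l b F (by omega)).trans ?_
  have := disc_fuse_right (s := s) hf (i := l) (a := a) (b := 0) (c := 0) (e := b) F (S := S)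
    (by omega)
  rwa [Nat.zero_add b] at this

include hs

/-- In the turn-back term a disc ends and a new one begins. On an occupied interval it contains a
1-valent vertex and vanishes, leaving the identity; on an empty interval it contributes `d⁻¹ * d =
1` times the identity, which cancels. -/
theorem stateRep_projector (l : ℕ) (F : List Bool → MonoidAlgebra K Word) {U : List Bool}
    (x : Bool) (B : List Bool) (hU : U.length = l) :
    Eqv f n (cnt (U ++ ([x] ++ B))) (stateRep s (projector d (2 * l)) F (U ++ ([x] ++ B)))
      (if x = true then F (U ++ ([x] ++ B)) else 0) := by
  have h0 : stateRep s (projector d (2 * l)) F (U ++ ([x] ++ B)) = F (U ++ ([x] ++ B)) -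
      ((d⁻¹ : Kˣ) : K) • disc s l 1 0 (disc s l 0 1 F) (U ++ ([x] ++ B)) := by
    rw [projector, map_sub, map_smul, map_one, map_mul ι, map_mul (stateRep s), stateRep_cap_even,
      stateRep_cup_even]
    rfl
  rw [h0, disc_apply s _ _ _ hU (by rfl)]
  simp only [boolSum]
  rw [disc_apply s _ _ _ hU (by rfl)]
  simp only [boolSum]
  have hN : cnt (U ++ ([x] ++ B)) = cnt U + (cnt [x] + cnt B) := by rw [cnt_append, cnt_append]
  cases x
  · have w1 : weight s 0 0 1 = 1 := by simp [weight]
    have w2 : weight s 0 0 0 = (d : K) := by rw [← hs]; simp [weight, zpow_ofNat]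
    have e1 := (hf.isolated (N := cnt (U ++ ([false] ++ B))) (l := cnt U) (by omega))
    have e2 := (hf.leaf (N := cnt (U ++ ([false] ++ B))) (l := cnt U) (by omega)).mul_right
      (F (U ++ ([true] ++ B)))
    have e3 := ((e2.smul (weight s 0 1 1)).add (e1.mul_right (F (U ++ ([false] ++ B)))))
    have e4 := e3.mul_left_of (w := vertex (cnt U) 0 0) (N := cnt (U ++ ([false] ++ B)))
      (vertex_mem (by omega) (by omega))
    have e5 := (e4.trans (e1.mul_right _)).smul (((d⁻¹ : Kˣ) : K) * d)
    have e6 := (Eqv.refl (f := f) (m := n) (N := cnt (U ++ ([false] ++ B)))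
      (F (U ++ ([false] ++ B)))).sub e5
    simpa [w1, w2, smul_smul] using e6
  · have e1 := (hf.vertex_one_zero (N := cnt (U ++ ([true] ++ B))) (l := cnt U)
      (by rw [hN]; simp)).mul_right (disc s l 0 1 F (U ++ ([] ++ B)))
    have e2 := (e1.smul (weight s 1 0 0)).smul ((d⁻¹ : Kˣ) : K)
    rw [disc_apply s _ _ _ hU (by rfl)] at e2
    have e6 := (Eqv.refl (f := f) (m := n) (N := cnt (U ++ ([true] ++ B)))
      (F (U ++ ([true] ++ B)))).sub e2
    simpa [boolSum] using e6

omit hf hs in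
theorem projectors_succ (d : Kˣ) (l k : ℕ) :
    projectors d l (k + 1) = projectors d l k * projector d (2 * (l + k)) := by
  simp [projectors, List.range_succ]

end

end PlanarAlg

/-! ### The left inverse on doubled layers -/

namespace PlanarAlg

noncomputable section

variable {K : Type*} [CommRing K] {A : Type*} [AddCommGroup A] [Module K A]
variable {f : MonoidAlgebra K Word →ₗ[K] A} {Q : K} {d s : Kˣ} {m n N : ℕ}

local notation "ι" => MonoidAlgebra.of K Word

theorem stateRep_projectors (hf : ChromaticInvariant f Q n) (hs : s ^ 2 = d) (l k : ℕ)
    (F : List Bool → MonoidAlgebra K Word) {U X : List Bool} (B : List Bool) (hU : U.length = l)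
    (hX : X.length = k) :
    Eqv f n (cnt (U ++ (X ++ B))) (stateRep s (projectors d l k) F (U ++ (X ++ B)))
      (if X = List.replicate k true then F (U ++ (X ++ B)) else 0) := by
  induction k generalizing F X B with
  | zero =>
    obtain rfl := List.length_eq_zero_iff.mp hX
    rw [if_pos (by rfl), projectors, List.range_zero, List.map_nil, List.prod_nil, stateRep_one]
  | succ k ih =>
    obtain ⟨X, x, rfl⟩ := List.eq_nil_or_concat X |>.resolve_left (by rintro rfl; simp at hX)
    rw [List.concat_eq_append] at hX ⊢
    have hX' : X.length = k := by simpa using hX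
    rw [projectors_succ, stateRep_mul]
    have h1 := ih (stateRep s (projector d (2 * (l + k))) F) (X := X) ([x] ++ B) hX'
    have h2 := stateRep_projector hf hs (l + k) F (U := U ++ X) x B (by simp; omega)
    simp only [List.append_assoc] at h1 h2 ⊢
    refine h1.trans ?_
    have h3 : X ++ [x] = List.replicate (k + 1) true ↔ X = List.replicate k true ∧ x = true := by
      rw [List.replicate_succ']
      exact ⟨fun h => by simpa using List.append_inj' h rfl, fun h => by rw [h.1, h.2]⟩
    simp only [h3]
    by_cases hXt : X = List.replicate k true
    · simpa only [hXt, true_and, if_true] using h2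
    · simp only [hXt, false_and, if_false]; rfl

theorem replicate_split (l a r : ℕ) : List.replicate (l + a + r) true =
    List.replicate l true ++ (List.replicate a true ++ List.replicate r true) := by
  rw [List.replicate_append_replicate, List.replicate_append_replicate, add_assoc]

/-- The operator of a disc with projectors on its upper intervals. -/
theorem disc_projectors (hf : ChromaticInvariant f Q n) (hs : s ^ 2 = d) (l a b r : ℕ)
    (F : List Bool → MonoidAlgebra K Word) :
    Eqv f n (l + a + r)
      (disc s l a b (stateRep s (projectors d l b) F) (List.replicate (l + a + r) true))
      (weight s a b b • (ι (vertex l a b) * F (List.replicate (l + b + r) true))) := by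
  rw [replicate_split, disc_apply s _ _ _ (by simp) (by simp), cnt_replicate, cnt_replicate]
  have h1 : ∀ Y, Y.length = b → Eqv f n (l + a + r)
      (weight s a (cnt Y) b • (ι (vertex l a (cnt Y)) * stateRep s (projectors d l b) F
        (List.replicate l true ++ (Y ++ List.replicate r true))))
      (weight s a (cnt Y) b • (ι (vertex l a (cnt Y)) * (if Y = List.replicate b true then
        F (List.replicate l true ++ (Y ++ List.replicate r true)) else 0))) := by
    intro Y hY
    refine Eqv.smul _ (Eqv.mul_left_of ?_ (stateRep_projectors hf hs l b F _ (by simp) hY))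
    refine vertex_mem (by omega) ?_
    simp
    omega
  refine (Eqv.boolSum h1).trans (Eqv.of_eq ?_)
  rw [boolSum_replicate]
  · rw [if_pos rfl, cnt_replicate, ← replicate_split]
  · intro Y _ hne
    rw [if_neg hne, mul_zero, smul_zero]

theorem weight_eq_one (x y b : ℕ) (h : (2 : ℤ) - x + y - 2 * b = 0) : weight s x y b = 1 := by
  rw [weight, h, zpow_zero, Units.val_one]

/-- The doubled minimum is one disc with two upper intervals. The projector forces an edge in the
first; an empty second interval would then leave a 1-valent vertex. The surviving 2-valent vertex
has weight one and is the minimum itself. -/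
theorem stateRep_phiLayer_cup (hf : ChromaticInvariant f Q n) (hs : s ^ 2 = d) (l r : ℕ)
    (F : List Bool → MonoidAlgebra K Word) :
    Eqv f n (l + 0 + r) (stateRep s (phiLayer d s ⟨l, .cup⟩) F (List.replicate (l + 0 + r) true))
      (ι (cup l) * F (List.replicate (l + 2 + r) true)) := by
  have hc : ∀ k, cnt (List.replicate k true) = k := cnt_replicate
  rw [phiLayer]
  rw [map_mul ι, stateRep_mul, stateRep_mul, stateRep_cup_even, stateRep_cup_odd]
  have h1 := disc_fuse_right (s := s) hf (i := l) (a := 0) (b := 0) (c := 0) (e := 2)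
    (stateRep s (projectors d l 1) F) (S := List.replicate (l + 0 + r) true) (by simp)
  rw [hc, zero_add 2] at h1
  refine h1.trans ?_
  rw [replicate_split, disc_apply s _ _ _ (by simp) (by simp), hc, hc]
  set G := stateRep s (projectors d l 1) F
  have hG : ∀ x y, Eqv f n (l + cnt [x, y] + r)
      (G (List.replicate l true ++ ([x, y] ++ List.replicate r true)))
      (if x = true then F (List.replicate l true ++ ([x, y] ++ List.replicate r true)) else 0) := by
    intro x y
    have := stateRep_projectors hf hs l 1 F (U := List.replicate l true) (X := [x])
      ([y] ++ List.replicate r true) (by simp) (by simp)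
    have hN : cnt (List.replicate l true ++ ([x] ++ ([y] ++ List.replicate r true))) =
        l + cnt [x, y] + r := by
      rw [← List.append_assoc [x], cnt_append, cnt_append, hc, hc, ← add_assoc]; rfl
    rw [hN] at this
    simpa using this
  clear_value G
  have hY : ∀ Y, Y.length = 2 → Eqv f n (l + 0 + r) (weight s 0 (cnt Y) 2 •
      (ι (vertex l 0 (cnt Y)) * G (List.replicate l true ++ (Y ++ List.replicate r true))))
      (if Y = List.replicate 2 true then
        ι (cup l) * F (List.replicate l true ++ (Y ++ List.replicate r true)) else 0) := by
    intro Y hY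
    obtain ⟨x, y, rfl⟩ := List.length_eq_two.mp hY
    have e1 := (hG x y).mul_left_of (N := l + 0 + r) (w := vertex l 0 (cnt [x, y]))
      (vertex_mem (by omega) (by omega))
    cases x
    · simpa [List.replicate_succ] using e1.smul (weight s 0 (cnt [false, y]) 2)
    · cases y
      · simpa [List.replicate_succ] using ((hf.leaf (N := l + r) (l := l) (by omega)).mul_right
          (G (List.replicate l true ++ ([true, false] ++ List.replicate r true)))).smul
          (weight s 0 1 2)
      · rw [if_pos rfl, show cnt [true, true] = 2 from rfl] at e1
        rw [if_pos (by rfl), show cnt [true, true] = 2 from rfl,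
          weight_eq_one 0 2 2 (by norm_num), one_smul]
        exact e1.trans ((hf.vertex_zero_two (N := l + 0 + r) (by omega)).mul_right _)
  refine (Eqv.boolSum hY).trans (Eqv.of_eq ?_)
  rw [boolSum_replicate _ _ fun Y _ hne => if_neg hne, if_pos rfl, ← replicate_split]

theorem stateRep_phiLayer_cap (hf : ChromaticInvariant f Q n) (l r : ℕ)
    (F : List Bool → MonoidAlgebra K Word) :
    Eqv f n (l + 2 + r) (stateRep s (phiLayer d s ⟨l, .cap⟩) F (List.replicate (l + 2 + r) true))
      (ι (cap l) * F (List.replicate (l + 0 + r) true)) := by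
  have hc : ∀ k, cnt (List.replicate k true) = k := cnt_replicate
  rw [phiLayer]
  rw [map_mul ι, stateRep_mul, stateRep_cap_odd, stateRep_cap_even]
  have h1 := disc_fuse_right (s := s) hf (i := l) (a := 2) (b := 0) (c := 0) (e := 0)
    F (S := List.replicate (l + 2 + r) true) (by simp)
  rw [hc] at h1
  refine h1.trans ?_
  rw [replicate_split, disc_apply s _ _ _ (by simp) (by simp), hc, hc]
  simp only [boolSum, cnt_nil, List.nil_append, List.replicate_append_replicate, add_zero]
  rw [weight_eq_one _ _ _ (by simp), one_smul]
  exact (hf.vertex_two_zero (by omega)).mul_right _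

theorem stateRep_phiLayer (hf : ChromaticInvariant f Q n) (hs : s ^ 2 = d)
    (x : Layer) (r : ℕ) (F : List Bool → MonoidAlgebra K Word) :
    Eqv f n (x.pos + x.piece.dom + r)
      (stateRep s (phiLayer d s x) F (List.replicate (x.pos + x.piece.dom + r) true))
      (ι (FreeMonoid.of x) * F (List.replicate (x.pos + x.piece.cod + r) true)) := by
  obtain ⟨l, p⟩ := x
  have hc : ∀ k, cnt (List.replicate k true) = k := cnt_replicate
  cases p with
  | cup => exact stateRep_phiLayer_cup hf hs l r F
  | cap => exact stateRep_phiLayer_cap hf l r F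
  | vertex a b =>
    simp only [phiLayer, Piece.dom, Piece.cod]
    rw [smul_mul_assoc, map_smul, LinearMap.smul_apply, Pi.smul_apply, stateRep_mul]
    have h1 := stateRep_halves (s := s) hf l a b (stateRep s (projectors d l b) F)
      (S := List.replicate (l + a + r) true) (by simp)
    rw [hc] at h1
    have h2 := (h1.trans (disc_projectors hf hs l a b r F)).smul ((s ^ ((a : ℤ) + b - 2) : Kˣ) : K)
    -- With all `b` upper intervals occupied, the weight of the disc is the inverse of the factor
    -- that `φ` attaches to the vertex.
    rw [smul_smul, weight, ← Units.val_mul, ← zpow_add,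
      show (a : ℤ) + b - 2 + (2 - a + b - 2 * b) = 0 by ring, zpow_zero,
      Units.val_one, one_smul] at h2
    exact h2

theorem stateRep_phi (hf : ChromaticInvariant f Q n) (hs : s ^ 2 = d)
    {w : Word} (F : List Bool → MonoidAlgebra K Word) : ∀ {k k' : ℕ}, w ∈ graphDrawings k k' →
    Eqv f n k (stateRep s (FreeMonoid.lift (phiLayer d s) w) F (List.replicate k true))
      (ι w * F (List.replicate k' true)) := by
  induction w using FreeMonoid.inductionOn' with
  | one => intro k k' h; cases h; rw [map_one, stateRep_one, map_one, one_mul]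
  | of_mul x w ih =>
    rintro k k' ⟨r, hr, hw⟩
    dsimp at hr hw
    subst hr
    rw [map_mul, FreeMonoid.lift_eval_of, stateRep_mul, map_mul, mul_assoc]
    refine (stateRep_phiLayer hf hs x r _).trans (Eqv.mul_left_of ?_ (ih hw))
    exact ⟨r, rfl, rfl⟩

/-- The bottom row of projectors fixes the initial state, and each doubled layer returns the
original layer while keeping all intervals occupied. -/
theorem stateEval_phiDrawing (hs : s ^ 2 = d) {w : Word} (hw : w ∈ graphDrawings n n) :
    stateEval s Q n (phiDrawing d s n w) = ChromaticAlgebra.graph Q n hw := by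
  rw [stateEval_apply, phiDrawing, stateRep_mul, ← ofGraphs_of hw]
  have hf := ofGraphs_chromaticInvariant Q n
  have h1 := stateRep_projectors hf hs 0 n
    (stateRep s (FreeMonoid.lift (phiLayer d s) w) (topState K n)) (U := [])
    (X := List.replicate n true) [] rfl (by simp)
  rw [if_pos rfl, List.nil_append, List.append_nil, cnt_replicate] at h1
  have h2 := stateRep_phi hf hs (topState K n) hw
  rw [topState, if_pos rfl, mul_one] at h2
  exact (h1.trans h2).apply_one

end

end PlanarAlg

/-! ## Projectors -/

namespace PlanarAlg

noncomputable section

variable {K : Type*} [CommRing K] {A : Type*} [AddCommGroup A] [Module K A]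
variable {f : MonoidAlgebra K Word →ₗ[K] A} {d s : Kˣ} {m n N : ℕ}

local notation "ι" => MonoidAlgebra.of K Word

/-! ### Exchange of minima and maxima in explicit positions -/

namespace IsotopyInvariant

variable (hf : IsotopyInvariant f m)
include hf

theorem cup_cup {l q : ℕ} (h : l ≤ q) (hN : q ≤ N) :
    Eqv f m N (ι (cup l) * ι (cup (q + 2))) (ι (cup q) * ι (cup l)) := by
  obtain ⟨k, rfl⟩ := Nat.exists_eq_add_of_le h
  have := hf.exchange_layer (N := N) l k .cup .cup (by simp only [Piece.dom]; omega)
  rwa [Piece.dom, Piece.cod, add_zero, add_right_comm] at this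

theorem cup_cap {l q : ℕ} (h : l ≤ q) (hN : q + 2 ≤ N) :
    Eqv f m N (ι (cup l) * ι (cap (q + 2))) (ι (cap q) * ι (cup l)) := by
  obtain ⟨k, rfl⟩ := Nat.exists_eq_add_of_le h
  have := hf.exchange_layer (N := N) l k .cup .cap (by simp only [Piece.dom]; omega)
  rwa [Piece.dom, Piece.cod, add_zero, add_right_comm] at this

theorem cap_cup {l q : ℕ} (h : l ≤ q) (hN : q + 2 ≤ N) :
    Eqv f m N (ι (cap l) * ι (cup q)) (ι (cup (q + 2)) * ι (cap l)) := by
  obtain ⟨k, rfl⟩ := Nat.exists_eq_add_of_le h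
  have := hf.exchange_layer (N := N) l k .cap .cup (by simp only [Piece.dom]; omega)
  rwa [Piece.dom, Piece.cod, add_zero, add_right_comm] at this

theorem cap_cap {l q : ℕ} (h : l ≤ q) (hN : q + 4 ≤ N) :
    Eqv f m N (ι (cap l) * ι (cap q)) (ι (cap (q + 2)) * ι (cap l)) := by
  obtain ⟨k, rfl⟩ := Nat.exists_eq_add_of_le h
  have := hf.exchange_layer (N := N) l k .cap .cap (by simp only [Piece.dom]; omega)
  rwa [Piece.dom, Piece.cod, add_zero, add_right_comm] at this

end IsotopyInvariant

/-! ### Projectors as local elements -/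

theorem shiftHom_projector (k l : ℕ) : shiftHom K k (projector d l) = projector d (k + l) := by
  simp only [projector, map_sub, map_one, map_smul, shiftHom_of, map_mul, shift_cup, shift_cap]

theorem shiftHom_projectors (k l c : ℕ) :
    shiftHom K (2 * k) (projectors d l c) = projectors d (k + l) c := by
  induction c with
  | zero => simp [projectors]
  | succ c ih =>
    rw [projectors_succ, projectors_succ, map_mul, ih, shiftHom_projector]
    congr 2; ring

theorem projector_mem {l : ℕ} (h : l + 2 ≤ N) : projector d l ∈ homs K N N :=
  Submodule.sub_mem _ (one_mem_homs N) (Submodule.smul_mem _ _ (of_mem_homs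
    (mul_mem_graphDrawings (m := N - 2) (cap_mem (by omega) (by omega))
      (cup_mem (by omega) (by omega)))))

theorem projectors_mem {l c : ℕ} (h : 2 * (l + c) ≤ N) : projectors d l c ∈ homs K N N := by
  induction c with
  | zero => simpa [projectors] using one_mem_homs N
  | succ c ih =>
    rw [projectors_succ]
    exact mul_mem_homs (ih (by omega)) (projector_mem (by omega))

theorem projectors_zero (l : ℕ) : projectors d l 0 = 1 := by simp [projectors]

theorem projectors_one (l : ℕ) : projectors d l 1 = projector d (2 * l) := by simp [projectors]

theorem projectors_add (l a b : ℕ) :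
    projectors d l (a + b) = projectors d l a * projectors d (l + a) b := by
  induction b with
  | zero => simp [projectors]
  | succ b ih =>
    rw [← add_assoc, projectors_succ, ih, projectors_succ, mul_assoc, add_assoc]

theorem projectors_succ' (l k : ℕ) :
    projectors d l (k + 1) = projector d (2 * l) * projectors d (l + 1) k := by
  rw [add_comm k 1, projectors_add, projectors_one]

namespace CurveInvariant

variable (hf : CurveInvariant f (d : K) m)
include hf

/-- The turn-back squares to `d` times itself, so the coefficient of the square is `-2/d + d/d ^ 2 =
-1/d`. -/
theorem projector_mul_self {l : ℕ} (h : l + 2 ≤ N) :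
    Eqv f m N (projector d l * projector d l) (projector d l) := by
  have h1 := ((hf.circle (N := N - 2) (l := l) (by omega)).mul_left_of (N := N) (w := cap l)
    (cap_mem (by omega) (by omega))).mul_right (ι (cup l))
  have h2 := (Eqv.refl (f := f) (m := m) (N := N)
    (1 - (2 * ((d⁻¹ : Kˣ) : K)) • (ι (cap l) * ι (cup l)))).add
      (h1.smul (((d⁻¹ : Kˣ) : K) * ((d⁻¹ : Kˣ) : K)))
  refine Eqv.trans (Eqv.of_eq ?_) (h2.trans (Eqv.of_eq ?_))
  · simp only [projector, map_mul, sub_mul, mul_sub, one_mul, mul_one, smul_mul_assoc,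
      mul_smul_comm, mul_assoc]
    module
  · rw [mul_smul_comm, mul_one, smul_mul_assoc, smul_smul, mul_assoc, Units.inv_mul, mul_one,
      projector, map_mul]
    module

theorem projector_comm {l q : ℕ} (h : l + 2 ≤ q) (hN : q + 2 ≤ N) :
    Eqv f m N (projector d l * projector d q) (projector d q * projector d l) := by
  have := hf.exchange (N := N) (projector_mem (d := d) (N := 2) (l := 0) (by omega))
    (projector_mem (d := d) (N := 2) (l := 0) (by omega)) l (q - l - 2) (by omega)
  rwa [shiftHom_projector, shiftHom_projector, show l + 2 + (q - l - 2) + 0 = q by omega,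
    add_zero] at this

theorem projectors_mul_projector {l k i : ℕ} (h1 : l ≤ i) (h2 : i < l + k)
    (hN : 2 * (l + k) ≤ N) :
    Eqv f m N (projectors d l k * projector d (2 * i)) (projectors d l k) := by
  induction k with
  | zero => omega
  | succ k ih =>
    rw [projectors_succ, mul_assoc]
    obtain rfl | hi := eq_or_ne i (l + k)
    · exact (hf.projector_mul_self (by omega)).mul_left (projectors_mem (by omega))
    · refine ((hf.projector_comm (l := 2 * i) (q := 2 * (l + k)) (by omega)
        (by omega)).symm.mul_left (projectors_mem (by omega))).trans ?_
      rw [← mul_assoc]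
      exact (ih (by omega) (by omega)).mul_right _

theorem projectors_mul_projectors {l k l' k' : ℕ} (h1 : l ≤ l') (h2 : l' + k' ≤ l + k)
    (hN : 2 * (l + k) ≤ N) :
    Eqv f m N (projectors d l k * projectors d l' k') (projectors d l k) := by
  induction k' with
  | zero => rw [projectors_zero, mul_one]
  | succ k' ih =>
    rw [projectors_succ, ← mul_assoc]
    exact ((ih (by omega)).mul_right _).trans
      (hf.projectors_mul_projector (by omega) (by omega) hN)

end CurveInvariant

/-! ### Doubled minima and maxima -/

/-- Two nested local minima. -/
def cups (K : Type*) [CommRing K] (p : ℕ) : MonoidAlgebra K Word :=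
  MonoidAlgebra.of K Word (cup p) * MonoidAlgebra.of K Word (cup (p + 1))

/-- Two nested local maxima. -/
def caps (K : Type*) [CommRing K] (p : ℕ) : MonoidAlgebra K Word :=
  MonoidAlgebra.of K Word (cap (p + 1)) * MonoidAlgebra.of K Word (cap p)

theorem shiftHom_cups (k p : ℕ) : shiftHom K k (cups K p) = cups K (k + p) := by
  simp only [cups, map_mul, shiftHom_of, shift_cup, add_assoc]

theorem shiftHom_caps (k p : ℕ) : shiftHom K k (caps K p) = caps K (k + p) := by
  simp only [caps, map_mul, shiftHom_of, shift_cap, add_assoc]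

theorem cups_mem {p N M : ℕ} (h : p ≤ N) (hM : M = N + 4) : cups K p ∈ homs K N M :=
  mul_mem_homs (m := N + 2) (of_mem_homs (cup_mem h rfl))
    (of_mem_homs (cup_mem (by omega) (by omega)))

theorem caps_mem {p N M : ℕ} (h : p ≤ N) (hM : M = N + 4) : caps K p ∈ homs K M N :=
  mul_mem_homs (m := N + 2) (of_mem_homs (cap_mem (by omega) (by omega)))
    (of_mem_homs (cap_mem (by omega) (by omega)))

namespace IsotopyInvariant

variable (hf : IsotopyInvariant f m)
include hf

/-- A projector slides over a doubled maximum: a turn-back on either leg, once straightened, leaves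
the same two maxima side by side. -/
theorem projector_mul_caps {p : ℕ} (h : p + 4 ≤ N) :
    Eqv f m N (projector d p * caps K p) (projector d (p + 2) * caps K p) := by
  have h1 : Eqv f m N (ι (cap p) * ι (cup p) * caps K p) (ι (cap p) * ι (cap p)) := by
    have := ((hf.cup_cap_succ (N := N - 2) (l := p) (by omega)).mul_left_of (N := N) (w := cap p)
      (cap_mem (by omega) (by omega))).mul_right (ι (cap p))
    simpa only [caps, mul_assoc, one_mul] using this
  have h2 : Eqv f m N (ι (cap (p + 2)) * ι (cup (p + 2)) * caps K p)
      (ι (cap (p + 2)) * ι (cap p)) := by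
    have := ((hf.cup_succ_cap (N := N - 2) (l := p + 1) (by omega)).mul_left_of (N := N)
      (w := cap (p + 2)) (cap_mem (by omega) (by omega))).mul_right (ι (cap p))
    simpa only [caps, mul_assoc, one_mul] using this
  have h3 := h1.trans ((hf.cap_cap (N := N) (l := p) (q := p) le_rfl (by omega)).trans h2.symm)
  simp only [projector, sub_mul, one_mul, smul_mul_assoc, map_mul ι]
  exact (Eqv.refl _).sub (h3.smul _)

theorem cups_mul_projector {p : ℕ} (h : p ≤ N) :
    Eqv f m N (cups K p * projector d p) (cups K p * projector d (p + 2)) := by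
  have h1 : Eqv f m N (cups K p * (ι (cap p) * ι (cup p))) (ι (cup p) * ι (cup p)) := by
    have := ((hf.cup_succ_cap (N := N + 2) (l := p) (by omega)).mul_left_of (N := N) (w := cup p)
      (cup_mem (by omega) (by omega))).mul_right (ι (cup p))
    simpa only [cups, mul_assoc, mul_one, one_mul] using this
  have h2 : Eqv f m N (cups K p * (ι (cap (p + 2)) * ι (cup (p + 2))))
      (ι (cup p) * ι (cup (p + 2))) := by
    have := ((hf.cup_cap_succ (N := N + 2) (l := p + 1) (by omega)).mul_left_of (N := N)
      (w := cup p) (cup_mem (by omega) (by omega))).mul_right (ι (cup (p + 2)))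
    simpa only [cups, mul_assoc, mul_one, one_mul] using this
  have h3 := h1.trans ((hf.cup_cup (N := N) (l := p) (q := p) le_rfl (by omega)).symm.trans h2.symm)
  simp only [projector, mul_sub, mul_one, mul_smul_comm, map_mul ι]
  exact (Eqv.refl _).sub (h3.smul _)

end IsotopyInvariant

/-! ### The value of `φ` on layers -/

theorem lowerHalf_mem (p a r : ℕ) : lowerHalf p a ∈ graphDrawings (p + 2 * a + r) (p + 2 + r) := by
  cases a with
  | zero => exact cup_mem (by omega) (by omega)
  | succ a => exact cap_pow_mem a _ (by omega) (by omega)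

theorem upperHalf_mem (p b r : ℕ) : upperHalf p b ∈ graphDrawings (p + 2 + r) (p + 2 * b + r) := by
  cases b with
  | zero => exact cap_mem (by omega) (by omega)
  | succ b => exact cup_pow_mem (by omega) b _ (by omega)

theorem shift_lowerHalf (k p a : ℕ) : shift k (lowerHalf p a) = lowerHalf (k + p) a := by
  cases a with
  | zero => rfl
  | succ a => rw [lowerHalf, lowerHalf, map_pow, shift_cap, add_assoc]

theorem shift_upperHalf (k p b : ℕ) : shift k (upperHalf p b) = upperHalf (k + p) b := by
  cases b with
  | zero => rfl
  | succ b => rw [upperHalf, upperHalf, map_pow, shift_cup, add_assoc]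

theorem phiLayer_cup (l : ℕ) : phiLayer d s ⟨l, .cup⟩ = cups K (2 * l) * projector d (2 * l) := by
  rw [phiLayer, map_mul ι, projectors_one]; rfl

theorem phiLayer_cap (l : ℕ) : phiLayer d s ⟨l, .cap⟩ = caps K (2 * l) := by
  rw [phiLayer, map_mul ι]; rfl

theorem shiftHom_phiLayer (k l : ℕ) (p : Piece) :
    shiftHom K (2 * k) (phiLayer d s ⟨l, p⟩) = phiLayer d s ⟨k + l, p⟩ := by
  cases p with
  | cup => rw [phiLayer_cup, phiLayer_cup, map_mul, shiftHom_cups, shiftHom_projector, mul_add]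
  | cap => rw [phiLayer_cap, phiLayer_cap, shiftHom_caps, mul_add]
  | vertex a b =>
    rw [phiLayer, phiLayer, map_mul, map_smul, shiftHom_of, map_mul (shift (2 * k)),
      shift_lowerHalf, shift_upperHalf, shiftHom_projectors, mul_add]

theorem phiLayer_mem (l : ℕ) (p : Piece) (r : ℕ) :
    phiLayer d s ⟨l, p⟩ ∈ homs K (2 * (l + p.dom + r)) (2 * (l + p.cod + r)) := by
  cases p with
  | cup =>
    rw [phiLayer_cup]
    simp only [Piece.dom, Piece.cod]
    exact mul_mem_homs (cups_mem (by omega) (by omega)) (projector_mem (by omega))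
  | cap =>
    rw [phiLayer_cap]
    simp only [Piece.dom, Piece.cod]
    exact caps_mem (by omega) (by omega)
  | vertex a b =>
    rw [phiLayer]
    simp only [Piece.dom, Piece.cod]
    refine mul_mem_homs (Submodule.smul_mem _ _ (of_mem_homs ?_)) (projectors_mem (by omega))
    have h1 := lowerHalf_mem (2 * l) a (2 * r)
    have h2 := upperHalf_mem (2 * l) b (2 * r)
    have := mul_mem_graphDrawings h1 h2
    rwa [← mul_add, ← mul_add, ← mul_add, ← mul_add] at this

/-- The algebra homomorphism that extends `phiLayer`. -/
def phiHom (d s : Kˣ) : MonoidAlgebra K Word →ₐ[K] MonoidAlgebra K Word :=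
  MonoidAlgebra.lift K _ Word (FreeMonoid.lift (phiLayer d s))

theorem phiHom_of (w : Word) : phiHom d s (ι w) = FreeMonoid.lift (phiLayer d s) w :=
  MonoidAlgebra.lift_of _ _

theorem phiHom_layer (l : ℕ) (p : Piece) : phiHom d s (ι (layer l p)) = phiLayer d s ⟨l, p⟩ := by
  rw [phiHom_of, layer, FreeMonoid.lift_eval_of]

theorem phiHom_of_mul (x : Layer) (w : Word) :
    phiHom d s (ι (FreeMonoid.of x * w)) = phiLayer d s x * phiHom d s (ι w) := by
  rw [phiHom_of, phiHom_of, map_mul, FreeMonoid.lift_eval_of]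

theorem phiHom_mem_of {w : Word} : ∀ {k k' : ℕ}, w ∈ graphDrawings k k' →
    phiHom d s (ι w) ∈ homs K (2 * k) (2 * k') := by
  induction w using FreeMonoid.inductionOn' with
  | one => intro k k' h; cases h; rw [map_one, map_one]; exact one_mem_homs _
  | of_mul x w ih =>
    rintro k k' ⟨r, hr, hw⟩
    dsimp at hr hw
    subst hr
    rw [phiHom_of_mul]
    exact mul_mem_homs (phiLayer_mem _ _ r) (ih hw)

theorem phiHom_shift (k : ℕ) (w : Word) :
    phiHom d s (ι (shift k w)) = shiftHom K (2 * k) (phiHom d s (ι w)) := by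
  induction w using FreeMonoid.inductionOn' with
  | one => simp only [map_one]
  | of_mul x w ih =>
    rw [map_mul (shift k), shift_of, layer, phiHom_of_mul, phiHom_of_mul, map_mul, ih,
      shiftHom_phiLayer]

namespace CurveInvariant

variable (hf : CurveInvariant f (d : K) m)
include hf

/-- The edges leaving a layer upwards already carry projectors. For a minimum only one leg does, but
the projector slides around to the other leg and is absorbed there. -/
theorem phiLayer_mul_projectors_cod (l : ℕ) (p : Piece) (h : 2 * (l + p.dom) ≤ 2 * N) :
    Eqv f m (2 * N) (phiLayer d s ⟨l, p⟩ * projectors d l p.cod) (phiLayer d s ⟨l, p⟩) := by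
  cases p with
  | cup =>
    simp only [Piece.dom, Piece.cod] at h ⊢
    rw [phiLayer_cup, projectors_succ, projectors_one, mul_add]
    have hc : cups K (2 * l) ∈ homs K (2 * N) (2 * N + 4) := cups_mem (by omega) rfl
    have e1 := ((hf.projector_mul_self (N := 2 * N + 4) (l := 2 * l) (by omega)).mul_left hc)
    have e2 := (hf.projector_comm (N := 2 * N + 4) (l := 2 * l) (q := 2 * l + 2 * 1) (by omega)
      (by omega)).mul_left hc
    have e3 := (hf.cups_mul_projector (d := d) (N := 2 * N) (p := 2 * l) (by omega)).mul_right
      (projector d (2 * l))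
    have e4 := e1.mul_right (projector d (2 * l + 2 * 1))
    simp only [← mul_assoc] at e1 e2 e3 e4 ⊢
    exact e4.trans (e2.trans (e3.symm.trans e1))
  | cap =>
    simp only [Piece.cod]
    rw [projectors_zero, mul_one]
  | vertex a b =>
    obtain ⟨r, rfl⟩ := Nat.exists_eq_add_of_le (show l + a ≤ N by simp [Piece.dom] at h; omega)
    simp only [Piece.cod]
    rw [phiLayer, mul_assoc]
    refine (hf.projectors_mul_projectors (N := 2 * (l + b + r)) le_rfl le_rfl (by omega)).mul_left
      (Submodule.smul_mem _ _ (of_mem_homs ?_))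
    have h1 := lowerHalf_mem (2 * l) a (2 * r)
    have h2 := upperHalf_mem (2 * l) b (2 * r)
    have := mul_mem_graphDrawings h1 h2
    rwa [← mul_add, ← mul_add, ← mul_add, ← mul_add] at this

/-- The upper row splits in three: the middle is absorbed by the layer, while the left and right
parts pass below it and are absorbed by the lower row. -/
theorem projectors_mul_phiLayer_mul (l : ℕ) (p : Piece) (r : ℕ) :
    Eqv f m (2 * (l + p.dom + r))
      (projectors d 0 (l + p.dom + r) * phiLayer d s ⟨l, p⟩ * projectors d 0 (l + p.cod + r))
      (projectors d 0 (l + p.dom + r) * phiLayer d s ⟨l, p⟩) := by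
  have hx0 := phiLayer_mem (d := d) (s := s) 0 p 0
  have hxl := phiLayer_mem (d := d) (s := s) l p r
  simp only [zero_add, add_zero] at hx0
  have hl : projectors d 0 l ∈ homs K (2 * l) (2 * l) := projectors_mem (by omega)
  have hr : projectors d 0 r ∈ homs K (2 * r) (2 * r) := projectors_mem (by omega)
  have e1 := hf.exchange (N := 2 * (l + p.dom + r)) hl hx0 0 0 (by omega)
  have e2 := hf.exchange (N := 2 * (l + p.dom + r)) hx0 hr (2 * l) 0 (by omega)
  rw [show 0 + 2 * l + 0 = 2 * l by omega, shiftHom_zero, shiftHom_phiLayer, add_zero] at e1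
  rw [show 2 * l + 2 * p.cod + 0 = 2 * (l + p.cod) by omega,
    show 2 * l + 2 * p.dom + 0 = 2 * (l + p.dom) by omega, shiftHom_phiLayer, shiftHom_projectors,
    shiftHom_projectors, add_zero, add_zero, add_zero] at e2
  have e3 := hf.phiLayer_mul_projectors_cod (s := s) (N := l + p.dom + r) l p (by omega)
  have hP : ∀ {l' k'}, l' + k' ≤ l + p.dom + r → projectors d l' k' ∈
    homs K (2 * (l + p.dom + r)) (2 * (l + p.dom + r)) := fun h => projectors_mem (by omega)
  rw [projectors_add 0 (l + p.cod) r, projectors_add 0 l p.cod, zero_add, zero_add, mul_assoc]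
  have e4 := e1.symm.mul_right (projectors d l p.cod * projectors d (l + p.cod) r)
  have e4' := ((e3.mul_right (projectors d (l + p.cod) r)).trans e2).mul_left
    (hP (l' := 0) (k' := l) (by omega))
  simp only [mul_assoc] at e4 e4'
  replace e4 := e4.trans e4'
  have e5 := e4.mul_left (hP (l' := 0) (k' := l + p.dom + r) (by omega))
  simp only [← mul_assoc] at e5 ⊢
  refine e5.trans (Eqv.mul_right ?_ _)
  exact ((hf.projectors_mul_projectors (by omega) (by omega) (by omega)).mul_right _).trans
    (hf.projectors_mul_projectors (by omega) (by omega) (by omega))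

/-- Every edge crossing the top carries a projector somewhere below, so a further row is free.
Relations valid only in the presence of projectors thereby become usable at any height. -/
theorem projectors_mul_phiHom_mul {w : Word} : ∀ {k k' : ℕ}, w ∈ graphDrawings k k' →
    Eqv f m (2 * k) (projectors d 0 k * phiHom d s (ι w) * projectors d 0 k')
      (projectors d 0 k * phiHom d s (ι w)) := by
  induction w using FreeMonoid.inductionOn' with
  | one =>
    intro k k' h
    cases h
    rw [map_one, map_one, mul_one]
    exact hf.projectors_mul_projectors le_rfl le_rfl (by omega)
  | of_mul x w ih =>
    rintro k k' ⟨r, hr, hw⟩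
    dsimp at hr hw
    subst hr
    rw [phiHom_of_mul]
    have e1 := hf.projectors_mul_phiLayer_mul (s := s) x.pos x.piece r
    have hP : projectors d 0 (x.pos + x.piece.dom + r) * phiLayer d s x ∈
        homs K (2 * (x.pos + x.piece.dom + r)) (2 * (x.pos + x.piece.cod + r)) :=
      mul_mem_homs (projectors_mem (by omega)) (phiLayer_mem _ _ r)
    have e2 := (ih hw).mul_left hP
    have e3 := e1.symm.mul_right (phiHom d s (ι w))
    have e4 := e3.mul_right (projectors d 0 k')
    simp only [mul_assoc] at e1 e2 e3 e4 ⊢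
    exact e4.trans (e2.trans e3.symm)

end CurveInvariant

end

end PlanarAlg

/-! ## Isotopies of doubled drawings -/

namespace PlanarAlg

noncomputable section

variable {K : Type*} [CommRing K] {A : Type*} [AddCommGroup A] [Module K A]
variable {f : MonoidAlgebra K Word →ₗ[K] A} {d s : Kˣ} {m n N : ℕ}

local notation "ι" => MonoidAlgebra.of K Word

/-! ### Straightening doubled strands and turning vertex boundaries -/

namespace IsotopyInvariant

variable (hf : IsotopyInvariant f m)
include hf

theorem cups_mul_caps_right {p : ℕ} (h : p + 2 ≤ N) :
    Eqv f m N (cups K p * caps K (p + 2)) 1 := by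
  have e1 := ((hf.cup_cap (N := N + 2) (l := p + 1) (q := p + 1) le_rfl (by omega)).mul_left_of
    (N := N) (w := cup p) (cup_mem (by omega) rfl)).mul_right (ι (cap (p + 2)))
  have e2 := (hf.cup_cap_succ (N := N) (l := p) (by omega)).mul_right
    (ι (cup (p + 1)) * ι (cap (p + 2)))
  have e3 := hf.cup_cap_succ (N := N) (l := p + 1) (by omega)
  simp only [cups, caps, mul_assoc, one_mul, add_assoc, Nat.reduceAdd] at e1 e2 e3 ⊢
  exact e1.trans (e2.trans e3)

theorem cups_mul_caps_left {p : ℕ} (h : p + 2 ≤ N) :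
    Eqv f m N (cups K (p + 2) * caps K p) 1 := by
  have e1 := ((hf.cap_cup (N := N + 2) (l := p + 1) (q := p + 1) le_rfl
    (by omega)).symm.mul_left_of (N := N) (w := cup (p + 2)) (cup_mem (by omega) rfl)).mul_right
      (ι (cap p))
  have e2 := (hf.cup_succ_cap (N := N) (l := p + 1) (by omega)).mul_right
    (ι (cup (p + 1)) * ι (cap p))
  have e3 := hf.cup_succ_cap (N := N) (l := p) (by omega)
  simp only [cups, caps, mul_assoc, one_mul, add_assoc, Nat.reduceAdd] at e1 e2 e3 ⊢
  exact e1.trans (e2.trans e3)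

theorem cup_pow_mul_cap {r q k : ℕ} (h : r ≤ q) (hN : q + 2 ≤ N) :
    Eqv f m N (ι (cup r) ^ k * ι (cap (q + 2 * k))) (ι (cap q) * ι (cup r) ^ k) := by
  induction k with
  | zero => simp only [pow_zero, one_mul, mul_one]; rfl
  | succ k ih =>
    have e1 := (hf.cup_cap (N := N + 2 * k) (l := r) (q := q + 2 * k) (by omega)
      (by omega)).mul_left_of (N := N) (w := cup r ^ k) (cup_pow_mem (by omega) _ _ rfl)
    have e2 := ih.mul_right (ι (cup r))
    rw [map_pow] at e1
    rw [show q + 2 * (k + 1) = q + 2 * k + 2 by ring, pow_succ]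
    simp only [mul_assoc] at e1 e2 ⊢
    exact e1.trans e2

theorem cup_pow_mul_cap_left {r q k : ℕ} (h : q ≤ r) (hN : r + 2 ≤ N) :
    Eqv f m N (ι (cup (r + 2)) ^ k * ι (cap q)) (ι (cap q) * ι (cup r) ^ k) := by
  induction k with
  | zero => simp only [pow_zero, one_mul, mul_one]; rfl
  | succ k ih =>
    have e1 := (hf.cap_cup (N := N + 2 * k) (l := q) (q := r) (by omega)
      (by omega)).symm.mul_left_of (N := N) (w := cup (r + 2) ^ k)
        (cup_pow_mem (by omega) _ _ rfl)
    have e2 := ih.mul_right (ι (cup r))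
    rw [map_pow] at e1
    rw [pow_succ, pow_succ]
    simp only [mul_assoc] at e1 e2 ⊢
    exact e1.trans e2

theorem cup_pow_succ_mul_cap_right {p k : ℕ} (hN : p + 2 ≤ N) :
    Eqv f m N (ι (cup (p + 1)) ^ (k + 1) * ι (cap (p + 2 * k + 2))) (ι (cup (p + 1)) ^ k) := by
  have e1 := (hf.cup_pow_mul_cap (N := N + 2) (r := p + 1) (q := p + 2) (k := k) (by omega)
    (by omega)).mul_left_of (N := N) (w := cup (p + 1)) (cup_mem (by omega) rfl)
  have e2 := (hf.cup_cap_succ (N := N) (l := p + 1) (by omega)).mul_right (ι (cup (p + 1)) ^ k)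
  rw [one_mul, mul_assoc] at e2
  rw [pow_succ', mul_assoc, show p + 2 * k + 2 = p + 2 + 2 * k by ring]
  exact e1.trans e2

theorem cup_pow_succ_mul_cap_left {p k : ℕ} (hN : p + 1 ≤ N) :
    Eqv f m N (ι (cup (p + 1)) ^ (k + 1) * ι (cap p)) (ι (cup (p + 1)) ^ k) := by
  have e1 := (hf.cup_succ_cap (N := N + 2 * k) (l := p) (by omega)).mul_left_of (N := N)
    (w := cup (p + 1) ^ k) (cup_pow_mem (by omega) _ _ rfl)
  rwa [map_pow, mul_one, ← mul_assoc, ← pow_succ] at e1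

theorem cap_pow_mul_cap {p k : ℕ} (hN : p + 2 * k + 2 ≤ N) :
    Eqv f m N (ι (cap (p + 2)) ^ k * ι (cap p)) (ι (cap p) ^ (k + 1)) := by
  induction k generalizing N with
  | zero => simp only [pow_zero, one_mul, zero_add, pow_one]; rfl
  | succ k ih =>
    have e1 := (ih (N := N - 2) (by omega)).mul_left_of (N := N) (w := cap (p + 2))
      (cap_mem (by omega) (by omega))
    have e2 := (hf.cap_cap (N := N) (l := p) (q := p) le_rfl (by omega)).symm.mul_right
      (ι (cap p) ^ k)
    rw [pow_succ', mul_assoc]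
    refine e1.trans ?_
    rw [pow_succ' _ k, pow_succ' _ (k + 1), pow_succ' _ k, ← mul_assoc, ← mul_assoc]
    exact e2

theorem cup_mul_cup_pow {r k : ℕ} (h : r ≤ N) :
    Eqv f m N (ι (cup r) * ι (cup (r + 2)) ^ k) (ι (cup r) ^ (k + 1)) := by
  induction k with
  | zero => simp only [pow_zero, mul_one, zero_add, pow_one]; rfl
  | succ k ih =>
    have e1 := ih.mul_right (ι (cup (r + 2)))
    have e2 := (hf.cup_cup (N := N + 2 * k) (l := r) (q := r) le_rfl (by omega)).mul_left_of
      (N := N) (w := cup r ^ k) (cup_pow_mem (by omega) _ _ rfl)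
    rw [map_pow] at e2
    rw [pow_succ (ι (cup (r + 2))), ← mul_assoc]
    refine e1.trans ?_
    rw [pow_succ, mul_assoc]
    refine e2.trans (Eqv.of_eq ?_)
    rw [pow_succ, pow_succ, mul_assoc]

/-! ### Halves of the boundary of a vertex -/

theorem lowerHalf_mul_cap {p a : ℕ} (h : p + 1 ≤ N) :
    Eqv f m N (ι (lowerHalf p a) * ι (cap (p + 1))) (ι (lowerHalf p (a + 1))) := by
  cases a with
  | zero =>
    simp only [lowerHalf, pow_zero, map_one ι]
    exact hf.cup_cap_succ h
  | succ a =>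
    rw [← map_mul]
    simp only [lowerHalf, ← pow_succ]
    rfl

theorem lowerHalf_mul_cap_left {p a : ℕ} (h : p + 2 + 2 * a ≤ N) :
    Eqv f m N (ι (lowerHalf (p + 2) a) * ι (cap (p + 1))) (ι (lowerHalf p (a + 1))) := by
  cases a with
  | zero =>
    simp only [lowerHalf, pow_zero, map_one ι]
    exact hf.cup_succ_cap (by omega)
  | succ a =>
    simp only [lowerHalf, map_pow]
    exact hf.cap_pow_mul_cap (p := p + 1) (by omega)

theorem upperHalf_mul_caps {p b : ℕ} (h : p + 4 ≤ N) :
    Eqv f m N (ι (upperHalf p (b + 1)) * caps K (p + 2 * b))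
      (ι (cap (p + 1)) * ι (upperHalf p b)) := by
  cases b with
  | zero =>
    simp only [upperHalf, pow_zero, map_one ι, one_mul]
    rfl
  | succ b =>
    simp only [upperHalf, map_pow, caps]
    have e1 := (hf.cup_pow_mul_cap (N := N) (r := p + 1) (q := p + 1) (k := b + 1) (by omega)
      (by omega)).mul_right (ι (cap (p + 2 * b + 2)))
    have e2 := (hf.cup_pow_succ_mul_cap_right (N := N - 2) (p := p) (k := b)
      (by omega)).mul_left_of (N := N) (w := cap (p + 1)) (cap_mem (by omega) (by omega))
    rw [show p + 2 * (b + 1) + 1 = p + 1 + 2 * (b + 1) by ring,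
      show p + 2 * (b + 1) = p + 2 * b + 2 by ring, ← mul_assoc]
    refine e1.trans ?_
    rw [mul_assoc]
    exact e2

theorem upperHalf_mul_caps_left {p b : ℕ} (h : p + 4 ≤ N) :
    Eqv f m N (ι (upperHalf (p + 2) (b + 1)) * caps K p)
      (ι (cap (p + 1)) * ι (upperHalf p b)) := by
  have e1 := (hf.cup_pow_mul_cap_left (N := N) (r := p + 1) (q := p + 1) (k := b) le_rfl
    (by omega)).mul_right (ι (cap p))
  simp only [upperHalf, map_pow, caps]
  rw [← mul_assoc]
  refine e1.trans ?_
  rw [mul_assoc]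
  refine Eqv.mul_left_of (N' := N - 2) (cap_mem (by omega) (by omega)) ?_
  cases b with
  | zero => simp only [pow_zero, one_mul]; rfl
  | succ b =>
    simp only [map_pow]
    exact hf.cup_pow_succ_mul_cap_left (by omega)

/-- The doubled maximum pulls one boundary arc from the upper half to the lower half, where it
becomes one more `cap (p + 1)`. -/
theorem halves_mul_caps {p a b : ℕ} (h : p + 2 * a + 2 ≤ N) :
    Eqv f m N (ι (lowerHalf p a * upperHalf p (b + 1)) * caps K (p + 2 * b))
      (ι (lowerHalf p (a + 1) * upperHalf p b)) := by
  obtain ⟨r, rfl⟩ := Nat.exists_eq_add_of_le h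
  have e1 := (hf.upperHalf_mul_caps (N := p + 2 + (2 + r)) (p := p) (b := b)
    (by omega)).mul_left_of (N := p + 2 * a + 2 + r) (w := lowerHalf p a)
    (by simpa only [add_assoc] using lowerHalf_mem p a (2 + r))
  have e2 := (hf.lowerHalf_mul_cap (N := p + 2 * a + 2 + r) (p := p) (a := a) (by omega)).mul_right
    (ι (upperHalf p b))
  rw [map_mul, map_mul, mul_assoc]
  rw [mul_assoc] at e2
  exact e1.trans e2

theorem halves_mul_caps_left {p a b : ℕ} (h : p + 2 * a + 2 ≤ N) :
    Eqv f m N (ι (lowerHalf (p + 2) a * upperHalf (p + 2) (b + 1)) * caps K p)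
      (ι (lowerHalf p (a + 1) * upperHalf p b)) := by
  obtain ⟨r, rfl⟩ := Nat.exists_eq_add_of_le h
  have e1 := (hf.upperHalf_mul_caps_left (N := p + 2 + 2 + r) (p := p) (b := b)
    (by omega)).mul_left_of (N := p + 2 * a + 2 + r) (w := lowerHalf (p + 2) a)
    (by simpa only [add_right_comm] using lowerHalf_mem (p + 2) a r)
  have e2 := (hf.lowerHalf_mul_cap_left (N := p + 2 * a + 2 + r) (p := p) (a := a)
    (by omega)).mul_right (ι (upperHalf p b))
  rw [map_mul, map_mul, mul_assoc]
  rw [mul_assoc] at e2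
  exact e1.trans e2

end IsotopyInvariant

/-! ### Drawings without upper endpoints -/

namespace CurveInvariant

variable (hf : CurveInvariant f (d : K) m)
include hf

/-- The minimum rises past disjoint maxima until a maximum ends on one of its strands, which
straightens it, or on both, which closes a circle worth `d`. The scalar and the result are chosen
before `l`, so the same reduction holds wherever the drawing is placed. -/
theorem exists_cup_mul_caps (v : Word) : ∀ {n q : ℕ}, v ∈ graphDrawings (n + 2) 0 →
    (∀ x ∈ v.toList, x.piece = .cap) → q ≤ n → ∃ (c : K) (v' : Word), v' ∈ graphDrawings n 0 ∧
      (∀ x ∈ v'.toList, x.piece = .cap) ∧ ∀ l N, l + n ≤ N →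
        Eqv f m N (ι (cup (l + q)) * ι (shift l v)) (c • ι (shift l v')) := by
  induction v using FreeMonoid.inductionOn' with
  | one => intro n q h; cases h
  | of_mul x v ih =>
    rintro n q ⟨r, hr, hv⟩ hcap hq
    obtain ⟨j, p⟩ := x
    obtain rfl : p = .cap := hcap ⟨j, p⟩ (by simp)
    have hcap' : ∀ x ∈ v.toList, x.piece = .cap := fun x hx => hcap x (by simp [hx])
    simp only [Piece.dom, Piece.cod] at hr hv
    replace hv : v ∈ graphDrawings n 0 := by
      have : j + 0 + r = n := by omega
      rw [← this]; exact hv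
    have hsh : ∀ l, ι (shift l (FreeMonoid.of ⟨j, .cap⟩ * v)) = ι (cap (l + j)) * ι (shift l v) :=
      fun l => by rw [map_mul (shift l), map_mul ι]; rfl
    simp only [hsh, ← mul_assoc]
    obtain h | rfl | rfl | rfl | h : q + 2 ≤ j ∨ j = q + 1 ∨ j = q ∨ q = j + 1 ∨ j + 2 ≤ q := by
      omega
    · obtain ⟨n, rfl⟩ : ∃ n', n = n' + 2 := ⟨n - 2, by omega⟩
      obtain ⟨j, rfl⟩ : ∃ j', j = j' + 2 := ⟨j - 2, by omega⟩
      obtain ⟨c, v', hv', hc', he⟩ := ih hv hcap' (show q ≤ n by omega)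
      refine ⟨c, cap j * v', cap_mul_mem hv' (by omega), ?_, fun l N hN => ?_⟩
      · intro x hx
        simp only [FreeMonoid.toList_mul, List.mem_append] at hx
        obtain hx | hx := hx
        · rw [List.mem_singleton.mp hx]
        · exact hc' x hx
      · have e1 := (hf.cup_cap (N := N) (l := l + q) (q := l + j) (by omega) (by omega)).mul_right
          (ι (shift l v))
        have e2 := (he l (N - 2) (by omega)).mul_left_of (N := N) (w := cap (l + j))
          (cap_mem (by omega) (by omega))
        rw [mul_smul_comm] at e2
        rw [mul_assoc (ι (cap _))] at e1
        refine e1.trans (e2.trans (Eqv.of_eq ?_))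
        rw [map_mul (shift l), map_mul ι]; rfl
    · refine ⟨1, v, hv, hcap', fun l N hN => ?_⟩
      have := (hf.cup_cap_succ (N := N) (l := l + q) (by omega)).mul_right (ι (shift l v))
      rw [one_smul]
      rwa [one_mul, add_assoc] at this
    · refine ⟨d, v, hv, hcap', fun l N hN => ?_⟩
      have := (hf.circle (N := N) (l := l + j) (by omega)).mul_right (ι (shift l v))
      rwa [smul_mul_assoc, one_mul] at this
    · refine ⟨1, v, hv, hcap', fun l N hN => ?_⟩
      have := (hf.cup_succ_cap (N := N) (l := l + j) (by omega)).mul_right (ι (shift l v))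
      rw [one_smul]
      rwa [one_mul, add_assoc] at this
    · obtain ⟨n, rfl⟩ : ∃ n', n = n' + 2 := ⟨n - 2, by omega⟩
      obtain ⟨q, rfl⟩ : ∃ q', q = q' + 2 := ⟨q - 2, by omega⟩
      obtain ⟨c, v', hv', hc', he⟩ := ih hv hcap' (show q ≤ n by omega)
      refine ⟨c, cap j * v', cap_mul_mem hv' (by omega), ?_, fun l N hN => ?_⟩
      · intro x hx
        simp only [FreeMonoid.toList_mul, List.mem_append] at hx
        obtain hx | hx := hx
        · rw [List.mem_singleton.mp hx]
        · exact hc' x hx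
      · have e1 := (hf.cap_cup (N := N) (l := l + j) (q := l + q) (by omega)
          (by omega)).symm.mul_right (ι (shift l v))
        have e2 := (he l (N - 2) (by omega)).mul_left_of (N := N) (w := cap (l + j))
          (cap_mem (by omega) (by omega))
        rw [mul_smul_comm] at e2
        rw [mul_assoc (ι (cap _))] at e1
        refine e1.trans (e2.trans (Eqv.of_eq ?_))
        rw [map_mul (shift l), map_mul ι]; rfl

/-- A drawing without upper endpoints is a multiple of a drawing that consists of maxima. -/
theorem exists_caps (w : Word) : ∀ {n : ℕ}, w ∈ graphDrawings n 0 → ∃ (c : K) (v : Word),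
    (c = 0 ∨ v ∈ graphDrawings n 0 ∧ ∀ x ∈ v.toList, x.piece = .cap) ∧
      ∀ l N, l + n ≤ N → Eqv f m N (ι (shift l w)) (c • ι (shift l v)) := by
  induction w using FreeMonoid.inductionOn' with
  | one =>
    intro n h
    exact ⟨1, 1, Or.inr ⟨h, fun x hx => by simp at hx⟩, fun l N _ => by rw [one_smul]⟩
  | of_mul x w ih =>
    rintro n ⟨r, hr, hw⟩
    dsimp at hr hw
    obtain ⟨c, v, hv, he⟩ := ih hw
    obtain ⟨j, p⟩ := x
    dsimp at hr hw hv he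
    have hsh : ∀ l, ι (shift l (FreeMonoid.of ⟨j, p⟩ * w)) =
        ι (layer (l + j) p) * ι (shift l w) := fun l => by
      rw [map_mul (shift l), map_mul ι, shift_of]
    have he' : ∀ l N, l + n ≤ N → Eqv f m N (ι (layer (l + j) p) * ι (shift l w))
        (c • (ι (layer (l + j) p) * ι (shift l v))) := fun l N hN => by
      rw [← mul_smul_comm]
      refine (he l (N - p.dom + p.cod) (by omega)).mul_left_of ?_
      exact ⟨N - (l + j) - p.dom, by dsimp; omega, show _ = _ by dsimp; omega⟩
    simp only [hsh]
    obtain rfl | ⟨hv, hc⟩ := hv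
    · exact ⟨0, 1, Or.inl rfl, fun l N hN => by simpa only [zero_smul] using he' l N hN⟩
    cases p with
    | cup =>
      simp only [Piece.dom, Piece.cod] at hr hv
      rw [show j + 2 + r = n + 2 by omega] at hv
      obtain ⟨c', v', hv', hc', h⟩ := hf.exists_cup_mul_caps v hv hc (show j ≤ n by omega)
      refine ⟨c * c', v', Or.inr ⟨hv', hc'⟩, fun l N hN => (he' l N hN).trans ?_⟩
      rw [mul_smul]
      exact (h l N hN).smul c
    | cap =>
      simp only [Piece.dom, Piece.cod] at hr hv
      refine ⟨c, cap j * v, Or.inr ⟨?_, ?_⟩, fun l N hN => (he' l N hN).trans (Eqv.of_eq ?_)⟩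
      · have := cap_mul_mem (l := j) hv (by omega)
        rwa [show j + 0 + r + 2 = n by omega] at this
      · intro x hx
        simp only [FreeMonoid.toList_mul, List.mem_append] at hx
        obtain hx | hx := hx
        · rw [List.mem_singleton.mp hx]
        · exact hc x hx
      · rw [map_mul (shift l), map_mul ι]; rfl
    | vertex a b =>
      refine ⟨0, 1, Or.inl rfl, fun l N hN => ?_⟩
      have := (hf.vertex (N := N) (l := l + j) (a := a) (b := b)).mul_right (ι (shift l w))
      rwa [zero_mul, ← zero_smul K (ι (shift l 1))] at this

/-- A maximum needs two strands below it, so a closed drawing reduced to maxima is empty. The scalar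
is independent of the position, hence the same inside and outside a curve. -/
theorem exists_scalar {y : MonoidAlgebra K Word} (hy : y ∈ homs K 0 0) :
    ∃ c : K, ∀ l N, l ≤ N → Eqv f m N (shiftHom K l y) (c • 1) := by
  induction hy using Submodule.span_induction with
  | mem y hy =>
    obtain ⟨w, hw, rfl⟩ := hy
    obtain ⟨c, v, hv, he⟩ := hf.exists_caps w hw
    refine ⟨c, fun l N hN => ?_⟩
    rw [shiftHom_of]
    refine (he l N hN).trans (Eqv.of_eq ?_)
    obtain rfl | ⟨hv, hc⟩ := hv
    · rw [zero_smul, zero_smul]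
    · induction v using FreeMonoid.inductionOn' with
      | one => rw [map_one, map_one]
      | of_mul x v =>
        obtain ⟨r, hr, -⟩ := hv
        rw [hc x (by simp)] at hr
        simp only [Piece.dom] at hr
        omega
  | zero => exact ⟨0, fun l N _ => by rw [map_zero, zero_smul]⟩
  | add x y _ _ hx hy =>
    obtain ⟨c, hc⟩ := hx
    obtain ⟨c', hc'⟩ := hy
    exact ⟨c + c', fun l N h => by rw [map_add, add_smul]; exact (hc l N h).add (hc' l N h)⟩
  | smul a x _ hx =>
    obtain ⟨c, hc⟩ := hx
    exact ⟨a * c, fun l N h => by rw [map_smul, mul_smul]; exact (hc l N h).smul a⟩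

theorem exists_smul_cap {y : MonoidAlgebra K Word} (hy : y ∈ homs K 2 0) :
    ∃ c : K, ∀ l N, l + 2 ≤ N → Eqv f m N (shiftHom K l y) (c • ι (cap l)) := by
  induction hy using Submodule.span_induction with
  | mem y hy =>
    obtain ⟨w, hw, rfl⟩ := hy
    obtain ⟨c, v, hv, he⟩ := hf.exists_caps w hw
    refine ⟨c, fun l N hN => ?_⟩
    rw [shiftHom_of]
    refine (he l N hN).trans (Eqv.of_eq ?_)
    obtain rfl | ⟨hv, hc⟩ := hv
    · rw [zero_smul, zero_smul]
    · induction v using FreeMonoid.inductionOn' with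
      | one => cases hv
      | of_mul x v =>
        obtain ⟨j, p⟩ := x
        obtain rfl : p = .cap := hc ⟨j, p⟩ (by simp)
        obtain ⟨r, hr, hv⟩ := hv
        simp only [Piece.dom, Piece.cod] at hr hv
        obtain rfl : j = 0 := by omega
        obtain rfl : r = 0 := by omega
        rw [map_mul (shift l), shift_of]
        induction v using FreeMonoid.inductionOn' with
        | one => rw [map_one, mul_one]; rfl
        | of_mul x v =>
          obtain ⟨r, hr, -⟩ := hv
          rw [hc x (by simp)] at hr
          simp only [Piece.dom] at hr
          omega
  | zero => exact ⟨0, fun l N _ => by rw [map_zero, zero_smul]⟩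
  | add x y _ _ hx hy =>
    obtain ⟨c, hc⟩ := hx
    obtain ⟨c', hc'⟩ := hy
    exact ⟨c + c', fun l N h => by rw [map_add, add_smul]; exact (hc l N h).add (hc' l N h)⟩
  | smul a x _ hx =>
    obtain ⟨c, hc⟩ := hx
    exact ⟨a * c, fun l N h => by rw [map_smul, mul_smul]; exact (hc l N h).smul a⟩

end CurveInvariant

end

end PlanarAlg

/-! ## The chromatic relations for doubled drawings -/

namespace PlanarAlg

noncomputable section

variable {K : Type*} [CommRing K] {A : Type*} [AddCommGroup A] [Module K A]
variable {f : MonoidAlgebra K Word →ₗ[K] A} {d s : Kˣ} {m n N : ℕ}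

local notation "ι" => MonoidAlgebra.of K Word

theorem lowerHalf_zero (p : ℕ) : lowerHalf p 0 = cup p := rfl

theorem lowerHalf_one (p : ℕ) : lowerHalf p 1 = 1 := pow_zero _

theorem upperHalf_zero (p : ℕ) : upperHalf p 0 = cap p := rfl

theorem upperHalf_one (p : ℕ) : upperHalf p 1 = 1 := pow_zero _

theorem halves_mem {p a b M : ℕ} (h : p + 2 * a ≤ N) (hM : N + 2 * b = M + 2 * a) :
    lowerHalf p a * upperHalf p b ∈ graphDrawings N M := by
  obtain ⟨r, rfl⟩ := Nat.exists_eq_add_of_le h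
  obtain rfl : M = p + 2 * b + r := by omega
  exact mul_mem_graphDrawings (lowerHalf_mem p a r) (upperHalf_mem p b r)

namespace IsotopyInvariant

variable (hf : IsotopyInvariant f m)
include hf

theorem projectors_mul_caps_comm {l k p : ℕ} (h : 2 * (l + k) ≤ p) (hN : p + 4 ≤ N) :
    Eqv f m N (projectors d l k * caps K p) (caps K p * projectors d l k) := by
  obtain ⟨r, rfl⟩ := Nat.exists_eq_add_of_le h
  have := hf.exchange (N := N) (projectors_mem (d := d) (l := 0) (c := k) (N := 2 * k) (by omega))
    (caps_mem (K := K) (p := 0) (N := 0) le_rfl rfl) (2 * l) r (by omega)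
  rwa [shiftHom_projectors, shiftHom_caps, add_zero, add_zero, ← mul_add] at this

theorem projectors_mul_caps_left {l k p : ℕ} (h : p ≤ 2 * l) (hN : 2 * (l + 2 + k) ≤ N) :
    Eqv f m N (projectors d (l + 2) k * caps K p) (caps K p * projectors d l k) := by
  obtain ⟨r, hr⟩ := Nat.exists_eq_add_of_le h
  have := hf.exchange (N := N) (caps_mem (K := K) (p := 0) (N := 0) le_rfl rfl)
    (projectors_mem (d := d) (l := 0) (c := k) (N := 2 * k) (by omega)) p r (by omega)
  rw [show p + 0 + r = 2 * l by omega, show p + (0 + 4) + r = 2 * (l + 2) by omega,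
    shiftHom_projectors, shiftHom_projectors, shiftHom_caps, add_zero, add_zero, add_zero] at this
  exact this.symm

/-- The projector moves above the doubled zigzag, which then straightens. -/
theorem cups_mul_projector_mul_caps_right {l : ℕ} (h : 2 * l + 2 ≤ N) :
    Eqv f m N (cups K (2 * l) * projector d (2 * l) * caps K (2 * (l + 1)))
      (projector d (2 * l)) := by
  have e1 := (hf.projectors_mul_caps_comm (d := d) (N := N + 4) (l := l) (k := 1)
    (p := 2 * (l + 1)) le_rfl (by omega)).mul_left (cups_mem (K := K) (p := 2 * l) (by omega) rfl)
  have e2 := (hf.cups_mul_caps_right (K := K) (N := N) (p := 2 * l) h).mul_right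
    (projector d (2 * l))
  rw [projectors_one] at e1
  rw [one_mul] at e2
  simp only [mul_assoc] at e1 e2 ⊢
  exact e1.trans e2

theorem cups_mul_projector_mul_caps_left {l : ℕ} (h : 2 * l + 2 ≤ N) :
    Eqv f m N (cups K (2 * (l + 1)) * projector d (2 * (l + 1)) * caps K (2 * l))
      (projector d (2 * l)) := by
  have e0 := (hf.cups_mul_projector (d := d) (N := N) (p := 2 * (l + 1)) (by omega)).mul_right
    (caps K (2 * l))
  have e1 := (hf.projectors_mul_caps_left (d := d) (N := N + 4) (l := l) (k := 1)
    (p := 2 * l) le_rfl (by omega)).mul_left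
      (cups_mem (K := K) (p := 2 * (l + 1)) (by omega) rfl)
  have e2 := (hf.cups_mul_caps_left (K := K) (N := N) (p := 2 * l) h).mul_right
    (projector d (2 * l))
  rw [projectors_one, projectors_one] at e1
  rw [one_mul] at e2
  simp only [mul_assoc] at e0 e1 e2 ⊢
  exact e0.trans (e1.trans e2)

end IsotopyInvariant

theorem units_zpow_sub_two (hs : s ^ 2 = d) (k : ℤ) :
    ((s ^ (k - 2) : Kˣ) : K) = ((d⁻¹ : Kˣ) : K) * ((s ^ k : Kˣ) : K) := by
  rw [← Units.val_mul, ← hs]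
  congr 1
  rw [zpow_sub, mul_comm]
  rfl

/-- An identity of formal combinations, needing no isotopy: expand the one projector on the
contracted edge. The parallel strands carry the exponent `a + b - 2`; the turn-backs carry an extra
`-d⁻¹`, which is the ratio of the factors after deleting the edge. -/
theorem phiHom_contract (hs : s ^ 2 = d) (l a b : ℕ) :
    phiHom d s (ι (layer l (.vertex a 1)) * ι (layer l (.vertex 1 b))) =
      phiHom d s (ι (layer l (.vertex a b)) - ι (layer l (.vertex a 0)) * ι (layer l (.vertex 0 b)))
    := by
  have h1 : s ^ ((a : ℤ) + (1 : ℕ) - 2) * s ^ (((1 : ℕ) : ℤ) + b - 2) = s ^ ((a : ℤ) + b - 2) := by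
    rw [← zpow_add]; congr 1; push_cast; ring
  have h2 : s ^ ((a : ℤ) + (0 : ℕ) - 2) * s ^ (((0 : ℕ) : ℤ) + b - 2) =
      d⁻¹ * s ^ ((a : ℤ) + b - 2) := by
    rw [← zpow_add, ← hs, ← zpow_natCast, ← zpow_neg, ← zpow_add]; congr 1; push_cast; ring
  replace h1 := congrArg Units.val h1
  replace h2 := congrArg Units.val h2
  rw [Units.val_mul] at h1 h2
  rw [Units.val_mul] at h2
  rw [map_sub, map_mul, map_mul]
  simp only [phiHom_layer, phiLayer, projectors_one, projectors_zero, mul_one,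
    map_mul ι, lowerHalf_zero, lowerHalf_one, upperHalf_zero, upperHalf_one, one_mul,
    smul_mul_assoc, mul_smul_comm, smul_smul, projector, mul_sub, sub_mul, smul_sub,
    mul_assoc]
  congr 2
  · linear_combination h1
  · linear_combination ((d⁻¹ : Kˣ) : K) * h1 - h2

namespace CurveInvariant

variable (hf : CurveInvariant f (d : K) m)
include hf

theorem projectors_mul_projector_left {i k : ℕ} (h : i < k) :
    Eqv f m (2 * k) (projectors d 0 k * projector d (2 * i)) (projectors d 0 k) :=
  hf.projectors_mul_projector (by omega) (by omega) (by omega)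

/-! ### Isotopies -/

theorem phiHom_exchange (l k : ℕ) (p p' : Piece) (h : l + p.dom + k + p'.dom ≤ N) :
    Eqv f m (2 * N) (phiHom d s (ι (layer l p * layer (l + p.cod + k) p')))
      (phiHom d s (ι (layer (l + p.dom + k) p' * layer l p))) := by
  have := hf.exchange (N := 2 * N) (phiLayer_mem (d := d) (s := s) 0 p 0)
    (phiLayer_mem (d := d) (s := s) 0 p' 0) (2 * l) (2 * k) (by omega)
  simp only [zero_add, add_zero, ← mul_add, shiftHom_phiLayer] at this
  simpa only [map_mul ι, map_mul, phiHom_layer] using this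

theorem phiHom_straighten_left {l : ℕ} (h : l + 1 ≤ N) :
    Eqv f m (2 * N) (projectors d 0 N * phiHom d s (ι (cup l * cap (l + 1))))
      (projectors d 0 N * phiHom d s (ι 1)) := by
  simp only [map_mul ι, map_mul, map_one, mul_one, cup, cap, phiHom_layer, phiLayer_cup,
    phiLayer_cap]
  exact ((hf.cups_mul_projector_mul_caps_right (by omega)).mul_left
    (projectors_mem (by omega))).trans (hf.projectors_mul_projector_left (by omega))

theorem phiHom_straighten_right {l : ℕ} (h : l + 1 ≤ N) :
    Eqv f m (2 * N) (projectors d 0 N * phiHom d s (ι (cup (l + 1) * cap l)))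
      (projectors d 0 N * phiHom d s (ι 1)) := by
  simp only [map_mul ι, map_mul, map_one, mul_one, cup, cap, phiHom_layer, phiLayer_cup,
    phiLayer_cap]
  exact ((hf.cups_mul_projector_mul_caps_left (by omega)).mul_left
    (projectors_mem (by omega))).trans (hf.projectors_mul_projector_left (by omega))

/-- The projector on the turned edge slides over the doubled maximum, moves down past the vertex and
is absorbed by the bottom row. The rest is `halves_mul_caps`; the valence, and so the power of `s`,
is unchanged. -/
theorem phiHom_turn_right {l a b : ℕ} (h : l + a + 1 ≤ N) :
    Eqv f m (2 * N) (projectors d 0 N * phiHom d s (ι (layer l (.vertex a (b + 1)) * cap (l + b))))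
      (projectors d 0 N * phiHom d s (ι (layer l (.vertex (a + 1) b)))) := by
  obtain ⟨r, rfl⟩ := Nat.exists_eq_add_of_le h
  have hLU : ι (lowerHalf (2 * l) a * upperHalf (2 * l) (b + 1)) ∈
      homs K (2 * (l + a + 1 + r)) (2 * (l + b + 2 + r)) :=
    of_mem_homs (halves_mem (by omega) (by omega))
  have hLU0 : ι (lowerHalf 0 a * upperHalf 0 (b + 1)) * projectors d 0 b ∈
      homs K (2 * a) (2 * (b + 1)) :=
    mul_mem_homs (of_mem_homs (halves_mem (by omega) (by omega))) (projectors_mem (by omega))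
  have e1 := (hf.projector_mul_caps (d := d) (N := 2 * (l + b + 2 + r)) (p := 2 * (l + b))
    (by omega)).mul_left (mul_mem_homs hLU (projectors_mem (d := d) (l := l) (c := b) (by omega)))
  have e2 := (hf.exchange (N := 2 * (l + a + 1 + r)) hLU0
    (projector_mem (d := d) (N := 2) (l := 0) le_rfl) (2 * l) 0 (by omega)).mul_right
      (caps K (2 * (l + b)))
  have hP : projector d (2 * (l + a)) ∈ homs K (2 * (l + a + 1 + r)) (2 * (l + a + 1 + r)) :=
    projector_mem (by omega)
  have e3 := ((hf.projectors_mul_caps_comm (d := d) (N := 2 * (l + b + 2 + r)) (l := l) (k := b)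
    (p := 2 * (l + b)) le_rfl (by omega)).mul_left hLU).mul_left hP
  have e4 := ((hf.halves_mul_caps (K := K) (N := 2 * (l + a + 1 + r)) (p := 2 * l) (a := a)
    (b := b) (by omega)).mul_right (projectors d l b)).mul_left hP
  have e5 := (hf.projectors_mul_projector_left (k := l + a + 1 + r) (i := l + a)
    (by omega)).mul_right
      (ι (lowerHalf (2 * l) (a + 1) * upperHalf (2 * l) b) * projectors d l b)
  rw [map_mul (shiftHom K _), shiftHom_of, map_mul (shift _), shift_lowerHalf, shift_upperHalf,
    shiftHom_projectors, shiftHom_projector, shiftHom_projector] at e2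
  simp only [add_zero, ← mul_add] at e2 e4
  rw [show 2 * (l + (b + 1)) = 2 * (l + b) + 2 by ring] at e2
  simp only [map_mul ι, map_mul, cap, phiHom_layer, phiLayer,
    smul_mul_assoc, mul_smul_comm, projectors_succ, mul_assoc] at e1 e2 e3 e4 e5 ⊢
  rw [show ((a + 1 : ℕ) : ℤ) + b - 2 = a + (b + 1 : ℕ) - 2 by push_cast; ring]
  exact Eqv.smul _ (((e1.trans (e2.trans (e3.trans e4))).mul_left
    (projectors_mem (by omega))).trans e5)

theorem phiHom_turn_left {l a b : ℕ} (h : l + a + 1 ≤ N) :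
    Eqv f m (2 * N) (projectors d 0 N * phiHom d s (ι (layer (l + 1) (.vertex a (b + 1)) * cap l)))
      (projectors d 0 N * phiHom d s (ι (layer l (.vertex (a + 1) b)))) := by
  obtain ⟨r, rfl⟩ := Nat.exists_eq_add_of_le h
  have hLU : ι (lowerHalf (2 * l + 2) a * upperHalf (2 * l + 2) (b + 1)) ∈
      homs K (2 * (l + a + 1 + r)) (2 * (l + b + 2 + r)) :=
    of_mem_homs (halves_mem (by omega) (by omega))
  have hLU0 : ι (lowerHalf 0 a * upperHalf 0 (b + 1)) ∈ homs K (2 * a) (2 * (b + 1)) :=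
    of_mem_homs (halves_mem (by omega) (by omega))
  have e1 := (hf.projectors_mul_caps_left (d := d) (N := 2 * (l + b + 2 + r)) (l := l) (k := b)
    (p := 2 * l) le_rfl (by omega)).mul_left (mul_mem_homs hLU
      (projector_mem (d := d) (l := 2 * l + 2) (by omega)))
  have e2 := ((hf.projector_mul_caps (d := d) (N := 2 * (l + b + 2 + r)) (p := 2 * l)
    (by omega)).symm.mul_left hLU).mul_right (projectors d l b)
  have e3 := (hf.exchange (N := 2 * (l + a + 1 + r))
    (projector_mem (d := d) (N := 2) (l := 0) le_rfl) hLU0 (2 * l) 0 (by omega)).symm.mul_right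
      (caps K (2 * l) * projectors d l b)
  have hP : projector d (2 * l) ∈ homs K (2 * (l + a + 1 + r)) (2 * (l + a + 1 + r)) :=
    projector_mem (by omega)
  have e4 := ((hf.halves_mul_caps_left (K := K) (N := 2 * (l + a + 1 + r)) (p := 2 * l) (a := a)
    (b := b) (by omega)).mul_right (projectors d l b)).mul_left hP
  have e5 := (hf.projectors_mul_projector_left (k := l + a + 1 + r) (i := l)
    (by omega)).mul_right
      (ι (lowerHalf (2 * l) (a + 1) * upperHalf (2 * l) b) * projectors d l b)
  rw [shiftHom_of, map_mul (shift _), shift_lowerHalf, shift_upperHalf, shiftHom_projector] at e3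
  simp only [add_zero] at e3
  simp only [map_mul ι, map_mul, cap, phiHom_layer, phiLayer,
    smul_mul_assoc, mul_smul_comm, projectors_succ' _ b, add_assoc l, Nat.reduceAdd, mul_assoc,
    show 2 * (l + 1) = 2 * l + 2 from rfl] at e1 e2 e3 e4 e5 ⊢
  rw [show ((a + 1 : ℕ) : ℤ) + b - 2 = a + (b + 1 : ℕ) - 2 by push_cast; ring]
  exact Eqv.smul _ (((e1.trans (e2.trans (e3.trans e4))).mul_left
    (projectors_mem (by omega))).trans e5)

theorem phiHom_move {x y : Word} (h : Move x y) {M M' : ℕ} (hx : x ∈ graphDrawings N M)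
    (hy : y ∈ graphDrawings N M') : Eqv f m (2 * N) (projectors d 0 N * phiHom d s (ι x))
      (projectors d 0 N * phiHom d s (ι y)) := by
  cases h with
  | exchange l k p p' =>
    obtain ⟨r, hr, r', hr', -⟩ := hy
    obtain ⟨t, ht, t', ht', -⟩ := hx
    dsimp at hr hr' ht ht'
    exact (hf.phiHom_exchange l k p p' (by omega)).mul_left (projectors_mem (by omega))
  | straighten_left l =>
    obtain ⟨t, ht, t', ht', -⟩ := hx
    simp only [Piece.dom, Piece.cod] at ht ht'
    exact hf.phiHom_straighten_left (by omega)
  | straighten_right l =>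
    obtain ⟨t, ht, t', ht', -⟩ := hx
    simp only [Piece.dom, Piece.cod] at ht ht'
    exact hf.phiHom_straighten_right (by omega)
  | turn_right l a b =>
    obtain ⟨r, hr, -⟩ := hy
    simp only [Piece.dom] at hr
    exact hf.phiHom_turn_right (by omega)
  | turn_left l a b =>
    obtain ⟨r, hr, -⟩ := hy
    simp only [Piece.dom] at hr
    exact hf.phiHom_turn_left (by omega)

/-! ### Vertices -/

/-- The boundary of a leaf is a turn-back fed into a projector: the circle it creates is worth `d`,
and `1 - d⁻¹ * d = 0`. -/
theorem phiHom_leaf {l : ℕ} (h : l ≤ N) :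
    Eqv f m (2 * N) (phiHom d s (ι (layer l (.vertex 0 1)))) 0 := by
  have e1 := ((hf.circle (N := 2 * N) (l := 2 * l) (by omega)).mul_right (ι (cup (2 * l)))).smul
    (((d⁻¹ : Kˣ) : K))
  have e2 := (Eqv.refl (f := f) (m := m) (N := 2 * N) (ι (cup (2 * l)))).sub e1
  rw [smul_mul_assoc, smul_smul, one_mul, Units.inv_mul, one_smul, sub_self, mul_assoc] at e2
  rw [phiHom_layer, phiLayer, projectors_one, lowerHalf_zero, upperHalf_one, mul_one,
    smul_mul_assoc, projector, map_mul ι, mul_sub, mul_smul_comm, mul_one]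
  have e3 := e2.smul ((s ^ (((0 : ℕ) : ℤ) + (1 : ℕ) - 2) : Kˣ) : K)
  rw [smul_zero] at e3
  exact e3

theorem phiHom_smooth {l : ℕ} (h : l + 1 ≤ N) :
    Eqv f m (2 * N) (projectors d 0 N * phiHom d s (ι (layer l (.vertex 1 1))))
      (projectors d 0 N * phiHom d s 1) := by
  have := hf.projectors_mul_projector_left (i := l) (k := N) (by omega)
  simpa only [phiHom_layer, phiLayer, projectors_one, lowerHalf_one, lowerHalf_zero, upperHalf_one,
    upperHalf_zero, mul_one, Nat.cast_one, map_one, Int.reduceAdd, Int.reduceSub, zpow_zero,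
    Units.val_one, one_smul, one_mul] using this

theorem phiHom_isolated (hs : s ^ 2 = d) {l : ℕ} (h : l ≤ N) :
    Eqv f m (2 * N) (phiHom d s (ι (layer l (.vertex 0 0)))) (phiHom d s 1) := by
  have := (hf.circle (N := 2 * N) (l := 2 * l) (by omega)).smul ((d⁻¹ : Kˣ) : K)
  rw [smul_smul, Units.inv_mul, one_smul] at this
  simp only [phiHom_layer, phiLayer, projectors_zero, lowerHalf_zero, upperHalf_zero, mul_one,
    Nat.cast_zero, zero_add, map_one, units_zpow_sub_two hs, zpow_zero, Units.val_one, map_mul ι]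
  exact this

end CurveInvariant

end

end PlanarAlg

/-! ## Loops and circles in doubled drawings -/

namespace PlanarAlg

noncomputable section

variable {K : Type*} [CommRing K] {A : Type*} [AddCommGroup A] [Module K A]
variable {f : MonoidAlgebra K Word →ₗ[K] A} {d s : Kˣ} {m n N : ℕ}

local notation "ι" => MonoidAlgebra.of K Word

theorem upperHalf_succ (p b : ℕ) : ι (upperHalf p (b + 1)) = ι (cup (p + 1)) ^ b :=
  map_pow ι _ _

namespace CurveInvariant

variable (hf : CurveInvariant f (d : K) m)
include hf

/-- Parallel strands close up to two nested circles, worth `d ^ 2`; the turn-backs join them into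
one circle, worth `d` times `d⁻¹`. -/
theorem cups_mul_projector_mul_caps {p : ℕ} (h : p ≤ N) :
    Eqv f m N (cups K p * projector d p * caps K p) (((d : K) ^ 2 - 1) • 1) := by
  have hp : cup p ∈ graphDrawings N (N + 2) := cup_mem h rfl
  have hc := hf.circle (N := N) (l := p) h
  have e1 := ((hf.circle (N := N + 2) (l := p + 1) (by omega)).mul_left_of hp).mul_right (ι (cap p))
  have e2 := ((hf.cup_succ_cap (N := N + 2) (l := p) (by omega)).mul_left_of hp).mul_right
    (ι (cup p) * (ι (cap (p + 1)) * ι (cap p)))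
  have e3 := ((hf.cup_cap_succ (N := N + 2) (l := p) (by omega)).mul_left_of hp).mul_right
    (ι (cap p))
  simp only [mul_smul_comm, smul_mul_assoc, mul_one, mul_assoc] at e1 e2 e3
  have e4 := (e1.trans (hc.smul (d : K))).sub ((e2.trans (e3.trans hc)).smul ((d⁻¹ : Kˣ) : K))
  refine Eqv.trans (Eqv.of_eq ?_) (e4.trans (Eqv.of_eq ?_))
  · simp only [cups, caps, projector, map_mul ι, mul_sub, sub_mul, mul_one, mul_smul_comm,
      smul_mul_assoc, mul_assoc]
  · rw [smul_smul, smul_smul, Units.inv_mul, sub_smul, sq]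

/-- Only empty circles can be removed, so the enclosed graph is first replaced by its scalar value.
-/
theorem phiHom_circle {l : ℕ} {X : Word} (hX : X ∈ graphDrawings 0 0) (h : l ≤ N) :
    Eqv f m (2 * N) (phiHom d s (ι (cup l) * ι (shift (l + 1) X) * ι (cap l)))
      (phiHom d s (((d : K) ^ 2 - 1) • ι (shift l X))) := by
  have hx : phiHom d s (ι X) ∈ homs K 0 0 := phiHom_mem_of (k := 0) (k' := 0) hX
  obtain ⟨c, hc⟩ := hf.exists_scalar hx
  have e1 := ((hc (2 * (l + 1)) (2 * N + 4) (by omega)).mul_left (mul_mem_homs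
    (cups_mem (K := K) (N := 2 * N) (p := 2 * l) (by omega) rfl)
    (projector_mem (d := d) (l := 2 * l) (by omega)))).mul_right (caps K (2 * l))
  have e2 := (hf.cups_mul_projector_mul_caps (N := 2 * N) (p := 2 * l) (by omega)).smul c
  have e3 := (hc (2 * l) (2 * N) (by omega)).smul ((d : K) ^ 2 - 1)
  rw [mul_smul_comm, smul_mul_assoc, mul_one] at e1
  rw [map_mul, map_mul, map_smul, phiHom_shift, phiHom_shift, cup, cap, phiHom_layer,
    phiHom_layer, phiLayer_cup, phiLayer_cap]
  refine e1.trans (e2.trans (Eqv.trans (Eqv.of_eq ?_) e3.symm))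
  exact smul_comm _ _ _

/-- The parallel-strand term of a loop. Once the enclosed part is reduced to a scalar or to a
multiple of one maximum, the inner strand of the loop closes to a circle, giving `d`. -/
theorem upperHalf_mul_shiftHom_mul_caps {c p : ℕ} {y : MonoidAlgebra K Word}
    (hy : y ∈ homs K (2 * c) 0) (h : p + 2 ≤ N) :
    Eqv f m N (ι (upperHalf p (c + 2)) * shiftHom K (p + 2) y * caps K p)
      ((d : K) • (ι (upperHalf p c) * shiftHom K p y)) := by
  rw [upperHalf_succ]
  have hcirc := (hf.circle (N := N) (l := p + 1) (by omega)).mul_right (ι (cap p))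
  rw [smul_mul_assoc, one_mul, mul_assoc] at hcirc
  cases c with
  | zero =>
    obtain ⟨k, hk⟩ := hf.exists_scalar hy
    have e1 := ((hk (p + 2) (N + 2) (by omega)).mul_left_of (N := N) (w := cup (p + 1))
      (cup_mem (by omega) (by omega))).mul_right (caps K p)
    have e2 := ((hk p (N - 2) (by omega)).mul_left_of (N := N) (w := cap p)
      (cap_mem (by omega) (by omega))).smul (d : K)
    rw [mul_smul_comm, smul_mul_assoc, mul_one] at e1
    rw [mul_smul_comm, mul_one] at e2
    rw [zero_add, pow_one, upperHalf_zero]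
    refine e1.trans ((hcirc.smul k).trans (Eqv.trans (Eqv.of_eq ?_) e2.symm))
    exact smul_comm _ _ _
  | succ c =>
    rw [upperHalf_succ]
    have hz : ι (cup 1 ^ c) * y ∈ homs K 2 0 :=
      mul_mem_homs (of_mem_homs (cup_pow_mem (by omega) c _ (by omega))) hy
    obtain ⟨k, hk⟩ := hf.exists_smul_cap hz
    have hk0 := hk p N h
    have hk2 := hk (p + 2) (N + 4) (by omega)
    simp only [map_mul (shiftHom K _), shiftHom_of, map_pow, shift_cup, add_assoc,
      Nat.reduceAdd] at hk0 hk2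
    have e1 := (hf.cup_mul_cup_pow (N := N + 2) (r := p + 1) (k := c) (by omega)).mul_left_of
      (N := N) (w := cup (p + 1)) (cup_mem (by omega) rfl)
    have e2 := e1.symm.mul_right (shiftHom K (p + 2) y * caps K p)
    have e3 := (hk2.mul_left_of (N := N) (w := cup (p + 1) * cup (p + 1))
      (mul_mem_graphDrawings (cup_mem (m := N + 2) (by omega) rfl)
        (cup_mem (by omega) rfl))).mul_right (caps K p)
    have e4 := (((hf.cup_cap_succ (N := N + 2) (l := p + 1) (by omega)).mul_left_of (N := N)
      (w := cup (p + 1)) (cup_mem (by omega) rfl)).mul_right (caps K p)).smul k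
    rw [mul_smul_comm, smul_mul_assoc, map_mul ι] at e3
    rw [← pow_succ'] at e2
    simp only [add_assoc, Nat.reduceAdd, mul_assoc, one_mul] at e2 e3 e4 ⊢
    refine e2.trans (e3.trans (e4.trans ((hcirc.smul k).trans
      (Eqv.trans (Eqv.of_eq ?_) (hk0.symm.smul (d : K))))))
    exact smul_comm _ _ _

/-- The turn-back term of a loop. It cuts the loop open, and everything straightens without creating
a circle, so the coefficient is one and `y` need not be evaluated. -/
theorem upperHalf_mul_cap_mul_cup_mul {c p : ℕ} {y : MonoidAlgebra K Word}
    (hy : y ∈ homs K (2 * c) 0) (h : p + 2 ≤ N) :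
    Eqv f m N (ι (upperHalf p (c + 2)) * (ι (cap p) * ι (cup p)) * shiftHom K (p + 2) y * caps K p)
      (ι (upperHalf p c) * shiftHom K p y) := by
  rw [upperHalf_succ]
  obtain ⟨r, rfl⟩ := Nat.exists_eq_add_of_le h
  have hU : ι (cup (p + 1)) ^ (c + 1) ∈ homs K (p + 2 + r) (p + 2 * c + r + 4) := by
    rw [← map_pow]
    exact of_mem_homs (cup_pow_mem (by omega) _ _ (by omega))
  have hUc : ι (cup (p + 1)) ^ c ∈ homs K (p + 2 + r) (p + 2 + 2 * c + r) := by
    rw [← map_pow]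
    exact of_mem_homs (cup_pow_mem (by omega) _ _ (by omega))
  have hcap : ι (cap p) ∈ homs K (p + 2 * c + r + 4) (p + 2 * c + r + 2) :=
    of_mem_homs (cap_mem (by omega) (by omega))
  have hY := shiftHom_mem_homs (K := K) p (r + 2) hy
  have e1 := ((hf.exchange (N := p + 2 * c + r + 2) (of_mem_homs (K := K) (w := cup 0) (n := 0)
    (m := 2) (cup_mem le_rfl rfl)) hy p 0 (by omega)).mul_left (mul_mem_homs hU hcap)).mul_right
      (caps K p)
  have e2 := ((hf.cup_cap_succ (N := p + r + 2) (l := p) (by omega)).mul_left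
    (mul_mem_homs hU (mul_mem_homs hcap hY))).mul_right (ι (cap p))
  have e3 := (hf.cup_pow_succ_mul_cap_left (N := p + 2 + r) (p := p) (k := c)
    (by omega)).mul_right (shiftHom K p y * ι (cap p))
  have e4 := (hf.exchange (N := p + 2 + 2 * c + r) hy (of_mem_homs (K := K) (w := cap 0) (n := 2)
    (m := 0) (cap_mem le_rfl rfl)) p 0 (by omega)).mul_left hUc
  have e5 : Eqv f m (p + 2 + r) (ι (cup (p + 1)) ^ c * ι (cap (p + 2 * c)))
      (ι (upperHalf p c)) := by
    cases c with
    | zero => rw [pow_zero, one_mul]; rfl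
    | succ c =>
      rw [upperHalf_succ]
      exact hf.cup_pow_succ_mul_cap_right (by omega)
  have e6 := e5.mul_right (shiftHom K p y)
  simp only [shiftHom_of, shift_cup, shift_cap, add_zero, caps, mul_assoc, one_mul]
    at e1 e2 e3 e4 e6 ⊢
  exact e1.trans (e2.trans (e3.trans (e4.trans e6)))

theorem upperHalf_mul_projector_mul {c p : ℕ} {y : MonoidAlgebra K Word}
    (hy : y ∈ homs K (2 * c) 0) (h : p + 2 ≤ N) :
    Eqv f m N (ι (upperHalf p (c + 2)) * projector d p * shiftHom K (p + 2) y * caps K p)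
      (((d : K) - ((d⁻¹ : Kˣ) : K)) • (ι (upperHalf p c) * shiftHom K p y)) := by
  have := (hf.upperHalf_mul_shiftHom_mul_caps hy h).sub
    ((hf.upperHalf_mul_cap_mul_cup_mul hy h).smul ((d⁻¹ : Kˣ) : K))
  rw [← sub_smul] at this
  simpa only [projector, mul_sub, sub_mul, mul_one, mul_smul_comm, smul_mul_assoc, map_mul ι]
    using this

/-- The last of the projectors on the edges inside a loop moves along the loop to its first end. -/
theorem projectors_mul_shiftHom_mul_caps {l c : ℕ} {x : MonoidAlgebra K Word}
    (hx : x ∈ homs K (2 * c) 0) (h : 2 * (l + c + 2) ≤ N) :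
    Eqv f m N (projectors d l (c + 2) * shiftHom K (2 * (l + 1)) x * caps K (2 * l))
      (projector d (2 * l) * shiftHom K (2 * l + 2) (projectors d 0 c * x) * caps K (2 * l)) := by
  obtain ⟨r, rfl⟩ := Nat.exists_eq_add_of_le h
  have hP : projector d 0 ∈ homs K 2 2 := projector_mem le_rfl
  have hPl : projector d (2 * l) ∈ homs K (2 * (l + c + 2) + r) (2 * (l + c + 2) + r) :=
    projector_mem (by omega)
  have hPs : projectors d (l + 1) c ∈ homs K (2 * (l + c + 2) + r) (2 * (l + c + 2) + r) :=
    projectors_mem (by omega)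
  have hS : shiftHom K (2 * l + 2) x ∈ homs K (2 * (l + c + 2) + r) (2 * l + 4 + r) := by
    have := shiftHom_mem_homs (2 * l + 2) (2 + r) hx
    rwa [show 2 * l + 2 + 2 * c + (2 + r) = 2 * (l + c + 2) + r by ring,
      show 2 * l + 2 + 0 + (2 + r) = 2 * l + 4 + r by ring] at this
  -- Since `x` has no upper endpoints, the last projector lands on the right leg of the loop above
  -- it. From there it crosses the maxima, descends on the left of `x`, and merges with the first
  -- projector.
  have e1 := ((hf.exchange (N := 2 * (l + c + 2) + r) hx hP (2 * l + 2) 0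
    (by omega)).symm.mul_left (mul_mem_homs hPl hPs)).mul_right (caps K (2 * l))
  have e2 := ((hf.projector_mul_caps (d := d) (N := 2 * l + 4 + r) (p := 2 * l)
    (by omega)).symm.mul_left (mul_mem_homs (mul_mem_homs hPl hPs) hS))
  have e3 := ((hf.exchange (N := 2 * (l + c + 2) + r) hP
    (mul_mem_homs (projectors_mem (d := d) (l := 0) (c := c) (by omega)) hx) (2 * l) 0
    (by omega)).symm.mul_left hPl).mul_right (caps K (2 * l))
  have e4 := (hf.projector_mul_self (N := 2 * (l + c + 2) + r) (l := 2 * l)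
    (by omega)).mul_right (shiftHom K (2 * l + 2) (projectors d 0 c * x) * caps K (2 * l))
  have hY : shiftHom K (2 * l + 2) (projectors d 0 c) = projectors d (l + 1) c :=
    shiftHom_projectors (l + 1) 0 c
  rw [projectors_succ, projectors_succ', show 2 * (l + (c + 1)) = 2 * l + 2 + 2 * c by ring,
    show 2 * (l + 1) = 2 * l + 2 from rfl]
  simp only [shiftHom_projector, add_zero, mul_assoc, map_mul (shiftHom K _), hY]
    at e1 e2 e3 e4 ⊢
  exact e1.trans (e2.trans (e3.trans e4))

/-- The loop is worth `d - d⁻¹`, and removing it lowers the valence by two. The change `s ^ (-2) =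
d⁻¹` of the vertex factor turns this into `d ^ 2 - 1`. -/
theorem phiHom_loop (hs : s ^ 2 = d) {l a c : ℕ} {X : Word} (hX : X ∈ graphDrawings c 0)
    (h : l + a ≤ N) :
    Eqv f m (2 * N)
      (phiHom d s (ι (layer l (.vertex a (c + 2))) * ι (shift (l + 1) X) * ι (cap l)))
      (phiHom d s (((d : K) ^ 2 - 1) • (ι (layer l (.vertex a c)) * ι (shift l X)))) := by
  obtain ⟨r, rfl⟩ := Nat.exists_eq_add_of_le h
  have hx := phiHom_mem_of (d := d) (s := s) hX
  have hy : projectors d 0 c * phiHom d s (ι X) ∈ homs K (2 * c) 0 :=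
    mul_mem_homs (projectors_mem (by omega)) hx
  have hL : ι (lowerHalf (2 * l) a) ∈ homs K (2 * (l + a + r)) (2 * l + 2 + 2 * r) := by
    have := lowerHalf_mem (2 * l) a (2 * r)
    rw [← mul_add, ← mul_add] at this
    exact of_mem_homs this
  have hU : ι (upperHalf (2 * l) (c + 2)) ∈
      homs K (2 * l + 2 + 2 * r) (2 * l + 2 * (c + 2) + 2 * r) :=
    of_mem_homs (upperHalf_mem (2 * l) (c + 2) (2 * r))
  have e1 := (hf.projectors_mul_shiftHom_mul_caps (l := l) (N := 2 * l + 2 * (c + 2) + 2 * r) hx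
    (by omega)).mul_left (mul_mem_homs hL hU)
  have e2 := (hf.upperHalf_mul_projector_mul (N := 2 * l + 2 + 2 * r) (p := 2 * l) hy
    (by omega)).mul_left hL
  rw [map_mul (shiftHom K (2 * l)), shiftHom_projectors, add_zero] at e2
  simp only [map_mul, map_smul, phiHom_layer, phiHom_shift, phiLayer, cap,
    map_mul ι, smul_mul_assoc, mul_smul_comm, mul_assoc, smul_smul] at e1 e2 ⊢
  refine ((e1.trans e2).smul _).trans (Eqv.of_eq ?_)
  rw [smul_smul, show (a : ℤ) + (c + 2 : ℕ) - 2 = a + c by push_cast; ring, units_zpow_sub_two hs]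
  congr 1
  have hd : (d : K) * ((d⁻¹ : Kˣ) : K) = 1 := Units.mul_inv d
  linear_combination (-(d : K) * ((s ^ ((a : ℤ) + c) : Kˣ) : K)) * hd

end CurveInvariant

end

end PlanarAlg

/-! ## The map `φ` -/

namespace PlanarAlg

noncomputable section

variable {K : Type*} [CommRing K] {A : Type*} [AddCommGroup A] [Module K A]
variable {f : MonoidAlgebra K Word →ₗ[K] A} {d s : Kˣ} {m n N : ℕ}

local notation "ι" => MonoidAlgebra.of K Word

open Classical in
/-- The linear map that takes a drawing of a graph to the value of `f` at `phiDrawing`. -/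
def phiEval (f : MonoidAlgebra K Word →ₗ[K] A) (d s : Kˣ) (n : ℕ) : MonoidAlgebra K Word →ₗ[K] A :=
  linearLift fun w => if w ∈ graphDrawings n n then f (phiDrawing d s n w) else 0

theorem phiDrawing_eq (w : Word) : phiDrawing d s n w = projectors d 0 n * phiHom d s (ι w) := by
  rw [phiHom_of]; rfl

theorem phiEval_of {w : Word} (h : w ∈ graphDrawings n n) :
    phiEval f d s n (ι w) = f (phiDrawing d s n w) := by
  rw [phiEval, linearLift_of, if_pos h]

theorem phiEval_of_notMem {w : Word} (h : w ∉ graphDrawings n n) : phiEval f d s n (ι w) = 0 := by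
  rw [phiEval, linearLift_of, if_neg h]

theorem phiEval_of_mul_mul {M : ℕ} {u v : Word} {x : MonoidAlgebra K Word} (hx : x ∈ homs K N M)
    (hu : u ∈ graphDrawings n N) (hv : v ∈ graphDrawings M n) :
    phiEval f d s n (ι u * x * ι v) =
      f (projectors d 0 n * phiHom d s (ι u) * phiHom d s x * phiHom d s (ι v)) := by
  induction hx using Submodule.span_induction with
  | mem x hx =>
    obtain ⟨w, hw, rfl⟩ := hx
    rw [← map_mul ι, ← map_mul ι,
      phiEval_of (mul_mem_graphDrawings (mul_mem_graphDrawings hu hw) hv), phiDrawing_eq, map_mul ι,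
      map_mul ι, map_mul (phiHom d s), map_mul (phiHom d s)]
    simp only [mul_assoc]
  | zero => simp only [mul_zero, zero_mul, map_zero]
  | add x y _ _ hx hy => simp only [mul_add, add_mul, map_add, hx, hy]
  | smul c x _ hx => simp only [mul_smul_comm, smul_mul_assoc, map_smul, hx]

theorem phiEval_of_mul_mul_of_notMem {M : ℕ} {u v : Word} {x : MonoidAlgebra K Word}
    (hx : x ∈ homs K N M) (hu : u ∈ graphDrawings n N) (hv : v ∉ graphDrawings M n) :
    phiEval f d s n (ι u * x * ι v) = 0 := by
  induction hx using Submodule.span_induction with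
  | mem x hx =>
    obtain ⟨w, hw, rfl⟩ := hx
    rw [← map_mul ι, ← map_mul ι, phiEval_of_notMem]
    rwa [mul_mem_graphDrawings_iff (mul_mem_graphDrawings hu hw)]
  | zero => simp only [mul_zero, zero_mul, map_zero]
  | add x y _ _ hx hy => simp only [mul_add, add_mul, map_add, hx, hy, add_zero]
  | smul c x _ hx => simp only [mul_smul_comm, smul_mul_assoc, map_smul, hx, smul_zero]

namespace CurveInvariant

section

variable (hf : CurveInvariant f (d : K) (2 * n))
include hf

/-- The row of projectors required by the local relation is created above `u` and absorbed again
afterwards. -/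
theorem projectors_mul_phiHom_congr {u : Word} {x y : MonoidAlgebra K Word}
    (hu : u ∈ graphDrawings n N)
    (h : Eqv f (2 * n) (2 * N) (projectors d 0 N * x) (projectors d 0 N * y)) :
    Eqv f (2 * n) (2 * n) (projectors d 0 n * phiHom d s (ι u) * x)
      (projectors d 0 n * phiHom d s (ι u) * y) := by
  have e := hf.projectors_mul_phiHom_mul (s := s) hu
  have e' := h.mul_left (mul_mem_homs (projectors_mem (d := d) (l := 0) (c := n) (by omega))
    (phiHom_mem_of (d := d) (s := s) hu))
  simp only [← mul_assoc] at e'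
  exact (e.mul_right x).symm.trans (e'.trans (e.mul_right y))

theorem eqv_phiEval {M : ℕ} {x y : MonoidAlgebra K Word} (hx : x ∈ homs K N M)
    (hy : y ∈ homs K N M) (h : Eqv f (2 * n) (2 * N) (projectors d 0 N * phiHom d s x)
      (projectors d 0 N * phiHom d s y)) : Eqv (phiEval f d s n) n N x y := by
  refine Eqv.of_words fun u hu v => ?_
  by_cases hv : v ∈ graphDrawings M n
  · rw [phiEval_of_mul_mul hx hu hv, phiEval_of_mul_mul hy hu hv]
    exact ((hf.projectors_mul_phiHom_congr hu h).mul_right _).apply_one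
  · rw [phiEval_of_mul_mul_of_notMem hx hu hv, phiEval_of_mul_mul_of_notMem hy hu hv]

theorem eqv_phiEval' {M : ℕ} {x y : MonoidAlgebra K Word} (hx : x ∈ homs K N M)
    (hy : y ∈ homs K N M) (h : Eqv f (2 * n) (2 * N) (phiHom d s x) (phiHom d s y)) :
    Eqv (phiEval f d s n) n N x y :=
  hf.eqv_phiEval hx hy (h.mul_left (projectors_mem (by omega)))

theorem phiEval_isotopyInvariant : IsotopyInvariant (phiEval f d s n) n where
  eq_zero _ h := phiEval_of_notMem h
  move u v x y h hx hy := by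
    rw [phiEval_of hx, phiEval_of hy, phiDrawing_eq, phiDrawing_eq]
    obtain ⟨M, hM, -⟩ := exists_of_mul_mem_graphDrawings hx
    obtain ⟨N, hu, hx'⟩ := exists_of_mul_mem_graphDrawings hM
    obtain ⟨M', hM', -⟩ := exists_of_mul_mem_graphDrawings hy
    have hy' := (mul_mem_graphDrawings_iff hu).mp hM'
    have := ((hf.projectors_mul_phiHom_congr (s := s) hu
      (hf.phiHom_move (s := s) h hx' hy')).mul_right (phiHom d s (ι v))).apply_one
    simpa only [map_mul ι, map_mul, mul_assoc] using this

theorem phiEval_chromaticInvariant (hs : s ^ 2 = d) :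
    ChromaticInvariant (phiEval f d s n) ((d : K) ^ 2) n where
  toIsotopyInvariant := hf.phiEval_isotopyInvariant
  contract {N l a b} h := by
    obtain ⟨r, rfl⟩ := Nat.exists_eq_add_of_le h
    have hv : ∀ {i j}, ι (PlanarAlg.vertex l i j) ∈ homs K (l + i + r) (l + j + r) :=
      fun {i j} => of_mem_homs (vertex_mem (by omega) (by omega))
    exact hf.eqv_phiEval' (mul_mem_homs hv hv) (sub_mem hv (mul_mem_homs hv hv))
      (Eqv.of_eq (phiHom_contract hs l a b))
  loop {N l a c X} hX h := by
    obtain ⟨r, rfl⟩ := Nat.exists_eq_add_of_le h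
    refine hf.eqv_phiEval' (M := l + r) ?_ ?_ (hf.phiHom_loop hs hX h)
    · exact mul_mem_homs (mul_mem_homs (m := l + 1 + c + (1 + r))
        (of_mem_homs (vertex_mem (by omega) (by omega)))
        (of_mem_homs (shift_mem_graphDrawings (l + 1) (1 + r) hX)))
        (of_mem_homs (cap_mem (by omega) (by omega)))
    · exact Submodule.smul_mem _ _ (mul_mem_homs (m := l + c + r)
        (of_mem_homs (vertex_mem (by omega) (by omega)))
        (of_mem_homs (shift_mem_graphDrawings l r hX)))
  circle {N l X} hX h := by
    obtain ⟨r, rfl⟩ := Nat.exists_eq_add_of_le h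
    refine hf.eqv_phiEval' (M := l + r) ?_ ?_ (hf.phiHom_circle hX h)
    · exact mul_mem_homs (mul_mem_homs (m := l + 1 + 0 + (1 + r))
        (of_mem_homs (cup_mem (by omega) (by omega)))
        (of_mem_homs (shift_mem_graphDrawings (l + 1) (1 + r) hX)))
        (of_mem_homs (cap_mem (by omega) (by omega)))
    · exact Submodule.smul_mem _ _ (of_mem_homs (shift_mem_graphDrawings l r hX))
  leaf {N l} h := hf.eqv_phiEval' (M := N + 1) (of_mem_homs (vertex_mem (by omega) (by omega)))
    (zero_mem _) (by rw [map_zero]; exact hf.phiHom_leaf h)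
  smooth {N l} h := hf.eqv_phiEval (of_mem_homs (vertex_mem (by omega) (by omega)))
    (one_mem_homs _) (hf.phiHom_smooth h)
  isolated {N l} h := hf.eqv_phiEval' (of_mem_homs (vertex_mem (by omega) (by omega)))
    (one_mem_homs _) (hf.phiHom_isolated hs h)

end

end CurveInvariant

/-! ### Products -/

theorem ChromaticAlgebra.induction_graph {Q : K} {p : ChromaticAlgebra Q n → Prop}
    (x : ChromaticAlgebra Q n) (h : ∀ w (hw : w ∈ graphDrawings n n), p (graph Q n hw))
    (hadd : ∀ x y, p x → p y → p (x + y)) (hsmul : ∀ (c : K) x, p x → p (c • x)) : p x := by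
  obtain ⟨x, rfl⟩ := RingQuot.mkAlgHom_surjective K (ChromaticRel Q n) x
  induction x using induction_of with
  | h x =>
    obtain ⟨⟨w, hw⟩, rfl⟩ := Con.mk'_surjective x
    exact h w hw
  | hadd x y hx hy => rw [map_add]; exact hadd _ _ hx hy
  | hsmul c x hx => rw [map_smul]; exact hsmul _ _ hx

theorem ChromaticAlgebra.graph_mul_graph {Q : K} {w w' : Word} (h : w ∈ graphDrawings n n)
    (h' : w' ∈ graphDrawings n n) : graph Q n h * graph Q n h' =
      graph Q n (mul_mem_graphDrawings h h') := by
  rw [graph, graph, graph, ← map_mul, gr, gr, ← map_mul, ← map_mul]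
  rfl

theorem TemperleyLieb.curve_mul_curve {c : K} {w w' : Word} (h : w ∈ curveDrawings m m)
    (h' : w' ∈ curveDrawings m m) : curve c m h * curve c m h' =
      curve c m ((curveMonoid m).mul_mem h h') := by
  unfold curve
  rw [← map_mul, cv, cv, ← map_mul, ← map_mul]
  rfl

/-- Membership in `homs K m m` is essential: words of other widths are sent to zero, although their
product may be a valid drawing. -/
theorem ofCurves_mul {c : K} {x y : MonoidAlgebra K Word} (hx : x ∈ homs K m m)
    (hy : y ∈ homs K m m) : ofCurves c m (x * y) = ofCurves c m x * ofCurves c m y := by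
  induction hx using Submodule.span_induction with
  | mem x hx =>
    obtain ⟨w, hw, rfl⟩ := hx
    induction hy using Submodule.span_induction with
    | mem y hy =>
      obtain ⟨w', hw', rfl⟩ := hy
      rw [← map_mul ι]
      by_cases h : w * w' ∈ curveDrawings m m
      · have h1 : w ∈ curveDrawings m m := ⟨hw, fun z hz => h.2 z (by
          rw [FreeMonoid.toList_mul]; exact List.mem_append_left _ hz)⟩
        have h2 : w' ∈ curveDrawings m m := ⟨hw', fun z hz => h.2 z (by
          rw [FreeMonoid.toList_mul]; exact List.mem_append_right _ hz)⟩
        rw [ofCurves_of h, ofCurves_of h1, ofCurves_of h2, TemperleyLieb.curve_mul_curve]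
      · rw [ofCurves_of_notMem h]
        by_cases h1 : w ∈ curveDrawings m m
        · rw [ofCurves_of_notMem fun h2 => h ((curveMonoid m).mul_mem h1 h2), mul_zero]
        · rw [ofCurves_of_notMem h1, zero_mul]
    | zero => simp only [mul_zero, map_zero]
    | add x y _ _ hx hy => simp only [mul_add, map_add, hx, hy]
    | smul c x _ hx => simp only [mul_smul_comm, map_smul, hx]
  | zero => simp only [zero_mul, map_zero]
  | add x y _ _ hx hy => simp only [add_mul, map_add, hx, hy]
  | smul c x _ hx => simp only [smul_mul_assoc, map_smul, hx]

/-- The two sides differ by the row of projectors between the factors, which is free. -/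
theorem ofCurves_phiDrawing_mul {w w' : Word} (h : w ∈ graphDrawings n n)
    (h' : w' ∈ graphDrawings n n) :
    ofCurves (d : K) (2 * n) (phiDrawing d s n (w * w')) =
      ofCurves (d : K) (2 * n) (phiDrawing d s n w) *
        ofCurves (d : K) (2 * n) (phiDrawing d s n w') := by
  have hP : projectors d 0 n ∈ homs K (2 * n) (2 * n) := projectors_mem (by omega)
  rw [phiDrawing_eq, phiDrawing_eq, phiDrawing_eq, ← ofCurves_mul
    (mul_mem_homs hP (phiHom_mem_of h)) (mul_mem_homs hP (phiHom_mem_of h'))]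
  have := (((ofCurves_curveInvariant (d : K) (2 * n)).projectors_mul_phiHom_mul (s := s)
    h).symm.mul_right (phiHom d s (ι w'))).apply_one
  simpa only [map_mul ι, map_mul, mul_assoc] using this

end

end PlanarAlg

/-! ### The homomorphism and its left inverse -/

theorem mainTheorem7 {K : Type*} [CommRing K] (d s : Kˣ) (hs : s ^ 2 = d) (n : ℕ) :
    ∃ φ : PlanarAlg.ChromaticAlgebra ((d : K) ^ 2) n →ₙₐ[K]
        PlanarAlg.TemperleyLieb (d : K) (2 * n),
      (∀ (w : PlanarAlg.Word) (hw : w ∈ PlanarAlg.graphDrawings n n),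
        φ (PlanarAlg.ChromaticAlgebra.graph ((d : K) ^ 2) n hw) =
          PlanarAlg.TemperleyLieb.ofDrawings (d : K) (2 * n)
            (PlanarAlg.phiDrawing d s n w)) ∧
      Function.Injective φ := by
  open PlanarAlg in
  obtain ⟨G, hG⟩ := exists_linearMap_chromaticAlgebra (A := TemperleyLieb (d : K) (2 * n))
    ((ofCurves_curveInvariant (d : K) (2 * n)).phiEval_chromaticInvariant hs)
  replace hG : ∀ (w : Word) (hw : w ∈ graphDrawings n n),
      G (ChromaticAlgebra.graph ((d : K) ^ 2) n hw) =
        ofCurves (d : K) (2 * n) (phiDrawing d s n w) :=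
    fun w hw => (hG w hw).trans (phiEval_of hw)
  have hmul : ∀ x y, G (x * y) = G x * G y := by
    intro x y
    induction x using ChromaticAlgebra.induction_graph with
    | h w hw =>
      induction y using ChromaticAlgebra.induction_graph with
      | h w' hw' =>
        rw [ChromaticAlgebra.graph_mul_graph, hG, hG, hG, ofCurves_phiDrawing_mul hw hw']
      | hadd x y hx hy => rw [mul_add, map_add, map_add, hx, hy, mul_add]
      | hsmul c x hx => rw [mul_smul_comm, map_smul, map_smul, hx, mul_smul_comm]
    | hadd x y hx hy => rw [add_mul, map_add, map_add, hx, hy, add_mul]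
    | hsmul c x hx => rw [smul_mul_assoc, map_smul, map_smul, hx, smul_mul_assoc]
  have hinj : Function.Injective G := by
    -- The state sum is written in terms of `s` alone, with circle value `s ^ 2` and chromatic
    -- parameter `(s ^ 2) ^ 2`.
    subst hs
    obtain ⟨L, hL⟩ := exists_linearMap_temperleyLieb (stateEval_curveInvariant (K := K) s n)
    refine Function.LeftInverse.injective (g := L) fun x => ?_
    induction x using ChromaticAlgebra.induction_graph with
    | h w hw => rw [hG, hL, stateEval_phiDrawing rfl hw]
    | hadd x y hx hy => rw [map_add, map_add, hx, hy]
    | hsmul c x hx => rw [map_smul, map_smul, hx]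
  -- `ofCurves` unfolds to `TemperleyLieb.ofDrawings`, so `hG` is already the required formula.
  exact ⟨{ G with
    map_zero' := map_zero G
    map_mul' := hmul }, hG, hinj⟩
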